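/- Let $M$ be a complex manifold with a half-flat holomorphic Grassmann structure: an isomorphism of holomorphic vector bundles $T^*M\cong E\otimes H$ (so $TM\cong E^*\otimes H^*$) with $\operatorname{rank}H=2$, together with a holomorphic linear connection $\nabla=\nabla^E\otimes\mathrm{Id}+\mathrm{Id}\otimes\nabla^H$, where $\nabla^E,\nabla^H$ are holomorphic connections in $E,H$ and $\nabla^H$ is flat. Fix a $\nabla^H$-parallel nondegenerate fibrewise two-form $\omega_H\in\Gamma(\wedge^2H)$ on $H^*$. Let $$S_H=\{(x,h_+,h_-)\;:\;x\in M,\ h_\pm\in H_x^*,\ \omega_H(h_+,h_-)=1\}\subset H^*\oplus H^*$$ be the harmonic space, and let $\mathcal D_+$ (resp. $\mathcal D_-$) be the holomorphic distribution on $S_H$ whose fibre at $(x,h_+,h_-)$ is spanned by the $\nabla^H$-horizontal lifts of the tangent vectors $e\otimes h_+$ (resp. $e\otimes h_-$) of $M$, $e\in E_x^*$. A distribution is called integrable (in the sense of Frobenius) if the Lie bracket of any two of its local holomorphic sections is again a section of it. Identifying $H^*$ with $H$ by means of $\omega_H$, we have $$TM\otimes\wedge^2T^*M\;\cong\;E^*\otimes\wedge^2E\otimes\bigl(S^3H\oplus\omega_H\otimes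 H\bigr)\;\oplus\;E^*\otimes S^2E\otimes\omega_H\otimes H ,$$ and the connection $\nabla$ is called admissible if its torsion has no component in $E^*\otimes\wedge^2E\otimes S^3H$. Then the following conditions are equivalent: 1. for every open set $U\subset M$ and every $\nabla^H$-parallel section $h$ of $H^*$ over $U$, the distribution $E^*\otimes h$ on $U$ is integrable; 2. the distribution $\mathcal D_+$ on $S_H$ is integrable; 3. the distribution $\mathcal D_-$ on $S_H$ is integrable; 4. the connection $\nabla$ is admissible. -/

import Mathlib

open Bundle
open scoped Manifold ContDiff Topology TensorProduct

noncomputable section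

/-! ### Distributions and their integrability -/

/-- Let `S` be a complex submanifold of the complex manifold `N` (for instance an open subset of
`N`) and let `D` be a distribution on `S`, given by its fibres `D y ⊆ T_y S ⊆ T_y N` for `y ∈ S`.
Integrability of `D` in the sense of Frobenius: the Lie bracket of any two local holomorphic
vector fields with values in `D` has again values in `D`.

Local holomorphic vector fields on `S` are described by their local holomorphic extensions to `N`;
as they are tangent to `S`, their Lie bracket on `S` is the restriction of the bracket of the
extensions. -/
def IsIntegrableDistribution {B : Type*} [NormedAddCommGroup B] [NormedSpace ℂ B]
    {K : Type*} [TopologicalSpace K] (I : ModelWithCorners ℂ B K)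
    {N : Type*} [TopologicalSpace N] [ChartedSpace K N] [IsManifold I ω N]
    (S : Set N) (D : ∀ y : N, Submodule ℂ (TangentSpace I y)) : Prop :=
  ∀ X Y : ∀ y : N, TangentSpace I y, ∀ s ∈ S,
    ContMDiffAt I I.tangent ω (fun y ↦ (⟨y, X y⟩ : TangentBundle I N)) s →
    ContMDiffAt I I.tangent ω (fun y ↦ (⟨y, Y y⟩ : TangentBundle I N)) s →
    (∀ᶠ y in 𝓝[S] s, X y ∈ D y) →
    (∀ᶠ y in 𝓝[S] s, Y y ∈ D y) →
    VectorField.mlieBracket I X Y s ∈ D s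

/-! ### Holomorphic connections -/

section Connections

variable {V : Type*} [NormedAddCommGroup V] [NormedSpace ℂ V]
  {M : Type*} [TopologicalSpace M] [ChartedSpace V M]
  {F : Type*} [NormedAddCommGroup F] [NormedSpace ℂ F]
  {W : M → Type*} [TopologicalSpace (TotalSpace F W)]
  [∀ x, AddCommGroup (W x)] [∀ x, Module ℂ (W x)] [∀ x, TopologicalSpace (W x)]
  [∀ x, IsTopologicalAddGroup (W x)] [∀ x, ContinuousSMul ℂ (W x)]
  [FiberBundle F W]

variable (V F) in
/-- The section `σ` of the bundle `W` is holomorphic near the point `x`. -/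
def HolomorphicSectionAt (σ : ∀ y : M, W y) (x : M) : Prop :=
  ContMDiffAt 𝓘(ℂ, V) (𝓘(ℂ, V).prod 𝓘(ℂ, F)) ω (fun y ↦ (⟨y, σ y⟩ : TotalSpace F W)) x

/-- A connection is holomorphic if it maps local holomorphic sections, on any open set, to local
holomorphic sections. -/
def IsHolomorphicConnection [IsManifold 𝓘(ℂ, V) 1 M] [VectorBundle ℂ F W]
    (cov : CovariantDerivative 𝓘(ℂ, V) F W) : Prop :=
  ∀ U : Set M, IsOpen U → ContMDiffCovariantDerivativeOn F ω cov U

/-- A connection is flat if its curvature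
`R(X, Y) σ = ∇_X ∇_Y σ - ∇_Y ∇_X σ - ∇_{[X, Y]} σ` vanishes. -/
def IsFlatConnection [IsManifold 𝓘(ℂ, V) 1 M]
    (cov : CovariantDerivative 𝓘(ℂ, V) F W) : Prop :=
  ∀ (x : M) (X Y : ∀ y : M, TangentSpace 𝓘(ℂ, V) y) (σ : ∀ y : M, W y),
    HolomorphicSectionAt V V X x → HolomorphicSectionAt V V Y x →
    HolomorphicSectionAt V F σ x →
    cov (fun y ↦ cov σ y (Y y)) x (X x) - cov (fun y ↦ cov σ y (X y)) x (Y x)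
      - cov σ x (VectorField.mlieBracket 𝓘(ℂ, V) X Y x) = 0

/-- `IsDualDeriv cov η x X ζ` says that `∇_X η = ζ` at `x`, where `η` is a section of the dual
bundle `W*` and `∇` is the connection in `W*` induced by the connection `cov` in `W`, that is,
`X(η(σ)) = (∇_X η)(σ) + η(∇_X σ)` for all local sections `σ` of `W`. -/
def IsDualDeriv (cov : CovariantDerivative 𝓘(ℂ, V) F W) (η : ∀ y : M, Module.Dual ℂ (W y)) (x : M)
    (X : TangentSpace 𝓘(ℂ, V) x) (ζ : Module.Dual ℂ (W x)) : Prop :=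
  ∀ σ : ∀ y : M, W y, HolomorphicSectionAt V F σ x →
    mvfderiv 𝓘(ℂ, V) (fun y ↦ η y (σ y)) x X = ζ (σ x) + η x (cov σ x X)

theorem finite_fiber [VectorBundle ℂ F W] [FiniteDimensional ℂ F] (x : M) :
    Module.Finite ℂ (W x) :=
  Module.Finite.equiv ((trivializationAt F W x).continuousLinearEquivAt ℂ x
    (mem_baseSet_trivializationAt F W x)).symm.toLinearEquiv

end Connections

/-! ### Half-flat Grassmann manifolds -/

section Grassmann

variable (V : Type*) [NormedAddCommGroup V] [NormedSpace ℂ V] [FiniteDimensional ℂ V]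
  (M : Type*) [TopologicalSpace M] [ChartedSpace V M] [IsManifold 𝓘(ℂ, V) ω M]
  (FE : Type*) [NormedAddCommGroup FE] [NormedSpace ℂ FE] [FiniteDimensional ℂ FE]
  (E : M → Type*) [TopologicalSpace (TotalSpace FE E)]
  [∀ x, AddCommGroup (E x)] [∀ x, Module ℂ (E x)] [∀ x, TopologicalSpace (E x)]
  [∀ x, IsTopologicalAddGroup (E x)] [∀ x, ContinuousSMul ℂ (E x)]
  [FiberBundle FE E] [VectorBundle ℂ FE E] [ContMDiffVectorBundle ω FE E 𝓘(ℂ, V)]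
  (FH : Type*) [NormedAddCommGroup FH] [NormedSpace ℂ FH] [FiniteDimensional ℂ FH]
  (H : M → Type*) [TopologicalSpace (TotalSpace FH H)]
  [∀ x, AddCommGroup (H x)] [∀ x, Module ℂ (H x)] [∀ x, TopologicalSpace (H x)]
  [∀ x, IsTopologicalAddGroup (H x)] [∀ x, ContinuousSMul ℂ (H x)]
  [FiberBundle FH H] [VectorBundle ℂ FH H] [ContMDiffVectorBundle ω FH H 𝓘(ℂ, V)]

/-- A half-flat Grassmann manifold: a complex manifold `M` with a holomorphic isomorphism
`T*M = E ⊗ H`, a holomorphic linear connection `∇ = ∇^E ⊗ Id + Id ⊗ ∇^H` with `∇^H` flat, and a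
fixed `∇^H`-parallel nondegenerate fibrewise 2-form `ω_H ∈ Γ(∧²H)` in the bundle `H*`. -/
structure HalfFlatGrassmannManifold where
  /-- The isomorphism `E ⊗ H ≅ T*M`. -/
  iso : ∀ x : M, E x ⊗[ℂ] H x ≃ₗ[ℂ] Module.Dual ℂ (TangentSpace 𝓘(ℂ, V) x)
  /-- The isomorphism is holomorphic: `e ⊗ h` is a holomorphic one-form for local holomorphic
  sections `e` and `h`. -/
  iso_holomorphic : ∀ (x : M) (e : ∀ y, E y) (h : ∀ y, H y) (Y : ∀ y : M, TangentSpace 𝓘(ℂ, V) y),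
    HolomorphicSectionAt V FE e x → HolomorphicSectionAt V FH h x → HolomorphicSectionAt V V Y x →
    ContMDiffAt 𝓘(ℂ, V) 𝓘(ℂ, ℂ) ω (fun y ↦ iso y (e y ⊗ₜ[ℂ] h y) (Y y)) x
  /-- The connection in `E`. -/
  nablaE : CovariantDerivative 𝓘(ℂ, V) FE E
  /-- The connection in `H`. -/
  nablaH : CovariantDerivative 𝓘(ℂ, V) FH H
  /-- The linear connection on `M`. -/
  nabla : CovariantDerivative 𝓘(ℂ, V) V (fun x : M ↦ TangentSpace 𝓘(ℂ, V) x)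
  nablaE_holomorphic : IsHolomorphicConnection nablaE
  nablaH_holomorphic : IsHolomorphicConnection nablaH
  nabla_holomorphic : IsHolomorphicConnection nabla
  /-- On `T*M`, `∇_X (e ⊗ h) = ∇^E_X e ⊗ h + e ⊗ ∇^H_X h`. -/
  nabla_eq : ∀ (x : M) (e : ∀ y, E y) (h : ∀ y, H y) (X : TangentSpace 𝓘(ℂ, V) x),
    HolomorphicSectionAt V FE e x → HolomorphicSectionAt V FH h x →
    IsDualDeriv nabla (fun y ↦ iso y (e y ⊗ₜ[ℂ] h y)) x X
      (iso x (nablaE e x X ⊗ₜ[ℂ] h x + e x ⊗ₜ[ℂ] nablaH h x X))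
  flat : IsFlatConnection nablaH
  /-- The two-form `ω_H` on the fibres of `H*`. -/
  omega : ∀ x : M, LinearMap.BilinForm ℂ (Module.Dual ℂ (H x))
  omega_alt : ∀ x, (omega x).IsAlt
  omega_nondegenerate : ∀ x, (omega x).Nondegenerate
  omega_holomorphic : ∀ (x : M) (η ξ : ∀ y, H y →L[ℂ] Bundle.Trivial M ℂ y),
    HolomorphicSectionAt V (FH →L[ℂ] ℂ) η x → HolomorphicSectionAt V (FH →L[ℂ] ℂ) ξ x →
    ContMDiffAt 𝓘(ℂ, V) 𝓘(ℂ, ℂ) ω (fun y ↦ omega y (η y).toLinearMap (ξ y).toLinearMap) x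
  /-- `X(ω_H(η, ξ)) = ω_H(∇_X η, ξ) + ω_H(η, ∇_X ξ)` for local sections `η, ξ` of `H*`. -/
  omega_parallel : ∀ (x : M) (η ξ : ∀ y, H y →L[ℂ] Bundle.Trivial M ℂ y)
    (X : TangentSpace 𝓘(ℂ, V) x) (η' ξ' : Module.Dual ℂ (H x)),
    HolomorphicSectionAt V (FH →L[ℂ] ℂ) η x → HolomorphicSectionAt V (FH →L[ℂ] ℂ) ξ x →
    IsDualDeriv nablaH (fun y ↦ (η y).toLinearMap) x X η' →
    IsDualDeriv nablaH (fun y ↦ (ξ y).toLinearMap) x X ξ' →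
    mvfderiv 𝓘(ℂ, V) (fun y ↦ omega y (η y).toLinearMap (ξ y).toLinearMap) x X
      = omega x η' (ξ x).toLinearMap + omega x (η x).toLinearMap ξ'

end Grassmann

namespace HalfFlatGrassmannManifold

variable {V : Type*} [NormedAddCommGroup V] [NormedSpace ℂ V] [FiniteDimensional ℂ V]
  {M : Type*} [TopologicalSpace M] [ChartedSpace V M] [IsManifold 𝓘(ℂ, V) ω M]
  {FE : Type*} [NormedAddCommGroup FE] [NormedSpace ℂ FE] [FiniteDimensional ℂ FE]
  {E : M → Type*} [TopologicalSpace (TotalSpace FE E)]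
  [∀ x, AddCommGroup (E x)] [∀ x, Module ℂ (E x)] [∀ x, TopologicalSpace (E x)]
  [∀ x, IsTopologicalAddGroup (E x)] [∀ x, ContinuousSMul ℂ (E x)]
  [FiberBundle FE E] [VectorBundle ℂ FE E] [ContMDiffVectorBundle ω FE E 𝓘(ℂ, V)]
  {FH : Type*} [NormedAddCommGroup FH] [NormedSpace ℂ FH] [FiniteDimensional ℂ FH]
  {H : M → Type*} [TopologicalSpace (TotalSpace FH H)]
  [∀ x, AddCommGroup (H x)] [∀ x, Module ℂ (H x)] [∀ x, TopologicalSpace (H x)]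
  [∀ x, IsTopologicalAddGroup (H x)] [∀ x, ContinuousSMul ℂ (H x)]
  [FiberBundle FH H] [VectorBundle ℂ FH H] [ContMDiffVectorBundle ω FH H 𝓘(ℂ, V)]

variable (G : HalfFlatGrassmannManifold V M FE E FH H)

/-- The isomorphism `TM = E* ⊗ H*` dual to `T*M = E ⊗ H`. -/
def tangentEquiv (x : M) :
    Module.Dual ℂ (E x) ⊗[ℂ] Module.Dual ℂ (H x) ≃ₗ[ℂ] TangentSpace 𝓘(ℂ, V) x :=
  haveI : Module.Finite ℂ (E x) := finite_fiber (F := FE) x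
  haveI : Module.Finite ℂ (H x) := finite_fiber (F := FH) x
  haveI : Module.Finite ℂ (TangentSpace 𝓘(ℂ, V) x) := inferInstanceAs (Module.Finite ℂ V)
  TensorProduct.dualDistribEquiv ℂ (E x) (H x) ≪≫ₗ (G.iso x).symm.dualMap ≪≫ₗ
    (Module.evalEquiv ℂ (TangentSpace 𝓘(ℂ, V) x)).symm

/-- The defining property of `e ⊗ h ∈ T_x M`: its pairing with `ε ⊗ κ ∈ T*_x M` is
`e(ε) h(κ)`. -/
theorem iso_tangentEquiv (x : M) (e : Module.Dual ℂ (E x)) (h : Module.Dual ℂ (H x))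
    (ε : E x) (κ : H x) :
    G.iso x (ε ⊗ₜ[ℂ] κ) (G.tangentEquiv x (e ⊗ₜ[ℂ] h)) = e ε * h κ := by
  have : Module.Finite ℂ (E x) := finite_fiber (F := FE) x
  have : Module.Finite ℂ (H x) := finite_fiber (F := FH) x
  have : Module.Finite ℂ (TangentSpace 𝓘(ℂ, V) x) := inferInstanceAs (Module.Finite ℂ V)
  simp only [tangentEquiv, LinearEquiv.trans_apply, Module.apply_evalEquiv_symm_apply]
  simp [TensorProduct.dualDistribEquiv, TensorProduct.dualDistribEquivOfBasis]

/-- The subspace `E*_x ⊗ h ⊆ T_x M` for `h ∈ H*_x`. -/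
def leafSpace (x : M) (h : Module.Dual ℂ (H x)) : Submodule ℂ (TangentSpace 𝓘(ℂ, V) x) :=
  LinearMap.range ((G.tangentEquiv x).toLinearMap ∘ₗ
    (TensorProduct.mk ℂ (Module.Dual ℂ (E x)) (Module.Dual ℂ (H x))).flip h)

/-- The section `η` of `H*` satisfies `∇^H η = 0` at the point `x`. -/
def IsParallelAt (η : ∀ y, H y →L[ℂ] Bundle.Trivial M ℂ y) (x : M) : Prop :=
  ∀ X : TangentSpace 𝓘(ℂ, V) x, IsDualDeriv G.nablaH (fun y ↦ (η y).toLinearMap) x X 0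

/-- `η` is a holomorphic parallel section of `H*` over the set `U`. -/
def IsParallelOn (η : ∀ y, H y →L[ℂ] Bundle.Trivial M ℂ y) (U : Set M) : Prop :=
  ∀ x ∈ U, HolomorphicSectionAt V (FH →L[ℂ] ℂ) η x ∧ G.IsParallelAt η x

variable (M FH H) in
/-- The total space of the holomorphic vector bundle `H* ⊕ H*`; its points are triples
`(x, h_+, h_-)` with `h_+, h_- ∈ H*_x`. -/
abbrev DualPairs : Type _ :=
  TotalSpace ((FH →L[ℂ] ℂ) × (FH →L[ℂ] ℂ))
    ((fun y ↦ H y →L[ℂ] Bundle.Trivial M ℂ y) ×ᵇ (fun y ↦ H y →L[ℂ] Bundle.Trivial M ℂ y))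

variable (V FH) in
/-- The model with corners of the complex manifold `H* ⊕ H*`. -/
abbrev dualPairsModel : ModelWithCorners ℂ (V × ((FH →L[ℂ] ℂ) × (FH →L[ℂ] ℂ)))
    (ModelProd V ((FH →L[ℂ] ℂ) × (FH →L[ℂ] ℂ))) :=
  𝓘(ℂ, V).prod 𝓘(ℂ, (FH →L[ℂ] ℂ) × (FH →L[ℂ] ℂ))

/-- Harmonic space `S_H = {(h_+, h_-) | ω_H(h_+, h_-) = 1}`, the submanifold of `H* ⊕ H*` formed
by the symplectic bases of the fibres of `H*`. -/
def harmonicSpace : Set (DualPairs M FH H) :=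
  {s | G.omega s.proj s.2.1.toLinearMap s.2.2.toLinearMap = 1}

/-- `v ∈ T_s (H* ⊕ H*)` is the horizontal lift of `Y ∈ T_x M` to the point `s` over `x` with
respect to `∇^H`: it is the derivative in the direction `Y` of a local holomorphic section
`(η_+, η_-)` through `s` with `∇^H η_± = 0` at `x`. -/
def IsHorizontalLift (s : DualPairs M FH H) (Y : TangentSpace 𝓘(ℂ, V) s.proj)
    (v : TangentSpace (dualPairsModel V FH) s) : Prop :=
  ∃ ηp ηm : ∀ y, H y →L[ℂ] Bundle.Trivial M ℂ y,
    HolomorphicSectionAt V (FH →L[ℂ] ℂ) ηp s.proj ∧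
    HolomorphicSectionAt V (FH →L[ℂ] ℂ) ηm s.proj ∧
    G.IsParallelAt ηp s.proj ∧ G.IsParallelAt ηm s.proj ∧
    tangentMap 𝓘(ℂ, V) (dualPairsModel V FH)
      (fun y ↦ (⟨y, (ηp y, ηm y)⟩ : DualPairs M FH H)) ⟨s.proj, Y⟩ = ⟨s, v⟩

/-- The fibre at `s = (x, h_+, h_-)` of the distribution `D_+`, spanned by the vectors `X_+^e`,
the horizontal lifts of `e ⊗ h_+`, `e ∈ E*_x`. (For `s ∈ S_H` it is tangent to `S_H`, since `ω_H`
is parallel.) -/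
def Dplus (s : DualPairs M FH H) : Submodule ℂ (TangentSpace (dualPairsModel V FH) s) :=
  Submodule.span ℂ {v | ∃ e : Module.Dual ℂ (E s.proj),
    G.IsHorizontalLift s (G.tangentEquiv s.proj (e ⊗ₜ[ℂ] s.2.1.toLinearMap)) v}

/-- The fibre at `s = (x, h_+, h_-)` of the distribution `D_-`, spanned by the vectors `X_-^e`,
the horizontal lifts of `e ⊗ h_-`, `e ∈ E*_x`. -/
def Dminus (s : DualPairs M FH H) : Submodule ℂ (TangentSpace (dualPairsModel V FH) s) :=
  Submodule.span ℂ {v | ∃ e : Module.Dual ℂ (E s.proj),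
    G.IsHorizontalLift s (G.tangentEquiv s.proj (e ⊗ₜ[ℂ] s.2.2.toLinearMap)) v}

/-- The torsion tensor of the linear connection `∇`. -/
def torsion (x : M) (X Y : TangentSpace 𝓘(ℂ, V) x) : TangentSpace 𝓘(ℂ, V) x :=
  haveI : CompleteSpace V := FiniteDimensional.complete ℂ V
  G.nabla.torsion x X Y

/-- The contraction of a tangent vector `v ∈ T_x M = E*_x ⊗ H*_x` with `ε ∈ E_x`, an element
of `H*_x`. -/
def contract (x : M) (ε : E x) (v : TangentSpace 𝓘(ℂ, V) x) : Module.Dual ℂ (H x) :=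
  (LinearMap.applyₗ v) ∘ₗ (G.iso x).toLinearMap ∘ₗ (TensorProduct.mk ℂ (E x) (H x) ε)

/-- The torsion at `x` as an element of `E* ⊗ E ⊗ E ⊗ H ⊗ H ⊗ H`, where the factor `H*` of
`TM = E* ⊗ H*` is identified with `H` by means of `ω_H`. It is evaluated on `ε ∈ E_x`,
`e, e' ∈ E*_x` and `h 0, h 1, h 2 ∈ H*_x`. -/
def torsionTensor (x : M) (ε : E x) (e e' : Module.Dual ℂ (E x))
    (h : Fin 3 → Module.Dual ℂ (H x)) : ℂ :=
  G.omega x (G.contract x ε (G.torsion x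
    (G.tangentEquiv x (e ⊗ₜ[ℂ] h 0)) (G.tangentEquiv x (e' ⊗ₜ[ℂ] h 1)))) (h 2)

/-- The component of the torsion in `E* ⊗ ∧²E ⊗ S³H`: the projection of the torsion by
skew-symmetrisation in the two factors `E` and symmetrisation in the three factors `H`. -/
def torsionComponent (x : M) (ε : E x) (e e' : Module.Dual ℂ (E x))
    (h : Fin 3 → Module.Dual ℂ (H x)) : ℂ :=
  (1 / 12 : ℂ) * ∑ ρ : Equiv.Perm (Fin 3),
    (G.torsionTensor x ε e e' (h ∘ ρ) - G.torsionTensor x ε e' e (h ∘ ρ))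

/-- The connection `∇` is admissible if its torsion has no component in `E* ⊗ ∧²E ⊗ S³H`. -/
def IsAdmissible : Prop :=
  ∀ (x : M) (ε : E x) (e e' : Module.Dual ℂ (E x)) (h : Fin 3 → Module.Dual ℂ (H x)),
    G.torsionComponent x ε e e' h = 0

end HalfFlatGrassmannManifold

end

/-! The theorem reduces to one computation on $M$. Let $h$ be a parallel section of $H^*$ with
$h(x)\neq 0$. Since $\operatorname{rank}H=2$, the kernel of $h$ is a line, spanned near $x$ by a
parallel section $\kappa$ of $H$, and $E^*\otimes h$ is the common kernel of the one-forms
$\varepsilon\otimes\kappa$. The connection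
$\nabla=\nabla^E\otimes\mathrm{Id}+\mathrm{Id}\otimes\nabla^H$ preserves this family of forms, so
$\nabla_XY$ and $\nabla_YX$ are sections of $E^*\otimes h$ whenever $X$ and $Y$ are. Hence
$[X,Y]\equiv -T(X,Y)$ modulo $E^*\otimes h$, where $T$ is the torsion
(`mlieBracket_mem_leafSpace_iff`). Integrability of $E^*\otimes h$ thus follows if $T(e\otimes
h,e'\otimes h)\in E^*\otimes h$ for all $e,e'$, and conversely forces it.

For fixed $\varepsilon,e,e'$ this membership is the vanishing of $\omega_H(\varepsilon\lrcorner
T(e\otimes h,e'\otimes h),h)$, a cubic form in $h$ (`torsionTensor_eq_zero_iff`). By polarisation it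
vanishes for all $h$ exactly when its symmetrisation in the three factors $H$ vanishes. As $T$ is
skew, that symmetrisation is automatically skew in $e,e'$, so it is the component in
$E^*\otimes\wedge^2E\otimes S^3H$ (`isAdmissible_iff`).

Flatness enters through `exists_isParallelTrivialization`: locally $H$ has a holomorphic parallel
frame. Every covector therefore extends to a parallel section, and through each point of $S_H$
passes a horizontal section $\sigma=(h_+,h_-)$, which stays in $S_H$ because $\omega_H$ is parallel.
Along its image, $\mathcal D_\pm$ is the image under $d\sigma$ of $E^*\otimes h_\pm$. Brackets of
$\sigma$-related fields are $\sigma$-related (`mfderiv_mlieBracket_of_related`), which carries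
integrability from all the $E^*\otimes h$ to $\mathcal D_\pm$. In the other direction a nonzero $h$
at a point can be completed to a symplectic basis either as $h_+$ or as $h_-$, so each of $\mathcal
D_+$, $\mathcal D_-$ alone controls the torsion on every $E^*\otimes h$.

The parallel frame comes from an analytic solution of $dQ=QA$ with $dA+A\wedge A=0$. The equation is
first solved along rays from the origin, as a fixed-point problem in a Banach algebra of paths
depending analytically on the end point; flatness then shows that the radial solution solves the
equation in all directions. -/

noncomputable section

set_option linter.unusedSectionVars false

/-! ### Analytic solutions of the radial equation -/

section RadialEquation

variable {V : Type*} [NormedAddCommGroup V] [NormedSpace ℂ V]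
  {R : Type*} [NormedRing R] [NormedAlgebra ℂ R] [CompleteSpace R]

/-- The linear map sending `w` to the path `s ↦ s ^ n • w`. -/
def monomialPath {R : Type*} [NormedRing R] [NormedAlgebra ℂ R] (n : ℕ) :
    R →L[ℂ] C(unitInterval, R) :=
  LinearMap.mkContinuous
    { toFun := fun w ↦ ⟨fun s ↦ ((s : ℝ) : ℂ) ^ n • w, by fun_prop⟩
      map_add' := fun v w ↦ by ext s; simp
      map_smul' := fun c w ↦ by ext s; simp [smul_smul, mul_comm] } 1 fun w ↦ by
    rw [ContinuousMap.norm_le _ (by positivity)]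
    intro s
    have h : ‖((s : ℝ) : ℂ) ^ n‖ ≤ 1 := by
      rw [norm_pow, Complex.norm_real, Real.norm_of_nonneg s.2.1]
      exact pow_le_one₀ s.2.1 s.2.2
    simpa [norm_smul] using mul_le_mul_of_nonneg_right h (norm_nonneg w)

theorem norm_monomialPath_le {R : Type*} [NormedRing R] [NormedAlgebra ℂ R] (n : ℕ) :
    ‖(monomialPath n : R →L[ℂ] C(unitInterval, R))‖ ≤ 1 :=
  LinearMap.mkContinuous_norm_le _ zero_le_one _

/-- If `f` is analytic at `0` and `f 0 = 0`, then `s ↦ f (s x) / s` is a path depending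
analytically on `x`. -/
theorem exists_analyticAt_path {f : V → R} (hf : AnalyticAt ℂ f 0) (h0 : f 0 = 0) :
    ∃ B : V → C(unitInterval, R), AnalyticAt ℂ B 0 ∧ B 0 = 0 ∧
      ∃ r > 0, ∀ x ∈ Metric.ball (0 : V) r, (B x 1 = f x) ∧
        ∀ s t : unitInterval, B (((t : ℝ) : ℂ) • x) s = ((t : ℝ) : ℂ) • B x (t * s) := by
  obtain ⟨p, hp⟩ := hf
  obtain ⟨r, hr⟩ := hp
  -- The $n$-th term of $f(sx)/s$ is $s^{n-1}p_n(x,\dots,x)$. The truncated exponent at $n=0$ is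
  -- harmless because $p_0=f(0)=0$. As $|s|\le 1$, the new series has at least the old radius of
  -- convergence.
  let q : FormalMultilinearSeries ℂ V C(unitInterval, R) := fun n ↦
    (monomialPath (n - 1)).compContinuousMultilinearMap (p n)
  have hq : p.radius ≤ q.radius := by
    refine ENNReal.le_of_forall_nnreal_lt fun r hr ↦ ?_
    obtain ⟨C, -, hC⟩ := p.norm_mul_pow_le_of_lt_radius hr
    refine q.le_radius_of_bound C fun n ↦ (hC n).trans' ?_
    gcongr
    refine (ContinuousLinearMap.norm_compContinuousMultilinearMap_le _ _).trans ?_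
    exact mul_le_of_le_one_left (norm_nonneg _) (norm_monomialPath_le _)
  have hqs := q.hasFPowerSeriesOnBall (hr.radius_pos.trans_le hq)
  have hp0 : ∀ m, p 0 m = 0 := fun m ↦ by rw [hr.coeff_zero, h0]
  refine ⟨q.sum, hqs.analyticAt, ?_, ?_⟩
  · have := hqs.coeff_zero 0
    rw [← this]
    simp [q, hp0]
  have hsum : ∀ x ∈ Metric.eball (0 : V) p.radius, ∀ s : unitInterval,
      HasSum (fun n ↦ ((s : ℝ) : ℂ) ^ (n - 1) • p n fun _ ↦ x) (q.sum x s) := fun x hx s ↦ by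
    have h1 := hqs.hasSum (y := x) (Metric.eball_subset_eball hq hx)
    rw [zero_add] at h1
    exact (ContinuousMap.evalCLM ℂ s).hasSum h1
  obtain ⟨ρ, hρ, hρr⟩ : ∃ ρ : ℝ, 0 < ρ ∧ ENNReal.ofReal ρ ≤ min p.radius r := by
    obtain ⟨a, ha, ha'⟩ := ENNReal.lt_iff_exists_nnreal_btwn.1 (lt_min hr.radius_pos hr.r_pos)
    exact ⟨a, by simpa using ha, by simpa using ha'.le⟩
  refine ⟨ρ, hρ, fun x hx ↦ ?_⟩
  have hx' : x ∈ Metric.eball (0 : V) (ENNReal.ofReal ρ) := by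
    rwa [Metric.eball_ofReal]
  refine ⟨?_, fun s t ↦ ?_⟩
  · have h1 := hsum x (Metric.eball_subset_eball (hρr.trans (min_le_left _ _)) hx') 1
    have h2 := hr.hasSum (Metric.eball_subset_eball (hρr.trans (min_le_right _ _)) hx')
    simp only [zero_add] at h2
    simp only [Set.Icc.coe_one, Complex.ofReal_one, one_pow, one_smul] at h1
    exact h1.unique h2
  · have htx : ((t : ℝ) : ℂ) • x ∈ Metric.eball (0 : V) p.radius := by
      refine Metric.eball_subset_eball (hρr.trans (min_le_left _ _)) ?_
      rw [Metric.eball_ofReal, mem_ball_zero_iff] at hx' ⊢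
      rw [norm_smul, Complex.norm_real, Real.norm_of_nonneg t.2.1]
      exact (mul_le_of_le_one_left (norm_nonneg _) t.2.2).trans_lt hx'
    have h1 := hsum _ htx s
    have h2 := (hsum x (Metric.eball_subset_eball (hρr.trans (min_le_left _ _)) hx')
      (t * s)).const_smul ((t : ℝ) : ℂ)
    refine h1.unique (h2.congr_fun fun n ↦ ?_)
    rw [(p n).map_smul_univ (fun _ ↦ ((t : ℝ) : ℂ)) fun _ ↦ x]
    cases n with
    | zero => simp [hp0]
    | succ n =>
      simp only [Finset.prod_const, Finset.card_univ, Fintype.card_fin, smul_smul,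
        Nat.add_sub_cancel, Set.Icc.coe_mul, Complex.ofReal_mul]
      congr 1
      ring

/-- Integration of paths from `0`. -/
def integralPath {R : Type*} [NormedRing R] [NormedAlgebra ℂ R] [CompleteSpace R] :
    C(unitInterval, R) →L[ℂ] C(unitInterval, R) :=
  LinearMap.mkContinuous
    { toFun := fun f ↦ ⟨fun t ↦ ∫ s in (0 : ℝ)..t, Set.IccExtend zero_le_one f s, by
        have h : Continuous (Set.IccExtend zero_le_one f) := f.continuous.Icc_extend'
        exact (intervalIntegral.continuous_primitive
          (fun a b ↦ h.intervalIntegrable a b) 0).comp continuous_subtype_val⟩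
      map_add' := fun f g ↦ by
        ext t
        have h (f : C(unitInterval, R)) : Continuous (Set.IccExtend zero_le_one f) :=
          f.continuous.Icc_extend'
        exact intervalIntegral.integral_add ((h f).intervalIntegrable _ _)
          ((h g).intervalIntegrable _ _)
      map_smul' := fun c f ↦ by
        ext t
        exact intervalIntegral.integral_smul c _ } 1 fun f ↦ by
    rw [ContinuousMap.norm_le _ (by positivity)]
    intro t
    have := intervalIntegral.norm_integral_le_of_norm_le_const (a := (0 : ℝ)) (b := t) (C := ‖f‖)
      (f := Set.IccExtend zero_le_one f) fun s _ ↦ f.norm_coe_le_norm _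
    refine this.trans ?_
    rw [mul_comm, sub_zero, abs_of_nonneg t.2.1]
    exact mul_le_mul_of_nonneg_right t.2.2 (norm_nonneg _)

theorem integralPath_apply (f : C(unitInterval, R)) (t : unitInterval) :
    integralPath f t = ∫ s in (0 : ℝ)..t, Set.IccExtend zero_le_one f s := rfl

theorem hasDerivAt_integral_IccExtend (f : C(unitInterval, R)) (t : ℝ) :
    HasDerivAt (fun t ↦ ∫ s in (0 : ℝ)..t, Set.IccExtend zero_le_one f s)
      (Set.IccExtend zero_le_one f t) t :=
  have h : Continuous (Set.IccExtend zero_le_one f) := f.continuous.Icc_extend'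
  intervalIntegral.integral_hasDerivAt_right (h.intervalIntegrable _ _)
    (h.stronglyMeasurableAtFilter _ _) h.continuousAt

/-- The solution `U(x)` of the linear equation `U = 1 + J (U * B(x))` depends analytically on `x`
near a zero of `B`. -/
theorem exists_analyticAt_fixed_point {𝒜 : Type*} [NormedRing 𝒜] [NormedAlgebra ℂ 𝒜]
    [CompleteSpace 𝒜] (J : 𝒜 →L[ℂ] 𝒜) {B : V → 𝒜} (hB : AnalyticAt ℂ B 0) (hB0 : B 0 = 0) :
    ∃ U : V → 𝒜, AnalyticAt ℂ U 0 ∧ ∀ᶠ x in 𝓝 0, ∀ W, W = 1 + J (W * B x) ↔ W = U x := by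
  let K : 𝒜 →L[ℂ] 𝒜 →L[ℂ] 𝒜 :=
    (ContinuousLinearMap.compL ℂ _ _ _ J) ∘L (ContinuousLinearMap.mul ℂ 𝒜).flip
  have hK : ∀ b u, K b u = J (u * b) := fun b u ↦ rfl
  -- The equation is linear in $W$ and reads $N(x)W=1$. Since $B(0)=0$, $N(0)$ is the identity, so
  -- $N(x)$ is invertible near $0$ and its inverse is analytic in $x$.
  let N : V → (𝒜 →L[ℂ] 𝒜) := fun x ↦ 1 - K (B x)
  have hN : AnalyticAt ℂ N 0 := analyticAt_const.sub ((K.analyticAt _).comp hB)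
  have hN0 : N 0 = 1 := by simp [N, hB0]
  have hunit : ∀ᶠ x in 𝓝 (0 : V), IsUnit (N x) := by
    refine hN.continuousAt.eventually (Units.isOpen.mem_nhds ?_)
    rw [hN0]
    exact isUnit_one
  refine ⟨fun x ↦ Ring.inverse (N x) 1, ?_, hunit.mono fun x hx W ↦ ?_⟩
  · have h1 : AnalyticAt ℂ (Ring.inverse : _ → (𝒜 →L[ℂ] 𝒜)) (N 0) := by
      rw [hN0]
      exact analyticAt_inverse (𝕜 := ℂ) 1
    exact ((ContinuousLinearMap.apply ℂ _ (1 : 𝒜)).analyticAt _).comp (h1.comp hN)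
  · have hNW : W = 1 + J (W * B x) ↔ N x W = 1 := by
      simp only [N, sub_apply, one_apply_eq_self, hK,
        sub_eq_iff_eq_add]
    rw [hNW]
    constructor
    · intro h
      have := congrArg (fun T : 𝒜 →L[ℂ] 𝒜 ↦ T W) (Ring.inverse_mul_cancel _ hx)
      simp only [mul_apply_eq_comp, h, one_apply_eq_self] at this
      exact this.symm
    · rintro rfl
      exact congrArg (fun T : 𝒜 →L[ℂ] 𝒜 ↦ T 1) (Ring.mul_inverse_cancel _ hx)

/-- The analytic solution of the radial equation `DQ(x) x = Q(x) f(x)` with `Q(0) = 1`. -/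
theorem exists_analyticAt_radial_solution {f : V → R} (hf : AnalyticAt ℂ f 0) (h0 : f 0 = 0) :
    ∃ Q : V → R, AnalyticAt ℂ Q 0 ∧ Q 0 = 1 ∧ ∀ᶠ x in 𝓝 0, fderiv ℂ Q x x = Q x * f x := by
  -- If $Q$ solves the radial equation, then $u(t)=Q(tx)$ satisfies $u'(t)=u(t)f(tx)/t=u(t)B(x)(t)$
  -- with $u(0)=1$. The integral form of this is the fixed-point equation solved by $U(x)$, and
  -- $Q(x)$ is the end value $U(x)(1)$.
  obtain ⟨B, hB, hB0, r, hr, hBr⟩ := exists_analyticAt_path hf h0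
  obtain ⟨U, hU, huniqU⟩ := exists_analyticAt_fixed_point integralPath hB hB0
  have hev : AnalyticAt ℂ (fun u : C(unitInterval, R) ↦ u 1) (U 0) :=
    ContinuousLinearMap.analyticAt
      (ContinuousMap.evalCLM ℂ (1 : unitInterval) : C(unitInterval, R) →L[ℂ] R) (U 0)
  have hQ : AnalyticAt ℂ (fun x ↦ U x 1) 0 := hev.comp hU
  obtain ⟨δ, hδ, hball⟩ := Metric.eventually_nhds_iff_ball.1
    (huniqU.and ((Filter.eventually_mem_set.2 (Metric.ball_mem_nhds (0 : V) hr)).and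
      hQ.eventually_analyticAt))
  have huniq : ∀ x ∈ Metric.ball (0 : V) δ, ∀ W : C(unitInterval, R),
      W = 1 + integralPath (W * B x) ↔ W = U x := fun x hx ↦ (hball x hx).1
  have hscale : ∀ x ∈ Metric.ball (0 : V) δ, ∀ t : unitInterval,
      ((t : ℝ) : ℂ) • x ∈ Metric.ball (0 : V) δ := fun x hx t ↦ by
    rw [mem_ball_zero_iff] at hx ⊢
    rw [norm_smul, Complex.norm_real, Real.norm_of_nonneg t.2.1]
    exact (mul_le_of_le_one_left (norm_nonneg _) t.2.2).trans_lt hx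
  -- The rescaled path $s\mapsto U(x)(ts)$ solves the integral equation at $tx$, by the scaling of
  -- $B$ and a change of variable; uniqueness identifies it with $U(tx)$. So $t\mapsto Q(tx)$ is the
  -- path $U(x)$.
  have hhom : ∀ x ∈ Metric.ball (0 : V) δ, ∀ t : unitInterval,
      U (((t : ℝ) : ℂ) • x) 1 = U x t := fun x hx t ↦ by
    let W : C(unitInterval, R) := ⟨fun s ↦ U x (t * s), by fun_prop⟩
    have hW : W = U (((t : ℝ) : ℂ) • x) := by
      refine (huniq _ (hscale x hx t) W).1 ?_
      ext s
      have h1 := congrArg (fun u : C(unitInterval, R) ↦ u (t * s)) ((huniq x hx (U x)).2 rfl)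
      refine h1.trans ?_
      simp only [ContinuousMap.add_apply, ContinuousMap.one_apply, integralPath_apply]
      congr 1
      rw [Set.Icc.coe_mul]
      have h2 := intervalIntegral.smul_integral_comp_mul_left (a := 0) (b := (s : ℝ))
        (Set.IccExtend zero_le_one (U x * B x)) (t : ℝ)
      rw [mul_zero] at h2
      rw [← h2, ← intervalIntegral.integral_smul]
      refine intervalIntegral.integral_congr fun r hr ↦ ?_
      rw [Set.uIcc_of_le s.2.1] at hr
      have hr1 : r ∈ Set.Icc (0 : ℝ) 1 := ⟨hr.1, hr.2.trans s.2.2⟩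
      have htr : (t : ℝ) * r ∈ Set.Icc (0 : ℝ) 1 := (t * ⟨r, hr1⟩ : unitInterval).2
      simp only [Set.IccExtend_of_mem zero_le_one _ htr, Set.IccExtend_of_mem zero_le_one _ hr1,
        ContinuousMap.mul_apply, (hBr x (hball x hx).2.1).2 ⟨r, hr1⟩ t, mul_smul_comm]
      rfl
    rw [← hW]
    simp [W]
  refine ⟨fun x ↦ U x 1, hQ, ?_, Filter.eventually_of_mem (Metric.ball_mem_nhds 0 hδ)
    fun x hx ↦ ?_⟩
  · have := (huniq 0 (Metric.mem_ball_self hδ) 1).1 (by simp [hB0])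
    simp [← this]
  · have hd : HasDerivAt (fun t : ℝ ↦ (t : ℂ) • x) x 1 := by
      simpa using (Complex.ofRealCLM.hasDerivAt (x := 1)).smul_const x
    -- The derivative of $t\mapsto Q(tx)$ at $t=1$ is computed twice: by the chain rule, and from
    -- the integral equation. Paths live on $[0,1]$, so it is a one-sided derivative at the right
    -- end point.
    have h1 : HasDerivWithinAt (fun t : ℝ ↦ U ((t : ℂ) • x) 1) (fderiv ℂ (fun x ↦ U x 1) x x)
        (Set.Icc 0 1) 1 := by
      have h2 : HasFDerivAt (fun x ↦ U x 1) (fderiv ℂ (fun x ↦ U x 1) x) (((1 : ℝ) : ℂ) • x) := by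
        simpa using (hball x hx).2.2.differentiableAt.hasFDerivAt
      exact (h2.restrictScalars ℝ |>.comp_hasDerivAt (1 : ℝ) hd).hasDerivWithinAt
    have h2 : HasDerivWithinAt (fun t : ℝ ↦ U ((t : ℂ) • x) 1) (U x 1 * f x) (Set.Icc 0 1) 1 := by
      have h3 := ((hasDerivAt_integral_IccExtend (U x * B x) 1).const_add 1).hasDerivWithinAt
        (s := Set.Icc 0 1)
      rw [Set.IccExtend_of_mem zero_le_one _ (Set.right_mem_Icc.2 zero_le_one)] at h3
      have h4 : (U x * B x) ⟨1, Set.right_mem_Icc.2 zero_le_one⟩ = U x 1 * f x := by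
        rw [← (hBr x (hball x hx).2.1).1]
        rfl
      rw [h4] at h3
      refine h3.congr_of_mem (fun t ht ↦ ?_) (Set.right_mem_Icc.2 zero_le_one)
      refine (hhom x hx ⟨t, ht⟩).trans ?_
      exact congrArg (fun u : C(unitInterval, R) ↦ u ⟨t, ht⟩) ((huniq x hx (U x)).2 rfl)
    exact (uniqueDiffOn_Icc_zero_one 1 (Set.right_mem_Icc.2 zero_le_one)).eq_deriv _ h1 h2

end RadialEquation

/-! ### From the radial equation to $dQ=QA$ -/

section RadialEquation

variable {V : Type*} [NormedAddCommGroup V] [NormedSpace ℂ V]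
  {R : Type*} [NormedRing R] [NormedAlgebra ℂ R] [CompleteSpace R]

omit [CompleteSpace R] in
/-- A one-dimensional linear equation with zero initial value has only the zero solution. -/
theorem eq_zero_of_hasDerivAt_mul {y b : ℝ → R} (hb : ContinuousOn b (Set.Icc 0 1))
    (hy : ∀ t ∈ Set.Icc (0 : ℝ) 1, HasDerivAt y (y t * b t) t) (h0 : y 0 = 0) : y 1 = 0 := by
  obtain ⟨K, hK⟩ := isCompact_Icc.exists_bound_of_continuousOn hb
  have := eq_zero_of_abs_deriv_le_mul_abs_self_of_eq_zero_right (f := y) (f' := fun t ↦ y t * b t)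
    (K := K) (a := 0) (b := 1)
    (fun t ht ↦ (hy t ht).continuousAt.continuousWithinAt)
    (fun t ht ↦ (hy t ⟨ht.1, ht.2.le⟩).hasDerivWithinAt) h0
    (fun t ht ↦ (norm_mul_le _ _).trans ((mul_comm _ _).le.trans
      (mul_le_mul_of_nonneg_right (hK t ⟨ht.1, ht.2.le⟩) (norm_nonneg _))))
  exact this 1 (Set.right_mem_Icc.2 zero_le_one)

/-- The flat connection `d + A` has locally a holomorphic parallel frame: there is an analytic
solution of `dQ = Q A` with `Q(0) = 1`. -/
theorem exists_analyticAt_of_flat {A : V → V →L[ℂ] R} (hA : AnalyticAt ℂ A 0)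
    (hflat : ∀ᶠ x in 𝓝 0, ∀ v w, fderiv ℂ A x w v + A x w * A x v
      = fderiv ℂ A x v w + A x v * A x w) :
    ∃ Q : V → R, AnalyticAt ℂ Q 0 ∧ Q 0 = 1 ∧ ∀ᶠ x in 𝓝 0, ∀ v, fderiv ℂ Q x v = Q x * A x v := by
  have hf : AnalyticAt ℂ (fun x ↦ A x x) 0 := by
    exact (hA.contDiffAt.clm_apply (contDiffAt_id (n := ω))).analyticAt
  obtain ⟨Q, hQ, hQ0, hrad⟩ := exists_analyticAt_radial_solution hf (by simp)
  refine ⟨Q, hQ, hQ0, ?_⟩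
  obtain ⟨δ, hδ, hball⟩ := Metric.eventually_nhds_iff_ball.1
    (hflat.and (hrad.eventually_nhds.and (hA.eventually_analyticAt.and hQ.eventually_analyticAt)))
  refine Filter.eventually_of_mem (Metric.ball_mem_nhds 0 hδ) fun x hx v ↦ ?_
  -- The defect of $dQ=QA$ in the fixed direction $v$. Differentiating the radial identity in the
  -- direction $v$ and using the symmetry of $D^2Q$ and flatness gives
  -- $D\psi(z)z=\psi(z)A(z)z-\psi(z)$.
  let ψ : V → R := fun z ↦ fderiv ℂ Q z v - Q z * A z v
  have hψ : ∀ z ∈ Metric.ball (0 : V) δ, HasFDerivAt ψ (fderiv ℂ ψ z) z ∧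
      fderiv ℂ ψ z z = ψ z * A z z - ψ z := fun z hz ↦ by
    obtain ⟨hfl, hr, hAz, hQz⟩ := hball z hz
    have hA' := hAz.differentiableAt.hasFDerivAt
    have hQ' := hQz.differentiableAt.hasFDerivAt
    have hQ'' := hQz.fderiv.differentiableAt.hasFDerivAt
    have hAv (v : V) : HasFDerivAt (fun z ↦ A z v) ((fderiv ℂ A z).flip v) z := by
      simpa using hA'.clm_apply (hasFDerivAt_const v z)
    have hψ' : HasFDerivAt ψ ((fderiv ℂ (fderiv ℂ Q) z).flip v -
        (Q z • (fderiv ℂ A z).flip v + (fderiv ℂ Q z).smulRight (A z v))) z := by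
      refine HasFDerivAt.sub ?_ (hQ'.mul' (hAv v))
      simpa using hQ''.clm_apply (hasFDerivAt_const v z)
    refine ⟨hψ'.differentiableAt.hasFDerivAt, ?_⟩
    have hsymm : fderiv ℂ (fderiv ℂ Q) z z v = fderiv ℂ (fderiv ℂ Q) z v z :=
      (hQz.contDiffAt (n := ω)).isSymmSndFDerivAt (by simp) z v
    have hdiff : fderiv ℂ (fderiv ℂ Q) z v z + fderiv ℂ Q z v =
        Q z * (fderiv ℂ A z v z + A z v) + fderiv ℂ Q z v * A z z := by
      have h1 : HasFDerivAt (fun z ↦ fderiv ℂ Q z z) _ z := hQ''.clm_apply (hasFDerivAt_id z)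
      have h2 : HasFDerivAt (fun z ↦ Q z * A z z) _ z := hQ'.mul' (hA'.clm_apply (hasFDerivAt_id z))
      have h3 := congrArg (fun L : V →L[ℂ] R ↦ L v)
        (h1.unique (h2.congr_of_eventuallyEq hr))
      simp at h3
      rw [add_comm, h3, mul_add]
      abel
    rw [hψ'.fderiv]
    have h4 := hfl z v
    have h5 := hr.self_of_nhds
    simp only [sub_apply, add_apply, ContinuousLinearMap.flip_apply, smul_apply, smul_eq_mul,
      ContinuousLinearMap.smulRight_apply, hsymm, eq_sub_of_add_eq hdiff, h5, ψ]
    linear_combination (norm := noncomm_ring) Q z * h4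
  have hz : ∀ t ∈ Set.Icc (0 : ℝ) 1, (t : ℂ) • x ∈ Metric.ball (0 : V) δ := fun t ht ↦ by
    rw [mem_ball_zero_iff] at hx ⊢
    rw [norm_smul, Complex.norm_real, Real.norm_of_nonneg ht.1]
    exact (mul_le_of_le_one_left (norm_nonneg _) ht.2).trans_lt hx
  -- The factor $t$ absorbs the term $-\psi$: $y(t)=t\,\psi(tx)$ satisfies $y'=y\cdot A(tx)x$ and
  -- $y(0)=0$, so $\psi(x)=y(1)=0$.
  have hy := eq_zero_of_hasDerivAt_mul (y := fun t : ℝ ↦ (t : ℂ) • ψ ((t : ℂ) • x))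
    (b := fun t ↦ A ((t : ℂ) • x) x) (fun t ht ↦ ?_) (fun t ht ↦ ?_) (by simp)
  · simpa [ψ, sub_eq_zero] using hy
  · have h1 := (hball _ (hz t ht)).2.2.1.continuousAt
    have h2 : ContinuousAt (fun t : ℝ ↦ (t : ℂ) • x) t := by fun_prop
    exact ((ContinuousAt.comp (f := fun t : ℝ ↦ (t : ℂ) • x) h1 h2).clm_apply
      continuousAt_const).continuousWithinAt
  · have hd : HasDerivAt (fun t : ℝ ↦ (t : ℂ) • x) x t := by
      simpa using (Complex.ofRealCLM.hasDerivAt (x := t)).smul_const x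
    obtain ⟨h1, h2⟩ := hψ _ (hz t ht)
    have h3 := (h1.restrictScalars ℝ).comp_hasDerivAt t hd
    have h4 := (Complex.ofRealCLM.hasDerivAt (x := t)).smul h3
    refine h4.congr_deriv ?_
    simp only [map_smul, mul_smul_comm, eq_sub_iff_add_eq] at h2
    simpa using h2

/-- `exists_analyticAt_of_flat` at an arbitrary base point. -/
theorem exists_analyticAt_of_flat_at {A : V → V →L[ℂ] R} {a : V} (hA : AnalyticAt ℂ A a)
    (hflat : ∀ᶠ x in 𝓝 a, ∀ v w, fderiv ℂ A x w v + A x w * A x v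
      = fderiv ℂ A x v w + A x v * A x w) :
    ∃ Q : V → R, AnalyticAt ℂ Q a ∧ Q a = 1 ∧ ∀ᶠ x in 𝓝 a, ∀ v, fderiv ℂ Q x v = Q x * A x v := by
  have htr : Filter.Tendsto (fun p ↦ p + a) (𝓝 0) (𝓝 a) := by
    have : ContinuousAt (fun p ↦ p + a) 0 := by fun_prop
    simpa [ContinuousAt] using this
  have htr' : Filter.Tendsto (fun p ↦ p - a) (𝓝 a) (𝓝 0) := by
    have : ContinuousAt (fun p ↦ p - a) a := by fun_prop
    simpa [ContinuousAt] using this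
  obtain ⟨Q, hQ, hQ0, hdQ⟩ := exists_analyticAt_of_flat (A := fun p ↦ A (p + a))
    (by
      have h1 : AnalyticAt ℂ (fun p ↦ p + a) 0 := by fun_prop
      exact AnalyticAt.fun_comp (by rwa [zero_add]) h1)
    ((htr.eventually hflat).mono fun p hp v w ↦ by
      rw [fderiv_comp_add_right]
      exact hp v w)
  refine ⟨fun p ↦ Q (p - a), ?_, by simpa using hQ0, (htr'.eventually hdQ).mono fun p hp v ↦ ?_⟩
  · have h1 : AnalyticAt ℂ (fun p ↦ p - a) a := by fun_prop
    exact AnalyticAt.fun_comp (by rwa [sub_self]) h1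
  · rw [show (fun p ↦ Q (p - a)) = fun p ↦ Q (p + -a) by simp [sub_eq_add_neg], fderiv_comp_add_right,
      ← sub_eq_add_neg]
    simpa [← sub_eq_add_neg] using hp v

end RadialEquation

/-! ### Connections in charts and trivializations -/

section ParallelTrivialization

variable {V : Type*} [NormedAddCommGroup V] [NormedSpace ℂ V]
  {M : Type*} [TopologicalSpace M] [ChartedSpace V M]
  {F : Type*} [NormedAddCommGroup F] [NormedSpace ℂ F]
  {W : M → Type*} [TopologicalSpace (TotalSpace F W)]
  [∀ x, AddCommGroup (W x)] [∀ x, Module ℂ (W x)] [∀ x, TopologicalSpace (W x)]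
  [∀ x, IsTopologicalAddGroup (W x)] [∀ x, ContinuousSMul ℂ (W x)]
  [FiberBundle F W] [VectorBundle ℂ F W]

/-- The chain rule for the composition of a vector-valued function on a manifold with a map between
vector spaces. -/
theorem HasFDerivAt.mvfderiv_comp {F' : Type*} [NormedAddCommGroup F'] [NormedSpace ℂ F']
    {g : F → F'} {g' : F →L[ℂ] F'} {u : M → F} {x : M} (hg : HasFDerivAt g g' (u x))
    (hu : MDifferentiableAt 𝓘(ℂ, V) 𝓘(ℂ, F) u x) (X : TangentSpace 𝓘(ℂ, V) x) :
    mvfderiv 𝓘(ℂ, V) (fun y ↦ g (u y)) x X = g' (mvfderiv 𝓘(ℂ, V) u x X) :=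
  congrArg (fun L : TangentSpace 𝓘(ℂ, V) x →L[ℂ] F' ↦ L X)
    ((hg.hasMFDerivAt.comp x hu.hasMFDerivAt).mfderiv)

theorem HolomorphicSectionAt.mdifferentiableAt {σ : ∀ y : M, W y} {x : M}
    (h : HolomorphicSectionAt V F σ x) :
    MDifferentiableAt 𝓘(ℂ, V) (𝓘(ℂ, V).prod 𝓘(ℂ, F))
      (fun y ↦ (⟨y, σ y⟩ : TotalSpace F W)) x :=
  ContMDiffAt.mdifferentiableAt h (by simp)

theorem holomorphicSectionAt_symmL [ContMDiffVectorBundle ω F W 𝓘(ℂ, V)]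
    (e : Trivialization F (TotalSpace.proj : TotalSpace F W → M)) [MemTrivializationAtlas e]
    (w : F) {x : M} (hx : x ∈ e.baseSet) :
    HolomorphicSectionAt V F (fun y ↦ e.symmL ℂ y w) x := by
  rw [HolomorphicSectionAt, e.contMDiffAt_section_iff hx]
  refine (contMDiffAt_const (c := w)).congr_of_eventuallyEq ?_
  filter_upwards [e.open_baseSet.mem_nhds hx] with y hy
  rw [e.symmL_apply hy, e.apply_mk_symm hy]

theorem CovariantDerivative.sum_smul (cov : CovariantDerivative 𝓘(ℂ, V) F W)
    [IsManifold 𝓘(ℂ, V) 1 M] [ContMDiffVectorBundle 1 F W 𝓘(ℂ, V)]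
    {ι : Type*} (t : Finset ι) {f : ι → M → ℂ} {s : ι → ∀ y, W y} {x : M}
    (hf : ∀ i, MDifferentiableAt 𝓘(ℂ, V) 𝓘(ℂ, ℂ) (f i) x)
    (hs : ∀ i, MDifferentiableAt 𝓘(ℂ, V) (𝓘(ℂ, V).prod 𝓘(ℂ, F))
      (fun y ↦ (⟨y, s i y⟩ : TotalSpace F W)) x) :
    cov (fun y ↦ ∑ i ∈ t, f i y • s i y) x =
      ∑ i ∈ t, (f i x • cov (s i) x + (mvfderiv 𝓘(ℂ, V) (f i) x).smulRight (s i x)) := by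
  classical
  induction t using Finset.induction_on with
  | empty => exact congrFun cov.zero x
  | insert i t hi ih =>
    simp only [Finset.sum_insert hi]
    have h1 := cov.isCovariantDerivativeOnUniv.add (x := x) (σ := f i • s i)
      (σ' := fun y ↦ ∑ i ∈ t, f i y • s i y)
      ((hf i).smul_section (hs i)) (MDifferentiableAt.sum_section
        fun i _ ↦ (hf i).smul_section (hs i))
    refine h1.trans ?_
    rw [ih, cov.isCovariantDerivativeOnUniv.leibniz (hs i) (hf i)]

variable [FiniteDimensional ℂ F]

/-- The connection form of `cov` in the trivialization of `W` and the chart of `M` at `x₀`. -/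
def connectionForm [IsManifold 𝓘(ℂ, V) 1 M] (cov : CovariantDerivative 𝓘(ℂ, V) F W)
    (x₀ y : M) : V →L[ℂ] F →L[ℂ] F :=
  ∑ i, (ContinuousLinearMap.smulRightL ℂ F F
      (LinearMap.toContinuousLinearMap ((Module.finBasis ℂ F).coord i))) ∘L
    ContinuousLinearMap.inCoordinates V (TangentSpace 𝓘(ℂ, V)) F W x₀ y x₀ y
      (cov (fun z ↦ (trivializationAt F W x₀).symmL ℂ z (Module.finBasis ℂ F i)) y)

theorem connectionForm_apply [IsManifold 𝓘(ℂ, V) 1 M] (cov : CovariantDerivative 𝓘(ℂ, V) F W)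
    (x₀ y : M) (v : V) (w : F) :
    connectionForm cov x₀ y v w = ∑ i, (Module.finBasis ℂ F).repr w i •
      (trivializationAt F W x₀).continuousLinearMapAt ℂ y
      (cov (fun z ↦ (trivializationAt F W x₀).symmL ℂ z (Module.finBasis ℂ F i)) y
        ((trivializationAt V (TangentSpace 𝓘(ℂ, V)) x₀).symmL ℂ y v)) := by
  simp [connectionForm, ContinuousLinearMap.inCoordinates]

/-- The covariant derivative in a trivialization. -/
theorem continuousLinearMapAt_cov [IsManifold 𝓘(ℂ, V) ω M] [ContMDiffVectorBundle ω F W 𝓘(ℂ, V)]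
    (cov : CovariantDerivative 𝓘(ℂ, V) F W) {x₀ y : M}
    (hy : y ∈ (trivializationAt F W x₀).baseSet) (hy' : y ∈ (chartAt V x₀).source)
    {σ : ∀ y, W y} (hσ : HolomorphicSectionAt V F σ y) (X : TangentSpace 𝓘(ℂ, V) y) :
    (trivializationAt F W x₀).continuousLinearMapAt ℂ y (cov σ y X) =
      mvfderiv 𝓘(ℂ, V) (fun z ↦ (trivializationAt F W x₀).continuousLinearMapAt ℂ z (σ z)) y X +
      connectionForm cov x₀ y (mvfderiv 𝓘(ℂ, V) (extChartAt 𝓘(ℂ, V) x₀) y X)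
        ((trivializationAt F W x₀).continuousLinearMapAt ℂ y (σ y)) := by
  set e := trivializationAt F W x₀
  set b := Module.finBasis ℂ F
  let u : M → F := fun z ↦ e.continuousLinearMapAt ℂ z (σ z)
  have hu : MDifferentiableAt 𝓘(ℂ, V) 𝓘(ℂ, F) u y := by
    have h1 := ((e.contMDiffAt_section_iff hy).1 hσ).mdifferentiableAt (by simp)
    refine h1.congr_of_eventuallyEq ?_
    filter_upwards [e.open_baseSet.mem_nhds hy] with z hz
    simp [u, e.coe_linearMapAt_of_mem hz]
  have hui (i) : MDifferentiableAt 𝓘(ℂ, V) 𝓘(ℂ, ℂ) (fun z ↦ b.repr (u z) i) y := by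
    have := (LinearMap.toContinuousLinearMap (b.coord i)).differentiableAt.mdifferentiableAt.comp
      y hu
    exact this
  have hdu : mvfderiv 𝓘(ℂ, V) u y X =
      ∑ i, mvfderiv 𝓘(ℂ, V) (fun z ↦ b.repr (u z) i) y X • b i := by
    have h2 (i) : mvfderiv 𝓘(ℂ, V) (fun z ↦ b.repr (u z) i) y X =
        b.repr (mvfderiv 𝓘(ℂ, V) u y X) i :=
      (LinearMap.toContinuousLinearMap (b.coord i)).hasFDerivAt.mvfderiv_comp hu X
    simp only [h2, b.sum_repr]
  have hσe : ∀ᶠ z in 𝓝 y, σ z = ∑ i, b.repr (u z) i • e.symmL ℂ z (b i) := by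
    filter_upwards [e.open_baseSet.mem_nhds hy] with z hz
    simp_rw [← map_smul, ← map_sum, b.sum_repr]
    exact (e.symmL_continuousLinearMapAt hz _).symm
  have hsec (i) := (holomorphicSectionAt_symmL (V := V) e (b i) hy).mdifferentiableAt
  have hcov : cov σ y = _ := (cov.isCovariantDerivativeOnUniv.congr_of_eventuallyEq
    hσ.mdifferentiableAt (MDifferentiableAt.sum_section
        fun i _ ↦ (hui i).smul_section (hsec i)) Filter.univ_mem hσe).trans
    (cov.sum_smul Finset.univ hui hsec)
  rw [hcov, hdu, connectionForm_apply]
  have hX : (trivializationAt V (TangentSpace 𝓘(ℂ, V)) x₀).symmL ℂ y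
      (mvfderiv 𝓘(ℂ, V) (extChartAt 𝓘(ℂ, V) x₀) y X) = X := by
    have := (trivializationAt V (TangentSpace 𝓘(ℂ, V)) x₀).symmL_continuousLinearMapAt
      (R := ℂ) (b := y) (by simpa using hy') X
    rwa [TangentBundle.continuousLinearMapAt_trivializationAt hy'] at this
  rw [hX]
  change e.continuousLinearMapAt ℂ y _ = _ + ∑ i, b.repr (u y) i •
    e.continuousLinearMapAt ℂ y (cov (fun z ↦ e.symmL ℂ z (b i)) y X)
  simp only [sum_apply, map_sum, add_apply, smul_apply, ContinuousLinearMap.smulRight_apply,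
    map_add, map_smul, Finset.sum_add_distrib, e.continuousLinearMapAt_symmL hy]
  rw [add_comm]

/-- The form is assembled from the covariant derivatives of the constant frame sections, which are
holomorphic because the connection preserves holomorphy on the open base set. -/
theorem contMDiffAt_connectionForm [FiniteDimensional ℂ V] [IsManifold 𝓘(ℂ, V) ω M]
    [ContMDiffVectorBundle ω F W 𝓘(ℂ, V)] {cov : CovariantDerivative 𝓘(ℂ, V) F W}
    (hcov : IsHolomorphicConnection cov) (x₀ : M) :
    ContMDiffAt 𝓘(ℂ, V) 𝓘(ℂ, V →L[ℂ] F →L[ℂ] F) ω (connectionForm cov x₀) x₀ := by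
  set e := trivializationAt F W x₀
  have h1 (w : F) : ContMDiffAt 𝓘(ℂ, V) 𝓘(ℂ, V →L[ℂ] F) ω
      (fun y ↦ ContinuousLinearMap.inCoordinates V (TangentSpace 𝓘(ℂ, V)) F W x₀ y x₀ y
        (cov (fun z ↦ e.symmL ℂ z w) y)) x₀ := by
    have h2 := (hcov e.baseSet e.open_baseSet).contMDiff (σ := fun z ↦ e.symmL ℂ z w)
      fun y hy ↦ (holomorphicSectionAt_symmL e w hy).contMDiffWithinAt
    exact ((contMDiffAt_hom_bundle _).1 (h2.contMDiffAt (e.open_baseSet.mem_nhds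
      (mem_baseSet_trivializationAt F W x₀)))).2
  exact contMDiffAt_finsetSum fun i _ ↦ contMDiffAt_const.clm_comp (h1 _)

/-- The coordinate vector fields of the chart at `x₀`. -/
def coordinateField (x₀ : M) [IsManifold 𝓘(ℂ, V) 1 M] (v : V) (y : M) : TangentSpace 𝓘(ℂ, V) y :=
  (trivializationAt V (TangentSpace 𝓘(ℂ, V)) x₀).symmL ℂ y v

theorem mvfderiv_extChartAt_coordinateField [IsManifold 𝓘(ℂ, V) ω M] {x₀ y : M}
    (hy : y ∈ (chartAt V x₀).source) (v : V) :
    mvfderiv 𝓘(ℂ, V) (extChartAt 𝓘(ℂ, V) x₀) y (coordinateField x₀ v y) = v := by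
  have := (trivializationAt V (TangentSpace 𝓘(ℂ, V)) x₀).continuousLinearMapAt_symmL
      (R := ℂ) (b := y) (by simpa using hy) v
  rwa [TangentBundle.continuousLinearMapAt_trivializationAt hy] at this

theorem holomorphicSectionAt_coordinateField [IsManifold 𝓘(ℂ, V) ω M] {x₀ y : M}
    (hy : y ∈ (chartAt V x₀).source) (v : V) :
    HolomorphicSectionAt V V (coordinateField (V := V) x₀ v) y :=
  holomorphicSectionAt_symmL _ v (by simpa using hy)

/-- Coordinate fields are pullbacks of constant fields by the chart, and pullback commutes with the
bracket. This removes the bracket term when the curvature is computed on them. -/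
theorem mlieBracket_coordinateField [CompleteSpace V] [IsManifold 𝓘(ℂ, V) ω M] {x₀ y : M}
    (hy : y ∈ (chartAt V x₀).source) (v w : V) :
    VectorField.mlieBracket 𝓘(ℂ, V) (coordinateField x₀ v) (coordinateField x₀ w) y = 0 := by
  let c (v : V) (z : V) : TangentSpace 𝓘(ℂ, V) z := v
  have h1 (v : V) : coordinateField x₀ v =ᶠ[𝓝 y] VectorField.mpullback 𝓘(ℂ, V) 𝓘(ℂ, V)
      (extChartAt 𝓘(ℂ, V) x₀) (c v) := by
    filter_upwards [(chartAt V x₀).open_source.mem_nhds hy] with z hz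
    obtain ⟨L, hL⟩ := isInvertible_mfderiv_extChartAt (I := 𝓘(ℂ, V)) (x := x₀) (y := z)
      (by simpa using hz)
    have h4 : L (coordinateField x₀ v z) = v :=
      (congrArg (fun T ↦ T (coordinateField x₀ v z)) hL).trans
        (mvfderiv_extChartAt_coordinateField hz v)
    have h5 : VectorField.mpullback 𝓘(ℂ, V) 𝓘(ℂ, V) (extChartAt 𝓘(ℂ, V) x₀) (c v) z
        = L.symm v := by
      refine VectorField.mpullback_apply.trans ?_
      rw [← hL, ContinuousLinearMap.inverse_equiv]
      rfl
    exact ((L.symm_apply_eq.2 h4.symm).symm).trans h5.symm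
  have hc (v : V) : MDifferentiableAt 𝓘(ℂ, V) 𝓘(ℂ, V).tangent
      (fun z ↦ (⟨z, c v z⟩ : TangentBundle 𝓘(ℂ, V) V)) (extChartAt 𝓘(ℂ, V) x₀ y) := by
    have h2 : ContMDiffAt 𝓘(ℂ, V) 𝓘(ℂ, V).tangent ω
        (fun z ↦ (⟨z, c v z⟩ : TangentBundle 𝓘(ℂ, V) V)) (extChartAt 𝓘(ℂ, V) x₀ y) :=
      contMDiffAt_vectorSpace_iff_contDiffAt.2 contDiffAt_const
    exact h2.mdifferentiableAt (by simp)
  have h6 := VectorField.mpullback_mlieBracket (n := ω) (hc v) (hc w)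
    (contMDiffAt_extChartAt' (I := 𝓘(ℂ, V)) hy) (by simp)
  rw [(h1 v).mlieBracket_vectorField_eq (h1 w)]
  refine h6.symm.trans (VectorField.mpullback_apply.trans ?_)
  rw [← VectorField.mlieBracketWithin_univ, VectorField.mlieBracketWithin_eq_lieBracketWithin,
    VectorField.lieBracketWithin_univ]
  have h7 : VectorField.lieBracket ℂ (c v) (c w) (extChartAt 𝓘(ℂ, V) x₀ y) = 0 := by
    simp [VectorField.lieBracket, c]
  rw [h7]
  exact ContinuousLinearMap.map_zero _

end ParallelTrivialization

/-! ### Parallel trivializations of a flat bundle -/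

section ParallelTrivialization

variable {V : Type*} [NormedAddCommGroup V] [NormedSpace ℂ V]
  {M : Type*} [TopologicalSpace M] [ChartedSpace V M]
  {F : Type*} [NormedAddCommGroup F] [NormedSpace ℂ F]
  {W : M → Type*} [TopologicalSpace (TotalSpace F W)]
  [∀ x, AddCommGroup (W x)] [∀ x, Module ℂ (W x)] [∀ x, TopologicalSpace (W x)]
  [∀ x, IsTopologicalAddGroup (W x)] [∀ x, ContinuousSMul ℂ (W x)]
  [FiberBundle F W] [VectorBundle ℂ F W]

variable [FiniteDimensional ℂ F]

/-- `T` is a holomorphic trivialization of `W` over the open set `U`, with inverse `S`, which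
transforms the connection `cov` into the trivial one. -/
structure IsParallelTrivialization [IsManifold 𝓘(ℂ, V) 1 M] (cov : CovariantDerivative 𝓘(ℂ, V) F W)
    (U : Set M) (T : ∀ y, W y →L[ℂ] F) (S : ∀ y, F →L[ℂ] W y) : Prop where
  isOpen : IsOpen U
  left_inv : ∀ y ∈ U, ∀ w, S y (T y w) = w
  right_inv : ∀ y ∈ U, ∀ c, T y (S y c) = c
  contMDiffAt_apply : ∀ y ∈ U, ∀ σ : ∀ z, W z, HolomorphicSectionAt V F σ y →
    ContMDiffAt 𝓘(ℂ, V) 𝓘(ℂ, F) ω (fun z ↦ T z (σ z)) y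
  holomorphicSectionAt : ∀ y ∈ U, ∀ c, HolomorphicSectionAt V F (fun z ↦ S z c) y
  mvfderiv_apply : ∀ y ∈ U, ∀ σ : ∀ z, W z, HolomorphicSectionAt V F σ y →
    ∀ X, mvfderiv 𝓘(ℂ, V) (fun z ↦ T z (σ z)) y X = T y (cov σ y X)

-- Flatness as $dA+A\wedge A=0$ in coordinates. On a constant section $c$,
-- $\nabla_v\nabla_wc=(\partial_vA(w)+A(v)A(w))c$ for coordinate fields $v,w$, whose bracket
-- vanishes, so zero curvature says that this expression is symmetric in $v,w$.
set_option synthInstance.maxHeartbeats 100000 in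
theorem connectionForm_flat [FiniteDimensional ℂ V] [IsManifold 𝓘(ℂ, V) ω M]
    [ContMDiffVectorBundle ω F W 𝓘(ℂ, V)] {cov : CovariantDerivative 𝓘(ℂ, V) F W}
    (hcov : IsHolomorphicConnection cov) (hflat : IsFlatConnection cov) {x₀ y : M}
    (hy : y ∈ (trivializationAt F W x₀).baseSet) (hy' : y ∈ (chartAt V x₀).source)
    (hA : DifferentiableAt ℂ (connectionForm cov x₀ ∘ (extChartAt 𝓘(ℂ, V) x₀).symm)
      (extChartAt 𝓘(ℂ, V) x₀ y)) (v w : V) :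
    fderiv ℂ (connectionForm cov x₀ ∘ (extChartAt 𝓘(ℂ, V) x₀).symm) (extChartAt 𝓘(ℂ, V) x₀ y) w v
        + connectionForm cov x₀ y w * connectionForm cov x₀ y v =
      fderiv ℂ (connectionForm cov x₀ ∘ (extChartAt 𝓘(ℂ, V) x₀).symm) (extChartAt 𝓘(ℂ, V) x₀ y) v w
        + connectionForm cov x₀ y v * connectionForm cov x₀ y w := by
  have : CompleteSpace V := FiniteDimensional.complete ℂ V
  set e := trivializationAt F W x₀
  set φ := extChartAt 𝓘(ℂ, V) x₀
  set A := connectionForm cov x₀ ∘ φ.symm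
  have hnear : ∀ᶠ z in 𝓝 y, z ∈ e.baseSet ∧ z ∈ (chartAt V x₀).source :=
    Filter.Eventually.and (e.open_baseSet.mem_nhds hy) ((chartAt V x₀).open_source.mem_nhds hy')
  ext c
  let σ : ∀ z, W z := fun z ↦ e.symmL ℂ z c
  have hσ (z) (hz : z ∈ e.baseSet) : HolomorphicSectionAt V F σ z := holomorphicSectionAt_symmL e c hz
  let τ (v : V) : ∀ z, W z := fun z ↦ cov σ z (coordinateField x₀ v z)
  have hτ (v : V) : HolomorphicSectionAt V F (τ v) y := by
    have h1 := ((hcov e.baseSet e.open_baseSet).contMDiff (σ := σ)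
      fun z hz ↦ (hσ z hz).contMDiffWithinAt).contMDiffAt (e.open_baseSet.mem_nhds hy)
    exact h1.clm_bundle_apply (holomorphicSectionAt_coordinateField hy' v)
  have hτe (v : V) (z) (hz : z ∈ e.baseSet) (hz' : z ∈ (chartAt V x₀).source) :
      e.continuousLinearMapAt ℂ z (τ v z) = connectionForm cov x₀ z v c := by
    have h1 := continuousLinearMapAt_cov cov hz hz' (hσ z hz) (coordinateField x₀ v z)
    rw [mvfderiv_extChartAt_coordinateField hz'] at h1
    have h2 : (fun z ↦ e.continuousLinearMapAt ℂ z (σ z)) =ᶠ[𝓝 z] fun _ ↦ c := by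
      filter_upwards [e.open_baseSet.mem_nhds hz] with z hz
      exact e.continuousLinearMapAt_symmL hz c
    have h3 : mvfderiv 𝓘(ℂ, V) (fun z ↦ e.continuousLinearMapAt ℂ z (σ z)) z = 0 :=
      (h2.mfderiv_eq).trans (mvfderiv_const c)
    refine h1.trans ?_
    have h4 : (trivializationAt F W x₀).continuousLinearMapAt ℂ z (σ z) = c := h2.self_of_nhds
    rw [h3, h4, zero_apply, zero_add]
  have hcov2 (v w : V) : e.continuousLinearMapAt ℂ y (cov (τ w) y (coordinateField x₀ v y)) =
      (fderiv ℂ A (φ y) v w + connectionForm cov x₀ y v * connectionForm cov x₀ y w) c := by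
    have h1 := continuousLinearMapAt_cov cov hy hy' (hτ w) (coordinateField x₀ v y)
    rw [mvfderiv_extChartAt_coordinateField hy'] at h1
    have h2 : (fun z ↦ e.continuousLinearMapAt ℂ z (τ w z)) =ᶠ[𝓝 y] fun z ↦ A (φ z) w c := by
      filter_upwards [hnear] with z hz
      rw [hτe w z hz.1 hz.2]
      simp only [A, Function.comp_apply, φ.left_inv (show z ∈ φ.source by simpa [φ] using hz.2)]
    have h3 := (hA.hasFDerivAt.clm_apply (hasFDerivAt_const w _)).clm_apply (hasFDerivAt_const c _)
    have h4 := h3.mvfderiv_comp (mdifferentiableAt_extChartAt hy') (coordinateField x₀ v y)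
    rw [mvfderiv_extChartAt_coordinateField hy'] at h4
    refine h1.trans ?_
    rw [hτe w y hy hy']
    rw [add_apply]
    congr 1
    simp only [ContinuousLinearMap.comp_zero, zero_add, ContinuousLinearMap.flip_apply] at h4
    exact (congrArg (fun L : TangentSpace 𝓘(ℂ, V) y →L[ℂ] F ↦ L (coordinateField x₀ v y))
      h2.mfderiv_eq).trans h4
  have h1 := hflat y (coordinateField x₀ v) (coordinateField x₀ w) σ
    (holomorphicSectionAt_coordinateField hy' v) (holomorphicSectionAt_coordinateField hy' w)
    (hσ y hy)
  rw [mlieBracket_coordinateField hy', map_zero, sub_zero] at h1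
  have h2 := congrArg (e.continuousLinearMapAt ℂ y) h1
  rw [map_sub, map_zero, sub_eq_zero] at h2
  rw [← hcov2 v w, ← hcov2 w v]
  exact h2.symm

theorem mvfderiv_clm_apply {B : M → F →L[ℂ] F} {B' : V → F →L[ℂ] F} {ψ : M → V} {u : M → F} {y : M}
    {D : V →L[ℂ] F →L[ℂ] F}
    (hB : B = B' ∘ ψ) (hB' : HasFDerivAt B' D (ψ y))
    (hψ : MDifferentiableAt 𝓘(ℂ, V) 𝓘(ℂ, V) ψ y) (hu : MDifferentiableAt 𝓘(ℂ, V) 𝓘(ℂ, F) u y)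
    (X : TangentSpace 𝓘(ℂ, V) y) :
    mvfderiv 𝓘(ℂ, V) (fun z ↦ B z (u z)) y X =
      D (mvfderiv 𝓘(ℂ, V) ψ y X) (u y) + B y (mvfderiv 𝓘(ℂ, V) u y X) := by
  subst hB
  have h1 : HasFDerivAt (fun p : V × F ↦ B' p.1 p.2) _ (ψ y, u y) :=
    (HasFDerivAt.comp (ψ y, u y) (g := B') hB' hasFDerivAt_fst).clm_apply hasFDerivAt_snd
  have h3 : HasMFDerivAt 𝓘(ℂ, V) 𝓘(ℂ, V × F) (fun z ↦ (ψ z, u z)) y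
      ((mvfderiv 𝓘(ℂ, V) ψ y).prod (mvfderiv 𝓘(ℂ, V) u y)) :=
    ⟨hψ.hasMFDerivAt.1.prodMk hu.hasMFDerivAt.1, hψ.hasMFDerivAt.2.prodMk hu.hasMFDerivAt.2⟩
  have h2 := HasMFDerivAt.comp y (g := fun p : V × F ↦ B' p.1 p.2) h1.hasMFDerivAt h3
  refine (congrArg (fun L : TangentSpace 𝓘(ℂ, V) y →L[ℂ] F ↦ L X) h2.mfderiv).trans ?_
  refine add_comm _ _

set_option synthInstance.maxHeartbeats 100000 in
/-- A flat holomorphic connection has local parallel trivializations. -/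
theorem exists_isParallelTrivialization [FiniteDimensional ℂ V] [IsManifold 𝓘(ℂ, V) ω M]
    [ContMDiffVectorBundle ω F W 𝓘(ℂ, V)] {cov : CovariantDerivative 𝓘(ℂ, V) F W}
    (hcov : IsHolomorphicConnection cov) (hflat : IsFlatConnection cov) (x₀ : M) :
    ∃ U T S, x₀ ∈ U ∧ IsParallelTrivialization cov U T S := by
  have : CompleteSpace V := FiniteDimensional.complete ℂ V
  have : CompleteSpace F := FiniteDimensional.complete ℂ F
  set e := trivializationAt F W x₀
  set φ := extChartAt 𝓘(ℂ, V) x₀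
  let A : V → V →L[ℂ] F →L[ℂ] F := connectionForm cov x₀ ∘ φ.symm
  have hφ₀ : φ.symm (φ x₀) = x₀ := extChartAt_to_inv x₀
  have hA : AnalyticAt ℂ A (φ x₀) := by
    have h1 : ContMDiffAt 𝓘(ℂ, V) 𝓘(ℂ, V) ω φ.symm (φ x₀) :=
      (contMDiffOn_extChartAt_symm x₀).contMDiffAt (extChartAt_target_mem_nhds x₀)
    have h2 := contMDiffAt_connectionForm hcov x₀
    have h3 : ContMDiffAt 𝓘(ℂ, V) 𝓘(ℂ, V →L[ℂ] F →L[ℂ] F) ω (connectionForm cov x₀)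
        (φ.symm (φ x₀)) := by rwa [hφ₀]
    exact (h3.comp (φ x₀) h1).contDiffAt.analyticAt
  have hnear : ∀ᶠ z in 𝓝 x₀, z ∈ e.baseSet ∧ z ∈ (chartAt V x₀).source :=
    Filter.Eventually.and (e.open_baseSet.mem_nhds (mem_baseSet_trivializationAt F W x₀))
      ((chartAt V x₀).open_source.mem_nhds (mem_chart_source V x₀))
  have hAflat : ∀ᶠ p in 𝓝 (φ x₀), ∀ v w, fderiv ℂ A p w v + A p w * A p v
      = fderiv ℂ A p v w + A p v * A p w := by
    have h1 : Filter.Tendsto φ.symm (𝓝 (φ x₀)) (𝓝 x₀) := by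
      have := continuousAt_extChartAt_symm (I := 𝓘(ℂ, V)) x₀
      rw [ContinuousAt] at this
      rwa [hφ₀] at this
    filter_upwards [hA.eventually_analyticAt, h1.eventually hnear,
      extChartAt_target_mem_nhds (I := 𝓘(ℂ, V)) x₀] with p hp hp' hpt v w
    have h2 : φ (φ.symm p) = p := φ.right_inv hpt
    have h3 := connectionForm_flat hcov hflat hp'.1 hp'.2 (by
      change DifferentiableAt ℂ A (φ (φ.symm p))
      rw [h2]
      exact hp.differentiableAt) v w
    change fderiv ℂ A (φ (φ.symm p)) w v + A p w * A p v =
      fderiv ℂ A (φ (φ.symm p)) v w + A p v * A p w at h3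
    rwa [h2] at h3
  obtain ⟨Q, hQ, hQ0, hdQ⟩ := exists_analyticAt_of_flat_at hA hAflat
  have hunit : ∀ᶠ p in 𝓝 (φ x₀), IsUnit (Q p) := by
    refine hQ.continuousAt.eventually (Units.isOpen.mem_nhds ?_)
    rw [hQ0]
    exact isUnit_one
  have hφc : Filter.Tendsto φ (𝓝 x₀) (𝓝 (φ x₀)) := continuousAt_extChartAt x₀
  have hφ (y) (hy : y ∈ (chartAt V x₀).source) : ContMDiffAt 𝓘(ℂ, V) 𝓘(ℂ, V) ω φ y :=
    contMDiffAt_extChartAt' hy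
  have hsec (y) (hy : y ∈ e.baseSet) (σ : ∀ z, W z) (hσ : HolomorphicSectionAt V F σ y) :
      ContMDiffAt 𝓘(ℂ, V) 𝓘(ℂ, F) ω (fun z ↦ e.continuousLinearMapAt ℂ z (σ z)) y := by
    refine ((e.contMDiffAt_section_iff hy).1 hσ).congr_of_eventuallyEq ?_
    filter_upwards [e.open_baseSet.mem_nhds hy] with z hz
    simp [e.coe_linearMapAt_of_mem hz]
  obtain ⟨U, hU, hUo, hx₀⟩ := eventually_nhds_iff.1 (hnear.and (hφc.eventually
    (hunit.and (hQ.eventually_analyticAt.and hdQ))))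
  -- With $u$ the coordinates of a section, $d(Qu)=Q(du+Au)$ because $dQ=QA$. Composing the
  -- trivialization with $Q$ therefore turns the connection into $d$. On `U` the map $Q$ is
  -- invertible, so `Ring.inverse` is a genuine inverse there.
  refine ⟨U, fun y ↦ Q (φ y) ∘L e.continuousLinearMapAt ℂ y,
    fun y ↦ e.symmL ℂ y ∘L Ring.inverse (Q (φ y)), hx₀, hUo, fun y hy w ↦ ?_, fun y hy c ↦ ?_,
    fun y hy σ hσ ↦ ?_, fun y hy c ↦ ?_, fun y hy σ hσ X ↦ ?_⟩
  · obtain ⟨⟨he, hs⟩, hu, ha, hd⟩ := hU y hy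
    have h1 := congrArg (fun L : F →L[ℂ] F ↦ L (e.continuousLinearMapAt ℂ y w))
      (Ring.inverse_mul_cancel _ hu)
    refine (congrArg (e.symmL ℂ y) h1).trans ?_
    exact e.symmL_continuousLinearMapAt he w
  · obtain ⟨⟨he, hs⟩, hu, ha, hd⟩ := hU y hy
    refine (congrArg (Q (φ y)) (e.continuousLinearMapAt_symmL he _)).trans ?_
    exact congrArg (fun L : F →L[ℂ] F ↦ L c) (Ring.mul_inverse_cancel _ hu)
  · obtain ⟨⟨he, hs⟩, hu, ha, hd⟩ := hU y hy
    exact (ha.contDiffAt.contMDiffAt.comp y (hφ y hs)).clm_apply (hsec y he σ hσ)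
  · obtain ⟨⟨he, hs⟩, hu, ha, hd⟩ := hU y hy
    rw [HolomorphicSectionAt, e.contMDiffAt_section_iff he]
    obtain ⟨q, hq⟩ := hu
    have h1 : AnalyticAt ℂ (Ring.inverse : (F →L[ℂ] F) → (F →L[ℂ] F)) (Q (φ y)) := by
      rw [← hq]
      exact analyticAt_inverse (𝕜 := ℂ) q
    have h2 : ContMDiffAt 𝓘(ℂ, V) 𝓘(ℂ, F →L[ℂ] F) ω (fun z ↦ Ring.inverse (Q (φ z))) y :=
      (h1.comp ha).contDiffAt.contMDiffAt.comp y (hφ y hs)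
    refine (h2.clm_apply (contMDiffAt_const (c := c))).congr_of_eventuallyEq ?_
    filter_upwards [e.open_baseSet.mem_nhds he] with z hz
    change (e ⟨z, e.symmL ℂ z (Ring.inverse (Q (φ z)) c)⟩).2 = _
    rw [e.symmL_apply hz, e.apply_mk_symm hz]
  · obtain ⟨⟨he, hs⟩, hu, ha, hd⟩ := hU y hy
    have h1 := mvfderiv_clm_apply (B := fun z ↦ Q (φ z)) rfl ha.differentiableAt.hasFDerivAt
      ((hφ y hs).mdifferentiableAt (by simp)) ((hsec y he σ hσ).mdifferentiableAt (by simp)) X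
    refine h1.trans ?_
    have h3 : A (φ y) = connectionForm cov x₀ y := by
      simp only [A, Function.comp_apply,
        φ.left_inv (show y ∈ φ.source by simpa [φ] using hs)]
    rw [hd, h3]
    have h4 := continuousLinearMapAt_cov cov he hs hσ X
    refine ((map_add (Q (φ y)) _ _).symm.trans ?_)
    refine (congrArg (Q (φ y)) ?_)
    rw [add_comm]
    exact h4.symm

end ParallelTrivialization

/-! ### Lie brackets of related vector fields -/

section RelatedFields

open VectorField

/-- Differentiate $Df\cdot X=X'\circ f$ along $Y$ and $Df\cdot Y=Y'\circ f$ along $X$ and subtract;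
the second-derivative terms of $f$ cancel by symmetry. -/
theorem fderiv_lieBracket_of_related {B B' : Type*} [NormedAddCommGroup B] [NormedSpace ℂ B]
    [NormedAddCommGroup B'] [NormedSpace ℂ B'] {f : B → B'} {x : B} (hf : ContDiffAt ℂ ω f x)
    {X Y : B → B} {X' Y' : B' → B'} (hX : DifferentiableAt ℂ X x) (hY : DifferentiableAt ℂ Y x)
    (hX' : DifferentiableAt ℂ X' (f x)) (hY' : DifferentiableAt ℂ Y' (f x))
    (hXX' : ∀ᶠ y in 𝓝 x, fderiv ℂ f y (X y) = X' (f y))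
    (hYY' : ∀ᶠ y in 𝓝 x, fderiv ℂ f y (Y y) = Y' (f y)) :
    fderiv ℂ f x (lieBracket ℂ X Y x) = lieBracket ℂ X' Y' (f x) := by
  have hf1 : HasFDerivAt f (fderiv ℂ f x) x := (hf.differentiableAt (by simp)).hasFDerivAt
  have hf2 : HasFDerivAt (fderiv ℂ f) (fderiv ℂ (fderiv ℂ f) x) x :=
    ((hf.fderiv_right (m := 1) (by simp)).differentiableAt (by simp)).hasFDerivAt
  have key : ∀ {X : B → B} {X' : B' → B'}, DifferentiableAt ℂ X x → DifferentiableAt ℂ X' (f x) →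
      (∀ᶠ y in 𝓝 x, fderiv ℂ f y (X y) = X' (f y)) → ∀ v,
      fderiv ℂ (fderiv ℂ f) x v (X x) + fderiv ℂ f x (fderiv ℂ X x v) =
        fderiv ℂ X' (f x) (fderiv ℂ f x v) := by
    intro X X' hX hX' h v
    have h1 := hf2.clm_apply hX.hasFDerivAt
    have h2 := hX'.hasFDerivAt.comp x hf1
    have h3 := congrArg (fun L : B →L[ℂ] B' ↦ L v) (h1.unique (h2.congr_of_eventuallyEq h))
    simpa [add_comm] using h3
  have hs := hf.isSymmSndFDerivAt (by simp) (X x) (Y x)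
  rw [lieBracket, lieBracket, map_sub, ← hXX'.self_of_nhds, ← hYY'.self_of_nhds,
    ← key hX hX' hXX', ← key hY hY' hYY', hs]
  abel

variable {B : Type*} [NormedAddCommGroup B] [NormedSpace ℂ B]
  {K : Type*} [TopologicalSpace K] {I : ModelWithCorners ℂ B K}
  {M : Type*} [TopologicalSpace M] [ChartedSpace K M]
  {B' : Type*} [NormedAddCommGroup B'] [NormedSpace ℂ B']
  {K' : Type*} [TopologicalSpace K'] {I' : ModelWithCorners ℂ B' K'}
  {N : Type*} [TopologicalSpace N] [ChartedSpace K' N]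

theorem mfderiv_mpullback_apply {f : M → N} {x : M} (h : (mfderiv I I' f x).IsInvertible)
    (X : ∀ y : N, TangentSpace I' y) : mfderiv I I' f x (mpullback I I' f X x) = X (f x) := by
  obtain ⟨L, hL⟩ := h
  have h1 : mpullback I I' f X x = L.symm (X (f x)) := by
    refine mpullback_apply.trans ?_
    rw [← hL, ContinuousLinearMap.inverse_equiv]
    rfl
  rw [h1, ← hL]
  exact L.apply_symm_apply _

variable [I.Boundaryless] [I'.Boundaryless] [IsManifold I ω M] [IsManifold I' ω N]

theorem contMDiffAt_extChartAt_symm_of_mem {x : M} {p : B} (hp : p ∈ (extChartAt I x).target) :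
    ContMDiffAt 𝓘(ℂ, B) I ω (extChartAt I x).symm p :=
  (contMDiffOn_extChartAt_symm x).contMDiffAt
    ((isOpen_extChartAt_target x).mem_nhds hp)

theorem isInvertible_mfderiv_extChartAt_symm {x : M} {p : B} (hp : p ∈ (extChartAt I x).target) :
    (mfderiv 𝓘(ℂ, B) I (extChartAt I x).symm p).IsInvertible := by
  have := isInvertible_mfderivWithin_extChartAt_symm (I := I) hp
  rwa [I.range_eq_univ, mfderivWithin_univ] at this

theorem mlieBracket_eq_lieBracket_apply (X Y : B → B) (p : B) :
    mlieBracket 𝓘(ℂ, B) (fun q ↦ (X q : TangentSpace 𝓘(ℂ, B) q)) Y p = lieBracket ℂ X Y p := by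
  have h : mlieBracketWithin 𝓘(ℂ, B) (fun q ↦ (X q : TangentSpace 𝓘(ℂ, B) q)) Y Set.univ p =
    lieBracketWithin ℂ X Y Set.univ p := congrFun (mlieBracketWithin_eq_lieBracketWithin) p
  rw [lieBracketWithin_univ] at h
  exact (congrFun mlieBracketWithin_univ p).symm.trans h

theorem mfderiv_mlieBracket_of_related_vectorSpace {f : B → B'} {x : B} (hf : ContDiffAt ℂ ω f x)
    {X Y : ∀ p : B, TangentSpace 𝓘(ℂ, B) p} {X' Y' : ∀ p : B', TangentSpace 𝓘(ℂ, B') p}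
    (hX : ContMDiffAt 𝓘(ℂ, B) 𝓘(ℂ, B).tangent ω
      (fun y ↦ (⟨y, X y⟩ : TangentBundle 𝓘(ℂ, B) B)) x)
    (hY : ContMDiffAt 𝓘(ℂ, B) 𝓘(ℂ, B).tangent ω
      (fun y ↦ (⟨y, Y y⟩ : TangentBundle 𝓘(ℂ, B) B)) x)
    (hX' : ContMDiffAt 𝓘(ℂ, B') 𝓘(ℂ, B').tangent ω
      (fun y ↦ (⟨y, X' y⟩ : TangentBundle 𝓘(ℂ, B') B')) (f x))
    (hY' : ContMDiffAt 𝓘(ℂ, B') 𝓘(ℂ, B').tangent ω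
      (fun y ↦ (⟨y, Y' y⟩ : TangentBundle 𝓘(ℂ, B') B')) (f x))
    (hXX' : ∀ᶠ y in 𝓝 x, mfderiv 𝓘(ℂ, B) 𝓘(ℂ, B') f y (X y) = X' (f y))
    (hYY' : ∀ᶠ y in 𝓝 x, mfderiv 𝓘(ℂ, B) 𝓘(ℂ, B') f y (Y y) = Y' (f y)) :
    mfderiv 𝓘(ℂ, B) 𝓘(ℂ, B') f x (mlieBracket 𝓘(ℂ, B) X Y x) =
      mlieBracket 𝓘(ℂ, B') X' Y' (f x) := by
  have h1 := fderiv_lieBracket_of_related hf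
    ((contMDiffAt_vectorSpace_iff_contDiffAt.1 hX).differentiableAt (by simp)) ((contMDiffAt_vectorSpace_iff_contDiffAt.1 hY).differentiableAt (by simp))
    ((contMDiffAt_vectorSpace_iff_contDiffAt.1 hX').differentiableAt (by simp)) ((contMDiffAt_vectorSpace_iff_contDiffAt.1 hY').differentiableAt (by simp))
    (by
      filter_upwards [hXX'] with y hy
      rw [mfderiv_eq_fderiv] at hy
      exact hy)
    (by
      filter_upwards [hYY'] with y hy
      rw [mfderiv_eq_fderiv] at hy
      exact hy)
  refine Eq.trans ?_ (h1.trans (mlieBracket_eq_lieBracket_apply (B := B') X' Y' (f x)).symm)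
  rw [mfderiv_eq_fderiv]
  exact congrArg (fderiv ℂ f x) (mlieBracket_eq_lieBracket_apply X Y x)

variable [CompleteSpace B] [CompleteSpace B']

/-- The coordinate expression of a differentiable vector field has the bracket given by the
coordinate expression of the bracket. -/
theorem mfderiv_extChartAt_symm_mlieBracket {x : M} {X Y : ∀ y : M, TangentSpace I y}
    (hX : ContMDiffAt I I.tangent ω (fun y ↦ (⟨y, X y⟩ : TangentBundle I M)) x)
    (hY : ContMDiffAt I I.tangent ω (fun y ↦ (⟨y, Y y⟩ : TangentBundle I M)) x) :
    mfderiv 𝓘(ℂ, B) I (extChartAt I x).symm (extChartAt I x x)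
      (mlieBracket 𝓘(ℂ, B) (mpullback 𝓘(ℂ, B) I (extChartAt I x).symm X)
        (mpullback 𝓘(ℂ, B) I (extChartAt I x).symm Y) (extChartAt I x x)) =
      (mlieBracket I X Y x : B) := by
  have hx : (extChartAt I x).symm (extChartAt I x x) = x := extChartAt_to_inv x
  have hp := mem_extChartAt_target (I := I) x
  have h1 := mpullback_mlieBracket (I := 𝓘(ℂ, B)) (I' := I) (f := (extChartAt I x).symm)
    (x₀ := extChartAt I x x) (V := X) (W := Y) (n := ω)
    (by rw [hx]; exact hX.mdifferentiableAt (by simp))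
    (by rw [hx]; exact hY.mdifferentiableAt (by simp)) (contMDiffAt_extChartAt_symm_of_mem hp) (by simp)
  have h2 := mfderiv_mpullback_apply (isInvertible_mfderiv_extChartAt_symm hp) (mlieBracket I X Y)
  rw [h1] at h2
  refine h2.trans ?_
  exact congrArg (fun q ↦ (mlieBracket I X Y q : B)) hx

/-- If two pairs of holomorphic vector fields are related by a holomorphic map, so are their
Lie brackets. -/
theorem mfderiv_mlieBracket_of_related {f : M → N} {x : M} (hf : ContMDiffAt I I' ω f x)
    {X Y : ∀ y : M, TangentSpace I y} {X' Y' : ∀ y : N, TangentSpace I' y}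
    (hX : ContMDiffAt I I.tangent ω (fun y ↦ (⟨y, X y⟩ : TangentBundle I M)) x)
    (hY : ContMDiffAt I I.tangent ω (fun y ↦ (⟨y, Y y⟩ : TangentBundle I M)) x)
    (hX' : ContMDiffAt I' I'.tangent ω (fun y ↦ (⟨y, X' y⟩ : TangentBundle I' N)) (f x))
    (hY' : ContMDiffAt I' I'.tangent ω (fun y ↦ (⟨y, Y' y⟩ : TangentBundle I' N)) (f x))
    (hXX' : ∀ᶠ y in 𝓝 x, mfderiv I I' f y (X y) = X' (f y))
    (hYY' : ∀ᶠ y in 𝓝 x, mfderiv I I' f y (Y y) = Y' (f y)) :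
    mfderiv I I' f x (mlieBracket I X Y x) = mlieBracket I' X' Y' (f x) := by
  set φ := extChartAt I x
  set ψ := extChartAt I' (f x)
  have hφx : φ.symm (φ x) = x := extChartAt_to_inv x
  have hp : φ x ∈ φ.target := mem_extChartAt_target (I := I) x
  have hp' : ψ (f x) ∈ ψ.target := mem_extChartAt_target (I := I') (f x)
  -- The coordinate expression of `f`. The fields pulled back to the model spaces are related by `F`
  -- near `φ x`, so the vector-space case applies to them; the bracket of pullbacks is the pullback
  -- of the bracket.
  let F : B → B' := fun q ↦ ψ (f (φ.symm q))
  have hFp : F (φ x) = ψ (f x) := by simp only [F, hφx]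
  have hg (q : B) (hq : q ∈ φ.target) : ContMDiffAt 𝓘(ℂ, B) I ω φ.symm q :=
    contMDiffAt_extChartAt_symm_of_mem hq
  have hk (q : B') (hq : q ∈ ψ.target) : ContMDiffAt 𝓘(ℂ, B') I' ω ψ.symm q :=
    contMDiffAt_extChartAt_symm_of_mem hq
  have hnear : ∀ᶠ y in 𝓝 x, ContMDiffAt I I' ω f y ∧ f y ∈ ψ.source :=
    ((contMDiffAt_iff_contMDiffAt_nhds (by simp)).1 hf).and
      (hf.continuousAt.eventually ((isOpen_extChartAt_source (f x)).mem_nhds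
        (mem_extChartAt_source (I := I') (f x))))
  have hF (q : B) (hq : q ∈ φ.target) (hq' : ContMDiffAt I I' ω f (φ.symm q))
      (hq'' : f (φ.symm q) ∈ ψ.source) : ContMDiffAt 𝓘(ℂ, B) 𝓘(ℂ, B') ω F q :=
    (contMDiffAt_extChartAt' (I := I') (by simpa [ψ] using hq'')).comp q (hq'.comp q (hg q hq))
  have htend : Filter.Tendsto φ.symm (𝓝 (φ x)) (𝓝 x) := by
    have := (hg _ hp).continuousAt.tendsto
    rwa [hφx] at this
  have hnear' : ∀ᶠ q in 𝓝 (φ x), q ∈ φ.target ∧ ContMDiffAt I I' ω f (φ.symm q) ∧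
      f (φ.symm q) ∈ ψ.source :=
    Filter.Eventually.and ((isOpen_extChartAt_target x).mem_nhds hp) (htend.eventually hnear)
  have hrel {Z : ∀ y : M, TangentSpace I y} {Z' : ∀ y : N, TangentSpace I' y}
      (h : ∀ᶠ y in 𝓝 x, mfderiv I I' f y (Z y) = Z' (f y)) :
      ∀ᶠ q in 𝓝 (φ x), mfderiv 𝓘(ℂ, B) 𝓘(ℂ, B') F q (mpullback 𝓘(ℂ, B) I φ.symm Z q) =
        mpullback 𝓘(ℂ, B') I' ψ.symm Z' (F q) := by
    filter_upwards [hnear'.eventually_nhds, htend.eventually h] with q hq hZ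
    obtain ⟨h1, h2, h3⟩ := hq.self_of_nhds
    have hFq : F q ∈ ψ.target := ψ.map_source h3
    have hinv := isInvertible_mfderiv_extChartAt_symm (I := I') hFq
    have hinj : Function.Injective (mfderiv 𝓘(ℂ, B') I' ψ.symm (F q)) := by
      obtain ⟨L, hL⟩ := hinv
      rw [← hL]
      exact L.injective
    -- The relation is checked after applying the injective differential of the inverse chart of
    -- `N`, where both sides are computed by the chain rule from $\psi^{-1}\circ
    -- F=f\circ\varphi^{-1}$.
    apply hinj
    refine Eq.trans ?_ (mfderiv_mpullback_apply hinv Z').symm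
    have h4 : mfderiv 𝓘(ℂ, B) I' (ψ.symm ∘ F) q = (mfderiv 𝓘(ℂ, B') I' ψ.symm (F q)).comp
        (mfderiv 𝓘(ℂ, B) 𝓘(ℂ, B') F q) :=
      mfderiv_comp q ((hk _ hFq).mdifferentiableAt (by simp))
        ((hF q h1 h2 h3).mdifferentiableAt (by simp))
    have h5 : mfderiv 𝓘(ℂ, B) I' (f ∘ φ.symm) q = (mfderiv I I' f (φ.symm q)).comp
        (mfderiv 𝓘(ℂ, B) I φ.symm q) :=
      mfderiv_comp q (h2.mdifferentiableAt (by simp)) ((hg q h1).mdifferentiableAt (by simp))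
    have h6 : (ψ.symm ∘ F) =ᶠ[𝓝 q] (f ∘ φ.symm) := by
      filter_upwards [hq] with r hr
      exact ψ.left_inv hr.2.2
    have h7 : (mfderiv 𝓘(ℂ, B) I' (ψ.symm ∘ F) q : B →L[ℂ] B') =
        mfderiv 𝓘(ℂ, B) I' (f ∘ φ.symm) q := h6.mfderiv_eq
    have h8 := congrArg (fun L : B →L[ℂ] B' ↦ L (mpullback 𝓘(ℂ, B) I φ.symm Z q))
      ((h4.symm.trans h7).trans h5)
    refine h8.trans ?_
    refine (congrArg (mfderiv I I' f (φ.symm q))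
      (mfderiv_mpullback_apply (isInvertible_mfderiv_extChartAt_symm h1) Z)).trans ?_
    refine hZ.trans ?_
    exact congrArg (fun y ↦ (Z' y : B')) (ψ.left_inv h3).symm
  have hsmooth {Z : ∀ y : M, TangentSpace I y}
      (hZ : ContMDiffAt I I.tangent ω (fun y ↦ (⟨y, Z y⟩ : TangentBundle I M)) x) :
      ContMDiffAt 𝓘(ℂ, B) 𝓘(ℂ, B).tangent ω
        (fun q ↦ (⟨q, mpullback 𝓘(ℂ, B) I φ.symm Z q⟩ : TangentBundle 𝓘(ℂ, B) B)) (φ x) :=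
    ContMDiffAt.mpullback_vectorField_preimage (by rwa [hφx]) (hg _ hp)
      (isInvertible_mfderiv_extChartAt_symm hp) (by simp)
  have hψx : ψ.symm (ψ (f x)) = f x := extChartAt_to_inv (f x)
  have hsmooth' {Z : ∀ y : N, TangentSpace I' y}
      (hZ : ContMDiffAt I' I'.tangent ω (fun y ↦ (⟨y, Z y⟩ : TangentBundle I' N)) (f x)) :
      ContMDiffAt 𝓘(ℂ, B') 𝓘(ℂ, B').tangent ω
        (fun q ↦ (⟨q, mpullback 𝓘(ℂ, B') I' ψ.symm Z q⟩ : TangentBundle 𝓘(ℂ, B') B'))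
        (F (φ x)) := by
    rw [hFp]
    exact ContMDiffAt.mpullback_vectorField_preimage (by rwa [hψx]) (hk _ hp')
      (isInvertible_mfderiv_extChartAt_symm hp') (by simp)
  have hFφ := hF (φ x) hp (by rw [hφx]; exact hf)
    (by rw [hφx]; exact mem_extChartAt_source (I := I') (f x))
  have hmain := mfderiv_mlieBracket_of_related_vectorSpace hFφ.contDiffAt
    (hsmooth hX) (hsmooth hY) (hsmooth' hX') (hsmooth' hY') (hrel hXX') (hrel hYY')
  have h1 := mfderiv_extChartAt_symm_mlieBracket hX hY
  have h2 := mfderiv_extChartAt_symm_mlieBracket hX' hY'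
  have hfx : MDifferentiableAt I I' f (φ.symm (φ x)) := by
    rw [hφx]
    exact hf.mdifferentiableAt (by simp)
  have h3 : mfderiv 𝓘(ℂ, B) I' (ψ.symm ∘ F) (φ x) = (mfderiv 𝓘(ℂ, B') I' ψ.symm (F (φ x))).comp
      (mfderiv 𝓘(ℂ, B) 𝓘(ℂ, B') F (φ x)) :=
    mfderiv_comp (φ x) ((hk _ (by rwa [hFp])).mdifferentiableAt (by simp))
      (hFφ.mdifferentiableAt (by simp))
  have h4 : mfderiv 𝓘(ℂ, B) I' (f ∘ φ.symm) (φ x) = (mfderiv I I' f (φ.symm (φ x))).comp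
      (mfderiv 𝓘(ℂ, B) I φ.symm (φ x)) :=
    mfderiv_comp (φ x) hfx ((hg _ hp).mdifferentiableAt (by simp))
  have h5 : (ψ.symm ∘ F) =ᶠ[𝓝 (φ x)] (f ∘ φ.symm) := by
    filter_upwards [hnear'] with r hr
    exact ψ.left_inv hr.2.2
  have h6 : (mfderiv 𝓘(ℂ, B) I' (ψ.symm ∘ F) (φ x) : B →L[ℂ] B') =
      mfderiv 𝓘(ℂ, B) I' (f ∘ φ.symm) (φ x) := h5.mfderiv_eq
  have h7 := congrArg (fun L : B →L[ℂ] B' ↦ L (mlieBracket 𝓘(ℂ, B)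
    (mpullback 𝓘(ℂ, B) I φ.symm X) (mpullback 𝓘(ℂ, B) I φ.symm Y) (φ x)))
      ((h3.symm.trans h6).trans h4)
  have h8 : (mfderiv I I' f x : B →L[ℂ] B') = mfderiv I I' f (φ.symm (φ x)) :=
    congrArg (β := B →L[ℂ] B') (fun y ↦ mfderiv I I' f y) hφx.symm
  refine (congrArg (mfderiv I I' f x) h1.symm).trans ?_
  refine (congrArg (fun L : B →L[ℂ] B' ↦ L (mfderiv 𝓘(ℂ, B) I φ.symm (φ x) (mlieBracket 𝓘(ℂ, B)
    (mpullback 𝓘(ℂ, B) I φ.symm X) (mpullback 𝓘(ℂ, B) I φ.symm Y) (φ x)))) h8).trans ?_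
  refine h7.symm.trans ?_
  refine (congrArg (mfderiv 𝓘(ℂ, B') I' ψ.symm (F (φ x))) hmain).trans ?_
  refine Eq.trans ?_ h2
  exact congrArg (fun q ↦ (mfderiv 𝓘(ℂ, B') I' ψ.symm q : B' →L[ℂ] B')
    (mlieBracket 𝓘(ℂ, B') (mpullback 𝓘(ℂ, B') I' ψ.symm X') (mpullback 𝓘(ℂ, B') I' ψ.symm Y') q))
      hFp

end RelatedFields

/-! ### Linear forms and symplectic forms on a plane -/

section TwoDimensional

variable {A : Type*} [AddCommGroup A] [Module ℂ A] [Module.Finite ℂ A]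

theorem exists_eq_smul_of_apply_eq_zero (hA : Module.finrank ℂ A = 2) {h : Module.Dual ℂ A}
    (hh : h ≠ 0) {κ : A} (hκ : κ ≠ 0) (hhκ : h κ = 0) {w : A} (hw : h w = 0) :
    ∃ a : ℂ, w = a • κ := by
  have h1 := Module.Dual.finrank_ker_add_one_of_ne_zero hh
  have h2 : Module.finrank ℂ (LinearMap.ker h) = 1 := by omega
  have hκ' : (⟨κ, hhκ⟩ : LinearMap.ker h) ≠ 0 := fun h ↦ hκ (congrArg Subtype.val h)
  obtain ⟨a, ha⟩ := (finrank_eq_one_iff_of_nonzero' _ hκ').1 h2 ⟨w, hw⟩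
  exact ⟨a, (congrArg Subtype.val ha).symm⟩

theorem exists_ne_zero_apply_eq_zero (hA : Module.finrank ℂ A = 2) {h : Module.Dual ℂ A}
    (hh : h ≠ 0) : ∃ κ : A, κ ≠ 0 ∧ h κ = 0 := by
  have h1 := Module.Dual.finrank_ker_add_one_of_ne_zero hh
  have : Nontrivial (LinearMap.ker h) := Module.nontrivial_of_finrank_pos (R := ℂ) (by omega)
  obtain ⟨κ, hκ⟩ := exists_ne (0 : LinearMap.ker h)
  exact ⟨κ, fun h ↦ hκ (Subtype.ext h), κ.2⟩

theorem exists_dual_apply_eq_one {h : Module.Dual ℂ A} (hh : h ≠ 0) : ∃ κ, h κ = 1 := by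
  obtain ⟨w, hw⟩ : ∃ w, h w ≠ 0 := by
    by_contra! H
    exact hh (LinearMap.ext H)
  exact ⟨(h w)⁻¹ • w, by simp [hw]⟩

/-- Two linear forms on a plane vanishing at the same nonzero vector are proportional. -/
theorem exists_dual_eq_smul (hA : Module.finrank ℂ A = 2) {h p : Module.Dual ℂ A}
    (hh : h ≠ 0) {κ : A} (hκ : κ ≠ 0) (hhκ : h κ = 0) (hp : p κ = 0) : ∃ a : ℂ, p = a • h := by
  obtain ⟨κ', hκ'⟩ := exists_dual_apply_eq_one hh
  refine ⟨p κ', LinearMap.ext fun w ↦ ?_⟩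
  obtain ⟨a, ha⟩ := exists_eq_smul_of_apply_eq_zero hA hh hκ hhκ (w := w - h w • κ')
    (by simp [hκ'])
  have h1 := congrArg p ha
  simp only [map_sub, map_smul, hp, smul_eq_mul, mul_zero, sub_eq_zero] at h1
  simp [h1, mul_comm]

/-- The pairing with a linear form `h` with respect to a symplectic form on the dual plane is, up
to a nonzero factor, the evaluation at a vector in the kernel of `h`. -/
theorem alternating_apply_eq_zero_iff (hA : Module.finrank ℂ A = 2)
    {β : LinearMap.BilinForm ℂ (Module.Dual ℂ A)} (halt : β.IsAlt) (hnon : β.Nondegenerate)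
    {h p : Module.Dual ℂ A} (hh : h ≠ 0) {κ : A} (hκ : κ ≠ 0) (hhκ : h κ = 0) :
    β p h = 0 ↔ p κ = 0 := by
  constructor
  · intro hp
    by_contra hpκ
    refine hh (hnon.2 h fun q ↦ ?_)
    -- If $p(\kappa)\neq 0$, every covector $q$ is a combination of $p$ and $h$: the multiple of $p$
    -- matching $q$ at $\kappa$ leaves a form vanishing on $\ker h$. Then $\beta(p,h)=0$ would put
    -- $h$ in the radical of $\beta$.
    obtain ⟨a, ha⟩ := exists_dual_eq_smul hA hh hκ hhκ (p := q - (q κ / p κ) • p)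
      (by simp [hpκ])
    rw [sub_eq_iff_eq_add.1 ha]
    simp [hp, halt h]
  · intro hp
    obtain ⟨a, rfl⟩ := exists_dual_eq_smul hA hh hκ hhκ hp
    simp [halt h]

theorem exists_alternating_apply_eq_one {B : Type*} [AddCommGroup B] [Module ℂ B]
    {β : LinearMap.BilinForm ℂ B} (hnon : β.Nondegenerate) {h : B} (hh : h ≠ 0) :
    ∃ q, β h q = 1 := by
  obtain ⟨q, hq⟩ : ∃ q, β h q ≠ 0 := by
    by_contra! H
    exact hh (hnon.1 h H)
  exact ⟨(β h q)⁻¹ • q, by simp [hq]⟩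

theorem sum_perm_fin_three {R : Type*} [AddCommMonoid R] {α : Type*} (h : Fin 3 → α)
    (t : (Fin 3 → α) → R) :
    ∑ ρ : Equiv.Perm (Fin 3), t (h ∘ ρ) = t ![h 0, h 1, h 2] + t ![h 0, h 2, h 1] +
      t ![h 1, h 0, h 2] + t ![h 1, h 2, h 0] + t ![h 2, h 0, h 1] + t ![h 2, h 1, h 0] := by
  have h1 : (Finset.univ : Finset (Equiv.Perm (Fin 3))).val =
      {1, Equiv.swap 1 2, Equiv.swap 0 1, Equiv.swap 0 1 * Equiv.swap 1 2,
        Equiv.swap 1 2 * Equiv.swap 0 1, Equiv.swap 0 2} := by decide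
  have h2 : ∀ i j k : Fin 3, ∀ ρ : Equiv.Perm (Fin 3), ρ 0 = i → ρ 1 = j → ρ 2 = k →
      h ∘ ρ = ![h i, h j, h k] := by
    rintro _ _ _ ρ rfl rfl rfl
    funext a
    fin_cases a <;> rfl
  rw [Finset.sum, h1]
  simp only [Multiset.insert_eq_cons, Multiset.map_cons, Multiset.sum_cons,
    Multiset.map_singleton, Multiset.sum_singleton]
  rw [h2 0 1 2 1 rfl rfl rfl, h2 0 2 1 (Equiv.swap 1 2) (by decide) (by decide) (by decide),
    h2 1 0 2 (Equiv.swap 0 1) (by decide) (by decide) (by decide),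
    h2 1 2 0 (Equiv.swap 0 1 * Equiv.swap 1 2) (by decide) (by decide) (by decide),
    h2 2 0 1 (Equiv.swap 1 2 * Equiv.swap 0 1) (by decide) (by decide) (by decide),
    h2 2 1 0 (Equiv.swap 0 2) (by decide) (by decide) (by decide)]
  simp only [add_assoc]

end TwoDimensional

namespace HalfFlatGrassmannManifold

/-! ### The torsion on $E^*\otimes h$ as a cubic form in $h$ -/

section Torsion

variable {V : Type*} [NormedAddCommGroup V] [NormedSpace ℂ V] [FiniteDimensional ℂ V]
  {M : Type*} [TopologicalSpace M] [ChartedSpace V M] [IsManifold 𝓘(ℂ, V) ω M]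
  {FE : Type*} [NormedAddCommGroup FE] [NormedSpace ℂ FE] [FiniteDimensional ℂ FE]
  {E : M → Type*} [TopologicalSpace (TotalSpace FE E)]
  [∀ x, AddCommGroup (E x)] [∀ x, Module ℂ (E x)] [∀ x, TopologicalSpace (E x)]
  [∀ x, IsTopologicalAddGroup (E x)] [∀ x, ContinuousSMul ℂ (E x)]
  [FiberBundle FE E] [VectorBundle ℂ FE E] [ContMDiffVectorBundle ω FE E 𝓘(ℂ, V)]
  {FH : Type*} [NormedAddCommGroup FH] [NormedSpace ℂ FH] [FiniteDimensional ℂ FH]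
  {H : M → Type*} [TopologicalSpace (TotalSpace FH H)]
  [∀ x, AddCommGroup (H x)] [∀ x, Module ℂ (H x)] [∀ x, TopologicalSpace (H x)]
  [∀ x, IsTopologicalAddGroup (H x)] [∀ x, ContinuousSMul ℂ (H x)]
  [FiberBundle FH H] [VectorBundle ℂ FH H] [ContMDiffVectorBundle ω FH H 𝓘(ℂ, V)]

variable (G : HalfFlatGrassmannManifold V M FE E FH H)

theorem finrank_fiber (x : M) : Module.finrank ℂ (H x) = Module.finrank ℂ FH :=
  (((trivializationAt FH H x).continuousLinearEquivAt ℂ x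
    (mem_baseSet_trivializationAt FH H x)).toLinearEquiv).finrank_eq

/-- The decomposable forms $\varepsilon\otimes\kappa$ span $T^*_xM$, hence separate tangent vectors.
-/
theorem eq_zero_of_iso_apply {x : M} {v : TangentSpace 𝓘(ℂ, V) x}
    (h : ∀ ε κ, G.iso x (ε ⊗ₜ[ℂ] κ) v = 0) : v = 0 := by
  have : Module.Finite ℂ (TangentSpace 𝓘(ℂ, V) x) := inferInstanceAs (Module.Finite ℂ V)
  refine (Module.forall_dual_apply_eq_zero_iff ℂ v).1 fun φ ↦ ?_
  obtain ⟨t, rfl⟩ := (G.iso x).surjective φ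
  induction t using TensorProduct.induction_on with
  | zero => simp
  | tmul ε κ => exact h ε κ
  | add a b ha hb => rw [map_add, LinearMap.add_apply, ha, hb, add_zero]

theorem tangentEquiv_mem_leafSpace (x : M) (e : Module.Dual ℂ (E x)) (h : Module.Dual ℂ (H x)) :
    G.tangentEquiv x (e ⊗ₜ[ℂ] h) ∈ G.leafSpace x h := ⟨e, rfl⟩

/-- Here the rank of $H$ is used: $\ker h$ is spanned by $\kappa$. If $h(\kappa')=1$, a vector $v$
killed by all $\varepsilon\otimes\kappa$ equals $e\otimes h$ with $e$ the contraction of $v$ with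
$\kappa'$. -/
theorem mem_leafSpace_iff (hH : Module.finrank ℂ FH = 2) {x : M} {h : Module.Dual ℂ (H x)}
    (hh : h ≠ 0) {κ : H x} (hκ : κ ≠ 0) (hhκ : h κ = 0) {v : TangentSpace 𝓘(ℂ, V) x} :
    v ∈ G.leafSpace x h ↔ ∀ ε, G.iso x (ε ⊗ₜ[ℂ] κ) v = 0 := by
  have : Module.Finite ℂ (H x) := finite_fiber (F := FH) x
  constructor
  · rintro ⟨e, rfl⟩ ε
    refine (G.iso_tangentEquiv x e h ε κ).trans ?_
    rw [hhκ, mul_zero]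
  · intro H'
    obtain ⟨κ', hκ'⟩ := exists_dual_apply_eq_one hh
    let e : Module.Dual ℂ (E x) := LinearMap.applyₗ v ∘ₗ (G.iso x).toLinearMap ∘ₗ
      (TensorProduct.mk ℂ (E x) (H x)).flip κ'
    have he (ε : E x) : e ε = G.iso x (ε ⊗ₜ[ℂ] κ') v := rfl
    refine ⟨e, ?_⟩
    refine (sub_eq_zero.1 (G.eq_zero_of_iso_apply fun ε w ↦ ?_)).symm
    refine (map_sub (G.iso x (ε ⊗ₜ[ℂ] w)) v (G.tangentEquiv x (e ⊗ₜ[ℂ] h))).trans ?_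
    rw [G.iso_tangentEquiv, he]
    obtain ⟨a, ha⟩ := exists_eq_smul_of_apply_eq_zero ((finrank_fiber x).trans hH) hh hκ hhκ
      (w := w - h w • κ') (by simp [hκ'])
    rw [sub_eq_iff_eq_add.1 ha]
    simp [TensorProduct.tmul_add, H', hhκ, hκ', mul_comm]

theorem leafSpace_zero (x : M) : G.leafSpace x 0 = ⊥ := by
  rw [eq_bot_iff]
  rintro _ ⟨e, rfl⟩
  simp

theorem torsion_antisymm (x : M) (X Y : TangentSpace 𝓘(ℂ, V) x) :
    G.torsion x X Y = - G.torsion x Y X :=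
  haveI : CompleteSpace V := FiniteDimensional.complete ℂ V
  G.nabla.torsion_antisymm X Y

theorem torsion_add_left (x : M) (X X' Y : TangentSpace 𝓘(ℂ, V) x) :
    G.torsion x (X + X') Y = G.torsion x X Y + G.torsion x X' Y := by
  simp [torsion]

theorem torsion_add_right (x : M) (X Y Y' : TangentSpace 𝓘(ℂ, V) x) :
    G.torsion x X (Y + Y') = G.torsion x X Y + G.torsion x X Y' := by
  simp [torsion]

/-- Pairing a covector with $h$ under $\omega_H$ vanishes exactly when the covector vanishes on
$\ker h$, which is the criterion of `mem_leafSpace_iff`. For $h=0$ both sides hold trivially. -/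
theorem torsionTensor_eq_zero_iff (hH : Module.finrank ℂ FH = 2) {x : M} {h : Module.Dual ℂ (H x)}
    {e e' : Module.Dual ℂ (E x)} :
    (∀ ε, G.torsionTensor x ε e e' (fun _ ↦ h) = 0) ↔
      G.torsion x (G.tangentEquiv x (e ⊗ₜ[ℂ] h)) (G.tangentEquiv x (e' ⊗ₜ[ℂ] h)) ∈
        G.leafSpace x h := by
  have : Module.Finite ℂ (H x) := finite_fiber (F := FH) x
  rcases eq_or_ne h 0 with rfl | hh
  · have h1 : G.torsion x (G.tangentEquiv x (e ⊗ₜ[ℂ] 0)) (G.tangentEquiv x (e' ⊗ₜ[ℂ] 0)) = 0 := by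
      simp [torsion]
    rw [h1]
    exact iff_of_true (fun ε ↦ by simp [torsionTensor]) (Submodule.zero_mem _)
  · have hH' : Module.finrank ℂ (H x) = 2 := (finrank_fiber x).trans hH
    obtain ⟨κ, hκ, hhκ⟩ := exists_ne_zero_apply_eq_zero hH' hh
    rw [G.mem_leafSpace_iff hH hh hκ hhκ]
    refine forall_congr' fun ε ↦ ?_
    exact alternating_apply_eq_zero_iff hH' (G.omega_alt x) (G.omega_nondegenerate x) hh hκ hhκ

/-- Skew-symmetry of the torsion exchanges $e,e'$ and the first two factors $H$ at once. After
symmetrisation over $H$, skew-symmetrisation over $E$ therefore brings nothing new. -/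
theorem torsionTensor_swap (x : M) (ε : E x) (e e' : Module.Dual ℂ (E x))
    (a b c : Module.Dual ℂ (H x)) :
    G.torsionTensor x ε e' e ![a, b, c] = - G.torsionTensor x ε e e' ![b, a, c] := by
  simp [torsionTensor, G.torsion_antisymm x (G.tangentEquiv x (e' ⊗ₜ[ℂ] a)), contract]

/-- A symmetric trilinear form is determined by its restriction to the diagonal; this replaces the
projection to $S^3H$ by a condition on a single $h$. -/
theorem isAdmissible_iff :
    G.IsAdmissible ↔ ∀ (x : M) (e e' : Module.Dual ℂ (E x)) (h : Module.Dual ℂ (H x)) (ε : E x),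
      G.torsionTensor x ε e e' (fun _ ↦ h) = 0 := by
  have hconst {x : M} (h : Module.Dual ℂ (H x)) : (fun _ : Fin 3 ↦ h) = ![h, h, h] := by
    funext i
    fin_cases i <;> rfl
  -- By `torsionTensor_swap` the two halves of the skew-symmetrised sum agree, which turns $1/12$
  -- into $1/6$.
  have key (x : M) (ε : E x) (e e' : Module.Dual ℂ (E x)) (h : Fin 3 → Module.Dual ℂ (H x)) :
      G.torsionComponent x ε e e' h = (1 / 6 : ℂ) * (G.torsionTensor x ε e e' ![h 0, h 1, h 2] +
        G.torsionTensor x ε e e' ![h 0, h 2, h 1] + G.torsionTensor x ε e e' ![h 1, h 0, h 2] +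
        G.torsionTensor x ε e e' ![h 1, h 2, h 0] + G.torsionTensor x ε e e' ![h 2, h 0, h 1] +
        G.torsionTensor x ε e e' ![h 2, h 1, h 0]) := by
    rw [torsionComponent, sum_perm_fin_three h
      (fun h ↦ G.torsionTensor x ε e e' h - G.torsionTensor x ε e' e h)]
    simp only [G.torsionTensor_swap x ε e e']
    ring
  constructor
  · intro hG x e e' h ε
    have h1 := (key x ε e e' (fun _ ↦ h)).symm.trans (hG x ε e e' _)
    rw [hconst]
    linear_combination h1
  · intro H' x ε e e' h
    have h0 (h : Module.Dual ℂ (H x)) : G.torsionTensor x ε e e' ![h, h, h] = 0 := by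
      rw [← hconst]
      exact H' x e e' h ε
    have hadd : ∀ a a' b b' c c' : Module.Dual ℂ (H x),
        G.torsionTensor x ε e e' ![a + a', b, c] = G.torsionTensor x ε e e' ![a, b, c] +
          G.torsionTensor x ε e e' ![a', b, c] ∧
        G.torsionTensor x ε e e' ![a, b + b', c] = G.torsionTensor x ε e e' ![a, b, c] +
          G.torsionTensor x ε e e' ![a, b', c] ∧
        G.torsionTensor x ε e e' ![a, b, c + c'] = G.torsionTensor x ε e e' ![a, b, c] +
          G.torsionTensor x ε e e' ![a, b, c'] := by
      intro a a' b b' c c'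
      refine ⟨?_, ?_, ?_⟩ <;>
      simp [torsionTensor, TensorProduct.tmul_add, torsion_add_left, torsion_add_right, contract,
        LinearMap.add_comp]
    have ha a a' b c := (hadd a a' b b c c).1
    have hb a b b' c := (hadd a a b b' c c).2.1
    have hc a b c c' := (hadd a a b b c c').2.2
    have h1 := h0 (h 0)
    have h2 := h0 (h 1)
    have h3 := h0 (h 2)
    have h12 := h0 (h 0 + h 1)
    have h13 := h0 (h 0 + h 2)
    have h23 := h0 (h 1 + h 2)
    have h123 := h0 (h 0 + h 1 + h 2)
    simp only [ha, hb, hc] at h12 h13 h23 h123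
    rw [key]
    -- The cubic polarisation identity: for $t$ trilinear and $q(a)=t(a,a,a)$, the sum of $t$ over
    -- the six orders of $a,b,c$ is $q(a+b+c)-q(a+b)-q(a+c)-q(b+c)+q(a)+q(b)+q(c)$.
    linear_combination (1 / 6 : ℂ) * (h123 - h12 - h13 - h23 + h1 + h2 + h3)

end Torsion

end HalfFlatGrassmannManifold

/-! ### Parallel sections of the dual bundle -/

section DualSections

variable {V : Type*} [NormedAddCommGroup V] [NormedSpace ℂ V]
  {M : Type*} [TopologicalSpace M] [ChartedSpace V M]
  {F : Type*} [NormedAddCommGroup F] [NormedSpace ℂ F]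
  {W : M → Type*} [TopologicalSpace (TotalSpace F W)]
  [∀ x, AddCommGroup (W x)] [∀ x, Module ℂ (W x)] [∀ x, TopologicalSpace (W x)]
  [∀ x, IsTopologicalAddGroup (W x)] [∀ x, ContinuousSMul ℂ (W x)]
  [FiberBundle F W] [VectorBundle ℂ F W]

/-- In a chart the function has zero derivative on a ball, which is connected. It serves to
propagate pairings of parallel sections, and the value of $\omega_H$ on them, from a point to a
neighbourhood. -/
theorem eventually_eq_of_mvfderiv_eq_zero [IsManifold 𝓘(ℂ, V) ω M] {u : M → F} {x : M}
    (hu : ∀ᶠ y in 𝓝 x, MDifferentiableAt 𝓘(ℂ, V) 𝓘(ℂ, F) u y ∧ mvfderiv 𝓘(ℂ, V) u y = 0) :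
    ∀ᶠ y in 𝓝 x, u y = u x := by
  set φ := extChartAt 𝓘(ℂ, V) x
  have hφx : φ.symm (φ x) = x := extChartAt_to_inv x
  have htend : Filter.Tendsto φ.symm (𝓝 (φ x)) (𝓝 x) := by
    have := continuousAt_extChartAt_symm (I := 𝓘(ℂ, V)) x
    rw [ContinuousAt, extChartAt_to_inv x] at this
    exact this
  have h1 : ∀ᶠ p in 𝓝 (φ x), p ∈ φ.target ∧
      (MDifferentiableAt 𝓘(ℂ, V) 𝓘(ℂ, F) u (φ.symm p) ∧ mvfderiv 𝓘(ℂ, V) u (φ.symm p) = 0) :=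
    Filter.Eventually.and ((isOpen_extChartAt_target x).mem_nhds (mem_extChartAt_target x))
      (htend.eventually hu)
  obtain ⟨r, hr, hball⟩ := Metric.eventually_nhds_iff_ball.1 h1
  have h2 : ∀ p ∈ Metric.ball (φ x) r, HasFDerivAt (u ∘ φ.symm) (0 : V →L[ℂ] F) p := by
    intro p hp
    obtain ⟨hp1, hp2, hp3⟩ := hball p hp
    have h3 := hp2.hasMFDerivAt.comp p
      ((contMDiffAt_extChartAt_symm_of_mem hp1).mdifferentiableAt (by simp)).hasMFDerivAt
    refine HasFDerivAt.congr_fderiv h3.hasFDerivAt ?_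
    refine (congrArg (fun L : V →L[ℂ] F ↦ L.comp (mfderiv 𝓘(ℂ, V) 𝓘(ℂ, V) φ.symm p : V →L[ℂ] V))
      hp3).trans ?_
    exact ContinuousLinearMap.zero_comp _
  have h5 : ∀ p ∈ Metric.ball (φ x) r, (u ∘ φ.symm) p = (u ∘ φ.symm) (φ x) := fun p hp ↦
    Metric.isOpen_ball.is_const_of_fderiv_eq_zero (𝕜 := ℂ) (convex_ball _ _).isPreconnected
      (fun q hq ↦ (h2 q hq).differentiableAt.differentiableWithinAt)
      (fun q hq ↦ (h2 q hq).fderiv) hp (Metric.mem_ball_self hr)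
  have h6 : ∀ᶠ y in 𝓝 x, y ∈ φ.source ∧ φ y ∈ Metric.ball (φ x) r :=
    Filter.Eventually.and ((isOpen_extChartAt_source x).mem_nhds (mem_extChartAt_source x))
      ((continuousAt_extChartAt x).eventually (Metric.ball_mem_nhds _ hr))
  filter_upwards [h6] with y hy
  have := h5 _ hy.2
  simp only [Function.comp_apply, hφx] at this
  rwa [φ.left_inv hy.1] at this

theorem HolomorphicSectionAt.dual_apply {η : ∀ y, W y →L[ℂ] Bundle.Trivial M ℂ y}
    {σ : ∀ y, W y} {x : M} (hη : HolomorphicSectionAt V (F →L[ℂ] ℂ) η x)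
    (hσ : HolomorphicSectionAt V F σ x) :
    ContMDiffAt 𝓘(ℂ, V) 𝓘(ℂ, ℂ) ω (fun y ↦ η y (σ y)) x := by
  have h := ContMDiffAt.clm_bundle_apply (b := fun y ↦ y) hη hσ
  exact (contMDiffAt_section _).1 h

/-- A function with values in continuous linear maps on a finite dimensional space is holomorphic
if it is so pointwise. -/
theorem contMDiffAt_clm_of_apply [FiniteDimensional ℂ F] {B : Type*} [NormedAddCommGroup B]
    [NormedSpace ℂ B] {K : Type*} [TopologicalSpace K] {I : ModelWithCorners ℂ B K}
    {N : Type*} [TopologicalSpace N] [ChartedSpace K N]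
    {F' : Type*} [NormedAddCommGroup F'] [NormedSpace ℂ F'] {A : N → F →L[ℂ] F'} {x : N}
    (h : ∀ c, ContMDiffAt I 𝓘(ℂ, F') ω (fun y ↦ A y c) x) :
    ContMDiffAt I 𝓘(ℂ, F →L[ℂ] F') ω A x := by
  have h1 : A = fun y ↦ ∑ i, ContinuousLinearMap.smulRightL ℂ F F'
      (LinearMap.toContinuousLinearMap ((Module.finBasis ℂ F).coord i))
      (A y (Module.finBasis ℂ F i)) := by
    funext y
    ext c
    conv_lhs => rw [← (Module.finBasis ℂ F).sum_repr c]
    simp only [map_sum, map_smul]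
    simp
  rw [h1]
  exact contMDiffAt_finsetSum fun i _ ↦ contMDiffAt_const.clm_apply (h _)

/-- The coordinates of $\eta$ in the trivialization at $x$ are its pairings with the constant
sections, so it is enough to test on holomorphic sections. -/
theorem holomorphicSectionAt_dual_of_apply [FiniteDimensional ℂ F] [IsManifold 𝓘(ℂ, V) ω M]
    [ContMDiffVectorBundle ω F W 𝓘(ℂ, V)]
    {η : ∀ y, W y →L[ℂ] Bundle.Trivial M ℂ y} {x : M}
    (h : ∀ σ : ∀ y, W y, HolomorphicSectionAt V F σ x →
      ContMDiffAt 𝓘(ℂ, V) 𝓘(ℂ, ℂ) ω (fun y ↦ η y (σ y)) x) :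
    HolomorphicSectionAt V (F →L[ℂ] ℂ) η x := by
  refine (contMDiffAt_hom_bundle _).2 ⟨contMDiffAt_id, contMDiffAt_clm_of_apply fun c ↦ ?_⟩
  have h1 := h _ (holomorphicSectionAt_symmL (V := V) (trivializationAt F W x) c
    (mem_baseSet_trivializationAt F W x))
  refine h1.congr_of_eventuallyEq (.of_forall fun y ↦ ?_)
  simp [ContinuousLinearMap.inCoordinates]

namespace IsParallelTrivialization

variable [IsManifold 𝓘(ℂ, V) ω M] [FiniteDimensional ℂ F] [ContMDiffVectorBundle ω F W 𝓘(ℂ, V)]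
  {cov : CovariantDerivative 𝓘(ℂ, V) F W} {U : Set M} {T : ∀ y, W y →L[ℂ] F}
  {S : ∀ y, F →L[ℂ] W y}

theorem holomorphicSectionAt_dual (hT : IsParallelTrivialization cov U T S) (a : F →L[ℂ] ℂ)
    {y : M} (hy : y ∈ U) :
    HolomorphicSectionAt V (F →L[ℂ] ℂ) (W := fun y ↦ W y →L[ℂ] Bundle.Trivial M ℂ y)
      (fun z ↦ a ∘L T z) y :=
  holomorphicSectionAt_dual_of_apply fun σ hσ ↦
    a.contMDiff.contMDiffAt.comp y (hT.contMDiffAt_apply y hy σ hσ)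

theorem isDualDeriv_dual (hT : IsParallelTrivialization cov U T S) (a : F →L[ℂ] ℂ)
    {y : M} (hy : y ∈ U) (X : TangentSpace 𝓘(ℂ, V) y) :
    IsDualDeriv cov (fun z ↦ (a ∘L T z).toLinearMap) y X 0 := by
  intro σ hσ
  have h1 := a.hasFDerivAt.mvfderiv_comp (u := fun z ↦ T z (σ z)) (x := y)
    ((hT.contMDiffAt_apply y hy σ hσ).mdifferentiableAt (by simp)) X
  refine h1.trans ?_
  rw [hT.mvfderiv_apply y hy σ hσ X, LinearMap.zero_apply, zero_add]
  rfl

theorem cov_eq_zero (hT : IsParallelTrivialization cov U T S) (c : F) {y : M} (hy : y ∈ U)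
    (X : TangentSpace 𝓘(ℂ, V) y) : cov (fun z ↦ S z c) y X = 0 := by
  rw [← hT.left_inv y hy (cov (fun z ↦ S z c) y X),
    ← hT.mvfderiv_apply y hy _ (hT.holomorphicSectionAt y hy c) X]
  have h1 : (fun z ↦ T z (S z c)) =ᶠ[𝓝 y] fun _ ↦ c := by
    filter_upwards [hT.isOpen.mem_nhds hy] with z hz using hT.right_inv z hz c
  have h2 : (mvfderiv 𝓘(ℂ, V) (fun z ↦ T z (S z c)) y : V →L[ℂ] F) = 0 :=
    (h1.mfderiv_eq).trans mfderiv_const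
  have h3 : mvfderiv 𝓘(ℂ, V) (fun z ↦ T z (S z c)) y X = 0 :=
    congrArg (fun L : V →L[ℂ] F ↦ L X) h2
  rw [h3, map_zero]

end IsParallelTrivialization

end DualSections

namespace HalfFlatGrassmannManifold

/-! ### The bracket on $E^*\otimes h$ is minus the torsion, modulo $E^*\otimes h$ -/

section Leaves

variable {V : Type*} [NormedAddCommGroup V] [NormedSpace ℂ V] [FiniteDimensional ℂ V]
  {M : Type*} [TopologicalSpace M] [ChartedSpace V M] [IsManifold 𝓘(ℂ, V) ω M]
  {FE : Type*} [NormedAddCommGroup FE] [NormedSpace ℂ FE] [FiniteDimensional ℂ FE]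
  {E : M → Type*} [TopologicalSpace (TotalSpace FE E)]
  [∀ x, AddCommGroup (E x)] [∀ x, Module ℂ (E x)] [∀ x, TopologicalSpace (E x)]
  [∀ x, IsTopologicalAddGroup (E x)] [∀ x, ContinuousSMul ℂ (E x)]
  [FiberBundle FE E] [VectorBundle ℂ FE E] [ContMDiffVectorBundle ω FE E 𝓘(ℂ, V)]
  {FH : Type*} [NormedAddCommGroup FH] [NormedSpace ℂ FH] [FiniteDimensional ℂ FH]
  {H : M → Type*} [TopologicalSpace (TotalSpace FH H)]
  [∀ x, AddCommGroup (H x)] [∀ x, Module ℂ (H x)] [∀ x, TopologicalSpace (H x)]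
  [∀ x, IsTopologicalAddGroup (H x)] [∀ x, ContinuousSMul ℂ (H x)]
  [FiberBundle FH H] [VectorBundle ℂ FH H] [ContMDiffVectorBundle ω FH H 𝓘(ℂ, V)]

variable (G : HalfFlatGrassmannManifold V M FE E FH H)

theorem exists_holomorphicSectionAt_eq (x : M) (ε₀ : E x) :
    ∃ ε : ∀ y, E y, HolomorphicSectionAt V FE ε x ∧ ε x = ε₀ := by
  have hx := mem_baseSet_trivializationAt FE E x
  exact ⟨_, holomorphicSectionAt_symmL (V := V) (trivializationAt FE E x)
    ((trivializationAt FE E x).continuousLinearMapAt ℂ x ε₀) hx,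
    (trivializationAt FE E x).symmL_continuousLinearMapAt hx ε₀⟩

/-- A parallel section of `H*` is constant along parallel sections of `H`. -/
theorem eventually_apply_parallel_eq {U : Set M} {T : ∀ y, H y →L[ℂ] FH} {S : ∀ y, FH →L[ℂ] H y}
    (hT : IsParallelTrivialization G.nablaH U T S) {x : M} (hx : x ∈ U)
    {h : ∀ y, H y →L[ℂ] Bundle.Trivial M ℂ y}
    (hh : ∀ᶠ y in 𝓝 x, HolomorphicSectionAt V (FH →L[ℂ] ℂ) h y ∧ G.IsParallelAt h y) (c : FH) :
    ∀ᶠ y in 𝓝 x, h y (S y c) = (h x (S x c) : ℂ) := by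
  refine eventually_eq_of_mvfderiv_eq_zero (V := V) (F := ℂ) (u := fun y ↦ h y (S y c)) ?_
  filter_upwards [hh, hT.isOpen.mem_nhds hx] with y hy hyU
  have h1 := hT.holomorphicSectionAt y hyU c
  refine ⟨(hy.1.dual_apply h1).mdifferentiableAt (by simp), ContinuousLinearMap.ext fun X ↦ ?_⟩
  refine (hy.2 X _ h1).trans ?_
  rw [hT.cov_eq_zero c hyU X]
  simp

/-- If a vector field is annihilated by the one-forms `ε ⊗ κ` with `κ` parallel, then so are its
covariant derivatives. -/
theorem iso_nabla_eq_zero {x : M} {κ : ∀ y, H y} (hκ : HolomorphicSectionAt V FH κ x)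
    (hκ' : ∀ w, G.nablaH κ x w = 0) {Z : ∀ y : M, TangentSpace 𝓘(ℂ, V) y}
    (hZ : HolomorphicSectionAt V V Z x)
    (h : ∀ᶠ y in 𝓝 x, ∀ ε, G.iso y (ε ⊗ₜ[ℂ] κ y) (Z y) = 0) (w : TangentSpace 𝓘(ℂ, V) x)
    (ε₀ : E x) : G.iso x (ε₀ ⊗ₜ[ℂ] κ x) (G.nabla Z x w) = 0 := by
  obtain ⟨ε, hε, rfl⟩ := exists_holomorphicSectionAt_eq (V := V) (FE := FE) x ε₀
  have h1 := G.nabla_eq x ε κ w hε hκ Z hZ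
  have h2 : (fun y ↦ G.iso y (ε y ⊗ₜ[ℂ] κ y) (Z y)) =ᶠ[𝓝 x] fun _ ↦ (0 : ℂ) := by
    filter_upwards [h] with y hy using hy (ε y)
  have h3 : (mvfderiv 𝓘(ℂ, V) (fun y ↦ G.iso y (ε y ⊗ₜ[ℂ] κ y) (Z y)) x : V →L[ℂ] ℂ) = 0 :=
    (h2.mfderiv_eq).trans mfderiv_const
  have h4 : mvfderiv 𝓘(ℂ, V) (fun y ↦ G.iso y (ε y ⊗ₜ[ℂ] κ y) (Z y)) x w = 0 :=
    congrArg (fun L : V →L[ℂ] ℂ ↦ L w) h3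
  -- In the Leibniz rule for $(\varepsilon\otimes\kappa)(Z)=0$ the term
  -- $\varepsilon\otimes\nabla^H\kappa$ is zero and $\nabla^E\varepsilon\otimes\kappa$ is again a
  -- form annihilating $Z$; only $(\varepsilon\otimes\kappa)(\nabla Z)$ is left.
  rw [h4, hκ' w, TensorProduct.tmul_zero, add_zero, h.self_of_nhds, zero_add] at h1
  exact h1.symm

/-- For vector fields tangent to `E* ⊗ h` with `h` parallel, the bracket is tangent to `E* ⊗ h` if
and only if the torsion is. -/
theorem mlieBracket_mem_leafSpace_iff (hH : Module.finrank ℂ FH = 2) {x : M}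
    {h : ∀ y, H y →L[ℂ] Bundle.Trivial M ℂ y}
    (hh : ∀ᶠ y in 𝓝 x, HolomorphicSectionAt V (FH →L[ℂ] ℂ) h y ∧ G.IsParallelAt h y)
    {X Y : ∀ y : M, TangentSpace 𝓘(ℂ, V) y} (hX : HolomorphicSectionAt V V X x)
    (hY : HolomorphicSectionAt V V Y x)
    (hXh : ∀ᶠ y in 𝓝 x, X y ∈ G.leafSpace y (h y).toLinearMap)
    (hYh : ∀ᶠ y in 𝓝 x, Y y ∈ G.leafSpace y (h y).toLinearMap) :
    VectorField.mlieBracket 𝓘(ℂ, V) X Y x ∈ G.leafSpace x (h x).toLinearMap ↔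
      G.torsion x (X x) (Y x) ∈ G.leafSpace x (h x).toLinearMap := by
  have : CompleteSpace V := FiniteDimensional.complete ℂ V
  have : Module.Finite ℂ (H x) := finite_fiber (F := FH) x
  have htor : G.torsion x (X x) (Y x) = G.nabla Y x (X x) - G.nabla X x (Y x) -
      VectorField.mlieBracket 𝓘(ℂ, V) X Y x :=
    G.nabla.torsion_apply hX.mdifferentiableAt hY.mdifferentiableAt
  -- When $h(x)=0$ the space $E^*\otimes h$ is zero at $x$, so both fields vanish there; the torsion
  -- formula then makes the bracket vanish too.
  rcases eq_or_ne (h x).toLinearMap 0 with h0 | h0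
  · have hX0 := hXh.self_of_nhds
    have hY0 := hYh.self_of_nhds
    rw [h0, leafSpace_zero, Submodule.mem_bot] at hX0 hY0 ⊢
    have h1 : G.torsion x (X x) (Y x) = 0 := by
      rw [hX0]
      simp [torsion]
    rw [Submodule.mem_bot, h1]
    rw [h1, hX0, hY0] at htor
    simpa using htor.symm
  obtain ⟨U, T, S, hxU, hT⟩ := exists_isParallelTrivialization G.nablaH_holomorphic G.flat x
  obtain ⟨κ₀, hκ₀, hhκ₀⟩ := exists_ne_zero_apply_eq_zero ((finrank_fiber x).trans hH) h0
  -- The parallel extension of a vector spanning $\ker h(x)$. Since $h$ is parallel as well,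
  -- $h(\kappa)$ is locally constant and remains $0$.
  set κ : ∀ y, H y := fun y ↦ S y (T x κ₀)
  have hκ := hT.holomorphicSectionAt x hxU (T x κ₀)
  have hhκ : ∀ᶠ y in 𝓝 x, h y (κ y) = (0 : ℂ) := by
    filter_upwards [G.eventually_apply_parallel_eq hT hxU hh (T x κ₀)] with y hy
    refine hy.trans ?_
    rw [hT.left_inv x hxU κ₀]
    exact hhκ₀
  have hann {Z : ∀ y : M, TangentSpace 𝓘(ℂ, V) y}
      (hZ : ∀ᶠ y in 𝓝 x, Z y ∈ G.leafSpace y (h y).toLinearMap) :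
      ∀ᶠ y in 𝓝 x, ∀ ε, G.iso y (ε ⊗ₜ[ℂ] κ y) (Z y) = 0 := by
    filter_upwards [hZ, hhκ] with y ⟨e, he⟩ hy ε
    rw [← he]
    refine (G.iso_tangentEquiv y e _ ε _).trans ?_
    exact mul_eq_zero_of_right _ hy
  rw [G.mem_leafSpace_iff hH h0 hκ₀ hhκ₀, G.mem_leafSpace_iff hH h0 hκ₀ hhκ₀]
  refine forall_congr' fun ε ↦ ?_
  -- Both covariant derivatives in $T(X,Y)=\nabla_XY-\nabla_YX-[X,Y]$ are annihilated by
  -- $\varepsilon\otimes\kappa$, which therefore takes opposite values on the torsion and on the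
  -- bracket.
  have h1 := G.iso_nabla_eq_zero hκ (hT.cov_eq_zero _ hxU) hY (hann hYh) (X x) ε
  have h2 := G.iso_nabla_eq_zero hκ (hT.cov_eq_zero _ hxU) hX (hann hXh) (Y x) ε
  rw [hT.left_inv x hxU κ₀] at h1 h2
  rw [htor, map_sub, map_sub, h1, h2, sub_zero, zero_sub, neg_eq_zero]

end Leaves

end HalfFlatGrassmannManifold

/-! ### Holomorphy tested on frames and coframes -/

section Frames

variable {V : Type*} [NormedAddCommGroup V] [NormedSpace ℂ V]
  {M : Type*} [TopologicalSpace M] [ChartedSpace V M]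
  {F : Type*} [NormedAddCommGroup F] [NormedSpace ℂ F]
  {W : M → Type*} [TopologicalSpace (TotalSpace F W)]
  [∀ x, AddCommGroup (W x)] [∀ x, Module ℂ (W x)] [∀ x, TopologicalSpace (W x)]
  [∀ x, IsTopologicalAddGroup (W x)] [∀ x, ContinuousSMul ℂ (W x)]
  [FiberBundle F W] [VectorBundle ℂ F W]

/-- A combination of sections along a map, with variable coefficients, is holomorphic. -/
theorem contMDiffAt_sum_smul_section_comp [ContMDiffVectorBundle ω F W 𝓘(ℂ, V)]
    {B : Type*} [NormedAddCommGroup B] [NormedSpace ℂ B]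
    {K : Type*} [TopologicalSpace K] {I : ModelWithCorners ℂ B K}
    {N : Type*} [TopologicalSpace N] [ChartedSpace K N] {g : N → M} {s : N}
    (hg : ContMDiffAt I 𝓘(ℂ, V) ω g s) {ι : Type*} (t : Finset ι) {f : ι → N → ℂ}
    {σ : ι → ∀ y, W y} (hf : ∀ i ∈ t, ContMDiffAt I 𝓘(ℂ, ℂ) ω (f i) s)
    (hσ : ∀ i ∈ t, HolomorphicSectionAt V F (σ i) (g s)) :
    ContMDiffAt I (𝓘(ℂ, V).prod 𝓘(ℂ, F)) ω
      (fun q ↦ (⟨g q, ∑ i ∈ t, f i q • σ i (g q)⟩ : TotalSpace F W)) s := by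
  refine contMDiffAt_totalSpace.2 ⟨hg, ?_⟩
  set e := trivializationAt F W (g s)
  have hx : g s ∈ e.baseSet := mem_baseSet_trivializationAt F W (g s)
  have h1 : ContMDiffAt I 𝓘(ℂ, F) ω (fun q ↦ ∑ i ∈ t, f i q • (e ⟨g q, σ i (g q)⟩).2) s :=
    contMDiffAt_finsetSum fun i hi ↦ (hf i hi).smul
      (((e.contMDiffAt_section_iff hx).1 (hσ i hi)).comp s hg)
  refine h1.congr_of_eventuallyEq ?_
  filter_upwards [hg.continuousAt.eventually (e.open_baseSet.mem_nhds hx)] with q hq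
  have h2 (w : W (g q)) : (e ⟨g q, w⟩).2 = e.linearMapAt ℂ (g q) w :=
    (congrFun (e.coe_linearMapAt_of_mem hq) w).symm
  simp only [h2, map_sum, map_smul]

/-- A section is holomorphic if its pairings with a separating family of holomorphic one-forms
are holomorphic. -/
theorem holomorphicSectionAt_of_separating [FiniteDimensional ℂ F] [IsManifold 𝓘(ℂ, V) ω M]
    [ContMDiffVectorBundle ω F W 𝓘(ℂ, V)] {ι : Type*} [Fintype ι]
    {θ : ι → ∀ y, Module.Dual ℂ (W y)} {x : M} {Z : ∀ y, W y}
    (hθ : ∀ i, ∀ σ : ∀ y, W y, HolomorphicSectionAt V F σ x →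
      ContMDiffAt 𝓘(ℂ, V) 𝓘(ℂ, ℂ) ω (fun y ↦ θ i y (σ y)) x)
    (hsep : ∀ v, (∀ i, θ i x v = 0) → v = 0)
    (hZ : ∀ i, ContMDiffAt 𝓘(ℂ, V) 𝓘(ℂ, ℂ) ω (fun y ↦ θ i y (Z y)) x) :
    HolomorphicSectionAt V F Z x := by
  have : CompleteSpace F := FiniteDimensional.complete ℂ F
  set e := trivializationAt F W x
  have hx : x ∈ e.baseSet := mem_baseSet_trivializationAt F W x
  let A (y : M) : F →L[ℂ] (ι → ℂ) := LinearMap.toContinuousLinearMap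
    (LinearMap.pi fun i ↦ θ i y ∘ₗ (e.symmL ℂ y).toLinearMap)
  have hA : ContMDiffAt 𝓘(ℂ, V) 𝓘(ℂ, F →L[ℂ] (ι → ℂ)) ω A x :=
    contMDiffAt_clm_of_apply fun c ↦ contMDiffAt_pi_space.2 fun i ↦
      hθ i _ (holomorphicSectionAt_symmL e c hx)
  have hker : LinearMap.ker (A x).toLinearMap = ⊥ := by
    rw [eq_bot_iff]
    intro c hc
    have h1 : e.symmL ℂ x c = 0 := hsep _ fun i ↦ congrFun hc i
    have h2 := e.continuousLinearMapAt_symmL (R := ℂ) hx c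
    rw [h1, map_zero] at h2
    exact h2.symm
  -- The separating family may have more members than the rank of the bundle, so `A x` is only
  -- injective. Composed with a left inverse of `A x`, the map `A y` becomes invertible near `x`,
  -- and the coordinates of `Z` are recovered holomorphically from its pairings.
  obtain ⟨L₀, hL₀⟩ := (A x).toLinearMap.exists_leftInverse_of_injective hker
  let L : (ι → ℂ) →L[ℂ] F := LinearMap.toContinuousLinearMap L₀
  let B (y : M) : F →L[ℂ] F := L ∘L A y
  have hB : ContMDiffAt 𝓘(ℂ, V) 𝓘(ℂ, F →L[ℂ] F) ω B x := contMDiffAt_const.clm_comp hA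
  have hBx : B x = 1 := ContinuousLinearMap.ext fun c ↦ congrArg (fun l ↦ l c) hL₀
  have hinv : ContMDiffAt 𝓘(ℂ, V) 𝓘(ℂ, F →L[ℂ] F) ω (fun y ↦ Ring.inverse (B y)) x := by
    refine ContMDiffAt.comp x (g := Ring.inverse) (ContDiffAt.contMDiffAt ?_) hB
    rw [hBx]
    exact contDiffAt_ringInverse ℂ (1 : (F →L[ℂ] F)ˣ)
  have hunit : ∀ᶠ y in 𝓝 x, IsUnit (B y) := by
    refine hB.continuousAt.eventually (Units.isOpen.mem_nhds ?_)
    rw [hBx]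
    exact isUnit_one
  have hg : ContMDiffAt 𝓘(ℂ, V) 𝓘(ℂ, ι → ℂ) ω (fun y i ↦ θ i y (Z y)) x :=
    contMDiffAt_pi_space.2 hZ
  rw [HolomorphicSectionAt, e.contMDiffAt_section_iff hx]
  refine (hinv.clm_apply ((contMDiffAt_const (c := L)).clm_apply hg)).congr_of_eventuallyEq ?_
  filter_upwards [hunit, e.open_baseSet.mem_nhds hx] with y hy hyb
  have h1 : A y (e ⟨y, Z y⟩).2 = fun i ↦ θ i y (Z y) := by
    funext i
    have h2 := e.symmL_continuousLinearMapAt (R := ℂ) hyb (Z y)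
    rw [e.continuousLinearMapAt_apply ℂ, e.coe_linearMapAt_of_mem hyb] at h2
    exact congrArg (θ i y) h2
  rw [← h1]
  have h3 := congrArg (fun C : F →L[ℂ] F ↦ C (e ⟨y, Z y⟩).2) (Ring.inverse_mul_cancel (B y) hy)
  exact h3.symm

end Frames

namespace HalfFlatGrassmannManifold

/-! ### Holomorphic vector fields of the form $e\otimes h$ -/

section TangentFields

variable {V : Type*} [NormedAddCommGroup V] [NormedSpace ℂ V] [FiniteDimensional ℂ V]
  {M : Type*} [TopologicalSpace M] [ChartedSpace V M] [IsManifold 𝓘(ℂ, V) ω M]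
  {FE : Type*} [NormedAddCommGroup FE] [NormedSpace ℂ FE] [FiniteDimensional ℂ FE]
  {E : M → Type*} [TopologicalSpace (TotalSpace FE E)]
  [∀ x, AddCommGroup (E x)] [∀ x, Module ℂ (E x)] [∀ x, TopologicalSpace (E x)]
  [∀ x, IsTopologicalAddGroup (E x)] [∀ x, ContinuousSMul ℂ (E x)]
  [FiberBundle FE E] [VectorBundle ℂ FE E] [ContMDiffVectorBundle ω FE E 𝓘(ℂ, V)]
  {FH : Type*} [NormedAddCommGroup FH] [NormedSpace ℂ FH] [FiniteDimensional ℂ FH]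
  {H : M → Type*} [TopologicalSpace (TotalSpace FH H)]
  [∀ x, AddCommGroup (H x)] [∀ x, Module ℂ (H x)] [∀ x, TopologicalSpace (H x)]
  [∀ x, IsTopologicalAddGroup (H x)] [∀ x, ContinuousSMul ℂ (H x)]
  [FiberBundle FH H] [VectorBundle ℂ FH H] [ContMDiffVectorBundle ω FH H 𝓘(ℂ, V)]

variable (G : HalfFlatGrassmannManifold V M FE E FH H)

/-- The vector field `e ⊗ h` is holomorphic if `e` and `h` are. -/
theorem holomorphicSectionAt_tangentEquiv {x : M} {e : ∀ y, Module.Dual ℂ (E y)}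
    {h : ∀ y, Module.Dual ℂ (H y)}
    (he : ∀ ε : ∀ y, E y, HolomorphicSectionAt V FE ε x →
      ContMDiffAt 𝓘(ℂ, V) 𝓘(ℂ, ℂ) ω (fun y ↦ e y (ε y)) x)
    (hh : ∀ κ : ∀ y, H y, HolomorphicSectionAt V FH κ x →
      ContMDiffAt 𝓘(ℂ, V) 𝓘(ℂ, ℂ) ω (fun y ↦ h y (κ y)) x) :
    HolomorphicSectionAt V V (fun y ↦ G.tangentEquiv y (e y ⊗ₜ[ℂ] h y)) x := by
  set eE := trivializationAt FE E x
  set eH := trivializationAt FH H x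
  have hE : x ∈ eE.baseSet := mem_baseSet_trivializationAt FE E x
  have hxH : x ∈ eH.baseSet := mem_baseSet_trivializationAt FH H x
  have hε c := holomorphicSectionAt_symmL (V := V) eE c hE
  have hκ c := holomorphicSectionAt_symmL (V := V) eH c hxH
  let bE := Module.finBasis ℂ FE
  let bH := Module.finBasis ℂ FH
  -- The test forms are the products $\varepsilon_i\otimes\kappa_j$ of constant frames of $E$ and
  -- $H$; they separate tangent vectors at $x$, and their pairings with $e\otimes h$ are
  -- $e(\varepsilon_i)h(\kappa_j)$.
  refine holomorphicSectionAt_of_separating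
    (ι := Fin (Module.finrank ℂ FE) × Fin (Module.finrank ℂ FH))
    (θ := fun i y ↦ G.iso y (eE.symmL ℂ y (bE i.1) ⊗ₜ[ℂ] eH.symmL ℂ y (bH i.2)))
    (fun i σ hσ ↦ G.iso_holomorphic x _ _ σ (hε _) (hκ _) hσ) (fun v hv ↦ ?_) (fun i ↦ ?_)
  · refine G.eq_zero_of_iso_apply fun ε κ ↦ ?_
    rw [← eE.symmL_continuousLinearMapAt (R := ℂ) hE ε,
      ← eH.symmL_continuousLinearMapAt (R := ℂ) hxH κ]
    rw [← bE.sum_repr (eE.continuousLinearMapAt ℂ x ε),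
      ← bH.sum_repr (eH.continuousLinearMapAt ℂ x κ)]
    have hv' i j := hv (i, j)
    simp only [map_sum, TensorProduct.sum_tmul, TensorProduct.tmul_sum,
      ← TensorProduct.smul_tmul', TensorProduct.tmul_smul, map_smul, LinearMap.sum_apply,
      LinearMap.smul_apply]
    simp [hv']
  · simp only [G.iso_tangentEquiv]
    exact (he _ (hε _)).mul (hh _ (hκ _))

/-- Every element of `E*_x` is the value of a local holomorphic section of `E*`. -/
theorem exists_holomorphic_dual_eq {x : M} (e₀ : Module.Dual ℂ (E x)) :
    ∃ e : ∀ y, Module.Dual ℂ (E y), e x = e₀ ∧ ∀ ε : ∀ y, E y, HolomorphicSectionAt V FE ε x →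
      ContMDiffAt 𝓘(ℂ, V) 𝓘(ℂ, ℂ) ω (fun y ↦ e y (ε y)) x := by
  set eE := trivializationAt FE E x
  have hE : x ∈ eE.baseSet := mem_baseSet_trivializationAt FE E x
  let l : FE →L[ℂ] ℂ := LinearMap.toContinuousLinearMap (e₀ ∘ₗ (eE.symmL ℂ x).toLinearMap)
  refine ⟨fun y ↦ (l ∘L eE.continuousLinearMapAt ℂ y).toLinearMap, LinearMap.ext fun ε ↦ ?_,
    fun ε hε ↦ ?_⟩
  · exact congrArg e₀ (eE.symmL_continuousLinearMapAt (R := ℂ) hE ε)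
  · have h1 := l.contMDiff.contMDiffAt.comp x ((eE.contMDiffAt_section_iff hE).1 hε)
    refine h1.congr_of_eventuallyEq ?_
    filter_upwards [eE.open_baseSet.mem_nhds hE] with y hy
    refine congrArg l ?_
    exact congrFun (eE.coe_linearMapAt_of_mem (R := ℂ) hy) (ε y)

end TangentFields

end HalfFlatGrassmannManifold

/-! ### Holomorphic maps into dual bundles and their sums -/

section BundlePairs

variable {V : Type*} [NormedAddCommGroup V] [NormedSpace ℂ V]
  {M : Type*} [TopologicalSpace M] [ChartedSpace V M]
  {F : Type*} [NormedAddCommGroup F] [NormedSpace ℂ F]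
  {W : M → Type*} [TopologicalSpace (TotalSpace F W)]
  [∀ x, AddCommGroup (W x)] [∀ x, Module ℂ (W x)] [∀ x, TopologicalSpace (W x)]
  [∀ x, IsTopologicalAddGroup (W x)] [∀ x, ContinuousSMul ℂ (W x)]
  [FiberBundle F W] [VectorBundle ℂ F W]
  {B : Type*} [NormedAddCommGroup B] [NormedSpace ℂ B]
  {K : Type*} [TopologicalSpace K] {I : ModelWithCorners ℂ B K}
  {N : Type*} [TopologicalSpace N] [ChartedSpace K N]

theorem contMDiffAt_prodBundle_iff {F₁ : Type*} [NormedAddCommGroup F₁] [NormedSpace ℂ F₁]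
    {W₁ : M → Type*} [TopologicalSpace (TotalSpace F₁ W₁)]
    [∀ x, AddCommGroup (W₁ x)] [∀ x, Module ℂ (W₁ x)] [∀ x, TopologicalSpace (W₁ x)]
    [FiberBundle F₁ W₁] [VectorBundle ℂ F₁ W₁]
    {g : N → M} {σ : ∀ q, W (g q)} {τ : ∀ q, W₁ (g q)} {s : N} :
    ContMDiffAt I (𝓘(ℂ, V).prod 𝓘(ℂ, F × F₁)) ω
      (fun q ↦ (⟨g q, (σ q, τ q)⟩ : TotalSpace (F × F₁) (W ×ᵇ W₁))) s ↔
    ContMDiffAt I (𝓘(ℂ, V).prod 𝓘(ℂ, F)) ω (fun q ↦ (⟨g q, σ q⟩ : TotalSpace F W)) s ∧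
    ContMDiffAt I (𝓘(ℂ, V).prod 𝓘(ℂ, F₁)) ω (fun q ↦ (⟨g q, τ q⟩ : TotalSpace F₁ W₁)) s := by
  rw [contMDiffAt_totalSpace, contMDiffAt_totalSpace, contMDiffAt_totalSpace]
  constructor
  · rintro ⟨h1, h2⟩
    obtain ⟨h3, h4⟩ := (contMDiffAt_prod_module_iff _).1 h2
    exact ⟨⟨h1, h3⟩, h1, h4⟩
  · rintro ⟨⟨h1, h2⟩, -, h3⟩
    exact ⟨h1, h2.prodMk_space h3⟩

theorem contMDiffAt_dual_apply {g : N → M} {η : ∀ q, W (g q) →L[ℂ] Bundle.Trivial M ℂ (g q)}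
    {σ : ∀ y, W y} {s : N}
    (hη : ContMDiffAt I (𝓘(ℂ, V).prod 𝓘(ℂ, F →L[ℂ] ℂ)) ω
      (fun q ↦ (⟨g q, η q⟩ : TotalSpace (F →L[ℂ] ℂ) fun y ↦ W y →L[ℂ] Bundle.Trivial M ℂ y)) s)
    (hσ : HolomorphicSectionAt V F σ (g s)) :
    ContMDiffAt I 𝓘(ℂ, ℂ) ω (fun q ↦ η q (σ (g q))) s := by
  have hg := (contMDiffAt_totalSpace.1 hη).1
  have h := ContMDiffAt.clm_bundle_apply (b := g) hη (ContMDiffAt.comp s hσ hg)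
  exact (contMDiffAt_totalSpace.1 h).2

namespace IsParallelTrivialization

variable [IsManifold 𝓘(ℂ, V) ω M] [FiniteDimensional ℂ F] [ContMDiffVectorBundle ω F W 𝓘(ℂ, V)]
  {cov : CovariantDerivative 𝓘(ℂ, V) F W} {U : Set M} {T : ∀ y, W y →L[ℂ] F}
  {S : ∀ y, F →L[ℂ] W y}

/-- Expanding $a$ in a fixed basis of the dual of the model fibre writes the map as a combination,
with holomorphic coefficients, of parallel sections pulled back along $g$. -/
theorem contMDiffAt_comp (hT : IsParallelTrivialization cov U T S) {g : N → M}
    {a : N → F →L[ℂ] ℂ} {s : N} (hg : ContMDiffAt I 𝓘(ℂ, V) ω g s)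
    (ha : ContMDiffAt I 𝓘(ℂ, F →L[ℂ] ℂ) ω a s) (hs : g s ∈ U) :
    ContMDiffAt I (𝓘(ℂ, V).prod 𝓘(ℂ, F →L[ℂ] ℂ)) ω
      (fun q ↦ (⟨g q, a q ∘L T (g q)⟩ :
        TotalSpace (F →L[ℂ] ℂ) fun y ↦ W y →L[ℂ] Bundle.Trivial M ℂ y)) s := by
  let b := Module.finBasis ℂ (F →L[ℂ] ℂ)
  have h := contMDiffAt_sum_smul_section_comp (F := F →L[ℂ] ℂ)
    (W := fun y ↦ W y →L[ℂ] Bundle.Trivial M ℂ y) hg Finset.univ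
    (f := fun i q ↦ b.repr (a q) i) (σ := fun i y ↦ b i ∘L T y)
    (fun i _ ↦ (LinearMap.toContinuousLinearMap (b.coord i)).contMDiff.contMDiffAt.comp s ha)
    (fun i _ ↦ hT.holomorphicSectionAt_dual (b i) hs)
  refine h.congr_of_eventuallyEq (.of_forall fun q ↦ ?_)
  have h1 : a q ∘L T (g q) = ∑ i, b.repr (a q) i • (b i ∘L T (g q)) := by
    ext w
    refine (congrArg (fun l : F →L[ℂ] ℂ ↦ l (T (g q) w)) (b.sum_repr (a q)).symm).trans ?_
    simp [-Module.Basis.sum_repr]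
  exact congrArg (TotalSpace.mk (g q)) h1

theorem contMDiffAt_dual_comp (hT : IsParallelTrivialization cov U T S) {g : N → M}
    {η : ∀ q, W (g q) →L[ℂ] Bundle.Trivial M ℂ (g q)} {s : N}
    (hη : ContMDiffAt I (𝓘(ℂ, V).prod 𝓘(ℂ, F →L[ℂ] ℂ)) ω
      (fun q ↦ (⟨g q, η q⟩ : TotalSpace (F →L[ℂ] ℂ) fun y ↦ W y →L[ℂ] Bundle.Trivial M ℂ y)) s)
    (hs : g s ∈ U) :
    ContMDiffAt I 𝓘(ℂ, F →L[ℂ] ℂ) ω (fun q ↦ (η q ∘L S (g q) : F →L[ℂ] ℂ)) s :=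
  contMDiffAt_clm_of_apply fun c ↦ contMDiffAt_dual_apply hη (hT.holomorphicSectionAt _ hs c)

/-- In a parallel trivialization, a section which is parallel at a point has vanishing
derivative there. -/
theorem hasMFDerivAt_dual_comp (hT : IsParallelTrivialization cov U T S)
    {η : ∀ y, W y →L[ℂ] Bundle.Trivial M ℂ y} {x : M} (hx : x ∈ U)
    (hη : HolomorphicSectionAt V (F →L[ℂ] ℂ) η x)
    (hη' : ∀ X, IsDualDeriv cov (fun y ↦ (η y).toLinearMap) x X 0) :
    HasMFDerivAt 𝓘(ℂ, V) 𝓘(ℂ, F →L[ℂ] ℂ) (fun y ↦ (η y ∘L S y : F →L[ℂ] ℂ)) x 0 := by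
  have h1 : MDifferentiableAt 𝓘(ℂ, V) 𝓘(ℂ, F →L[ℂ] ℂ) (fun y ↦ (η y ∘L S y : F →L[ℂ] ℂ)) x :=
    (hT.contMDiffAt_dual_comp (g := fun y ↦ y) hη hx).mdifferentiableAt (by simp)
  have h2 : (mvfderiv 𝓘(ℂ, V) (fun y ↦ (η y ∘L S y : F →L[ℂ] ℂ)) x : V →L[ℂ] F →L[ℂ] ℂ) = 0 := by
    ext X c
    have h3 := (ContinuousLinearMap.apply ℂ ℂ c).hasFDerivAt.mvfderiv_comp
      (u := fun y ↦ (η y ∘L S y : F →L[ℂ] ℂ)) (x := x) h1 X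
    refine h3.symm.trans ((hη' X _ (hT.holomorphicSectionAt x hx c)).trans ?_)
    rw [hT.cov_eq_zero c hx X]
    simp
  have h4 := h1.hasMFDerivAt
  exact h2 ▸ h4

end IsParallelTrivialization

end BundlePairs

namespace HalfFlatGrassmannManifold

/-! ### Flat coordinates on $H^*\oplus H^*$ and horizontal lifts -/

section DualPairs

variable {V : Type*} [NormedAddCommGroup V] [NormedSpace ℂ V] [FiniteDimensional ℂ V]
  {M : Type*} [TopologicalSpace M] [ChartedSpace V M] [IsManifold 𝓘(ℂ, V) ω M]
  {FE : Type*} [NormedAddCommGroup FE] [NormedSpace ℂ FE] [FiniteDimensional ℂ FE]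
  {E : M → Type*} [TopologicalSpace (TotalSpace FE E)]
  [∀ x, AddCommGroup (E x)] [∀ x, Module ℂ (E x)] [∀ x, TopologicalSpace (E x)]
  [∀ x, IsTopologicalAddGroup (E x)] [∀ x, ContinuousSMul ℂ (E x)]
  [FiberBundle FE E] [VectorBundle ℂ FE E] [ContMDiffVectorBundle ω FE E 𝓘(ℂ, V)]
  {FH : Type*} [NormedAddCommGroup FH] [NormedSpace ℂ FH] [FiniteDimensional ℂ FH]
  {H : M → Type*} [TopologicalSpace (TotalSpace FH H)]
  [∀ x, AddCommGroup (H x)] [∀ x, Module ℂ (H x)] [∀ x, TopologicalSpace (H x)]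
  [∀ x, IsTopologicalAddGroup (H x)] [∀ x, ContinuousSMul ℂ (H x)]
  [FiberBundle FH H] [VectorBundle ℂ FH H] [ContMDiffVectorBundle ω FH H 𝓘(ℂ, V)]

variable (G : HalfFlatGrassmannManifold V M FE E FH H)

/-- The point of `H* ⊕ H*` with given coordinates in a trivialization of `H`. -/
def parallelPair (T : ∀ y, H y →L[ℂ] FH) (p : M × ((FH →L[ℂ] ℂ) × (FH →L[ℂ] ℂ))) :
    DualPairs M FH H :=
  ⟨p.1, (p.2.1 ∘L T p.1, p.2.2 ∘L T p.1)⟩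

/-- The coordinates in the fibre of a point of `H* ⊕ H*`. -/
def pairCoord (S : ∀ y, FH →L[ℂ] H y) (s : DualPairs M FH H) :
    (FH →L[ℂ] ℂ) × (FH →L[ℂ] ℂ) :=
  (s.2.1 ∘L S s.proj, s.2.2 ∘L S s.proj)

variable {cov : CovariantDerivative 𝓘(ℂ, V) FH H} {U : Set M} {T : ∀ y, H y →L[ℂ] FH}
  {S : ∀ y, FH →L[ℂ] H y}

theorem parallelPair_pairCoord (hT : IsParallelTrivialization cov U T S) {s : DualPairs M FH H}
    (hs : s.proj ∈ U) : parallelPair T (s.proj, pairCoord S s) = s := by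
  obtain ⟨x, a, b⟩ := s
  have h1 (a : H x →L[ℂ] Bundle.Trivial M ℂ x) : (a ∘L S x) ∘L T x = a :=
    ContinuousLinearMap.ext fun w ↦ congrArg a (hT.left_inv x hs w)
  exact congrArg (TotalSpace.mk x) (Prod.ext (h1 a) (h1 b))

theorem pairCoord_parallelPair (hT : IsParallelTrivialization cov U T S) {x : M} (hx : x ∈ U)
    (c : (FH →L[ℂ] ℂ) × (FH →L[ℂ] ℂ)) : pairCoord S (parallelPair T (x, c)) = c := by
  have h1 (a : FH →L[ℂ] ℂ) : (a ∘L T x) ∘L S x = a :=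
    ContinuousLinearMap.ext fun w ↦ congrArg a (hT.right_inv x hx w)
  exact Prod.ext (h1 c.1) (h1 c.2)

theorem contMDiffAt_parallelPair (hT : IsParallelTrivialization cov U T S)
    {p : M × ((FH →L[ℂ] ℂ) × (FH →L[ℂ] ℂ))} (hp : p.1 ∈ U) :
    ContMDiffAt (𝓘(ℂ, V).prod 𝓘(ℂ, (FH →L[ℂ] ℂ) × (FH →L[ℂ] ℂ))) (dualPairsModel V FH) ω
      (parallelPair T) p :=
  contMDiffAt_prodBundle_iff.2 ⟨
    hT.contMDiffAt_comp contMDiffAt_fst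
      ((contDiff_fst.contMDiff.contMDiffAt).comp p contMDiffAt_snd) hp,
    hT.contMDiffAt_comp contMDiffAt_fst
      ((contDiff_snd.contMDiff.contMDiffAt).comp p contMDiffAt_snd) hp⟩

theorem contMDiffAt_parallelPair_const (hT : IsParallelTrivialization cov U T S) {x : M}
    (hx : x ∈ U) (c : (FH →L[ℂ] ℂ) × (FH →L[ℂ] ℂ)) :
    ContMDiffAt 𝓘(ℂ, V) (dualPairsModel V FH) ω (fun y ↦ parallelPair T (y, c)) x :=
  ContMDiffAt.comp x (contMDiffAt_parallelPair hT (p := (x, c)) hx)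
    (contMDiffAt_id.prodMk contMDiffAt_const)

theorem contMDiffAt_pairCoord (hT : IsParallelTrivialization cov U T S) {s : DualPairs M FH H}
    (hs : s.proj ∈ U) :
    ContMDiffAt (dualPairsModel V FH) 𝓘(ℂ, (FH →L[ℂ] ℂ) × (FH →L[ℂ] ℂ)) ω (pairCoord S) s := by
  have h1 := contMDiffAt_prodBundle_iff.1 (contMDiffAt_id (I := dualPairsModel V FH) (n := ω)
    (x := s))
  exact (hT.contMDiffAt_dual_comp h1.1 hs).prodMk_space (hT.contMDiffAt_dual_comp h1.2 hs)

/-- The differential of a parallel section is the horizontal lift. -/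
theorem isHorizontalLift_parallelPair (hT : IsParallelTrivialization G.nablaH U T S)
    {s : DualPairs M FH H} (hs : s.proj ∈ U) (Y : TangentSpace 𝓘(ℂ, V) s.proj) :
    G.IsHorizontalLift s Y (mfderiv 𝓘(ℂ, V) (dualPairsModel V FH)
      (fun y ↦ parallelPair T (y, pairCoord S s)) s.proj Y : V × ((FH →L[ℂ] ℂ) × (FH →L[ℂ] ℂ))) := by
  refine ⟨fun y ↦ (pairCoord S s).1 ∘L T y, fun y ↦ (pairCoord S s).2 ∘L T y,
    hT.holomorphicSectionAt_dual _ hs, hT.holomorphicSectionAt_dual _ hs,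
    hT.isDualDeriv_dual _ hs, hT.isDualDeriv_dual _ hs, ?_⟩
  have h1 := parallelPair_pairCoord hT hs
  exact congrArg (fun z : DualPairs M FH H ↦ (⟨z, (mfderiv 𝓘(ℂ, V) (dualPairsModel V FH)
      (fun y ↦ parallelPair T (y, pairCoord S s)) s.proj Y : V × ((FH →L[ℂ] ℂ) × (FH →L[ℂ] ℂ)))⟩ :
      TangentBundle (dualPairsModel V FH) (DualPairs M FH H))) h1

/-- The horizontal lift is unique. -/
theorem IsHorizontalLift.eq_mfderiv {G : HalfFlatGrassmannManifold V M FE E FH H}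
    (hT : IsParallelTrivialization G.nablaH U T S)
    {s : DualPairs M FH H} (hs : s.proj ∈ U) {Y : TangentSpace 𝓘(ℂ, V) s.proj}
    {v : TangentSpace (dualPairsModel V FH) s} (hv : G.IsHorizontalLift s Y v) :
    (v : V × ((FH →L[ℂ] ℂ) × (FH →L[ℂ] ℂ))) = mfderiv 𝓘(ℂ, V) (dualPairsModel V FH)
      (fun y ↦ parallelPair T (y, pairCoord S s)) s.proj Y := by
  obtain ⟨ηp, ηm, hp, hm, hp', hm', h⟩ := hv
  set f : M → DualPairs M FH H := fun y ↦ ⟨y, (ηp y, ηm y)⟩ with hf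
  have hfs : f s.proj = s := congrArg (fun z : TangentBundle (dualPairsModel V FH)
    (DualPairs M FH H) ↦ z.proj) h
  have hv : (mfderiv 𝓘(ℂ, V) (dualPairsModel V FH) f s.proj Y :
      V × ((FH →L[ℂ] ℂ) × (FH →L[ℂ] ℂ))) = v := congrArg (fun z : TangentBundle
      (dualPairsModel V FH) (DualPairs M FH H) ↦ (z.2 : V × ((FH →L[ℂ] ℂ) × (FH →L[ℂ] ℂ)))) h
  have hc : pairCoord S (f s.proj) = pairCoord S s := congrArg _ hfs
  have hD := ((contMDiffAt_parallelPair hT (p := (s.proj, pairCoord S (f s.proj)))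
    hs).mdifferentiableAt (by simp)).hasMFDerivAt
  have hp'' := hT.hasMFDerivAt_dual_comp hs hp hp'
  have hm'' := hT.hasMFDerivAt_dual_comp hs hm hm'
  have h1 : HasMFDerivAt 𝓘(ℂ, V) 𝓘(ℂ, (FH →L[ℂ] ℂ) × (FH →L[ℂ] ℂ)) (fun y ↦ pairCoord S (f y))
      s.proj ((0 : V →L[ℂ] FH →L[ℂ] ℂ).prod 0) :=
    ⟨hp''.1.prodMk hm''.1, hp''.2.prodMk hm''.2⟩
  -- Near $x$ the section is `parallelPair T` of its own coordinates, whose derivative vanishes at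
  -- $x$. To first order it agrees with the section with constant coordinates, so the two
  -- derivatives computed here coincide.
  have h2 := HasMFDerivAt.comp s.proj (g := parallelPair T) hD
    ((hasMFDerivAt_id s.proj).prodMk h1)
  have h3 := HasMFDerivAt.comp s.proj (g := parallelPair T) hD
    ((hasMFDerivAt_id s.proj).prodMk (hasMFDerivAt_const (pairCoord S (f s.proj)) s.proj))
  have h4 : f =ᶠ[𝓝 s.proj] fun y ↦ parallelPair T (y, pairCoord S (f y)) := by
    filter_upwards [hT.isOpen.mem_nhds hs] with y hy
    exact (parallelPair_pairCoord hT (s := f y) hy).symm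
  rw [← hv, ← hc]
  refine (congrArg (fun L : V →L[ℂ] V × ((FH →L[ℂ] ℂ) × (FH →L[ℂ] ℂ)) ↦ L Y)
    (h4.mfderiv_eq.trans h2.mfderiv)).trans ?_
  refine Eq.trans ?_ (congrArg (fun L : V →L[ℂ] V × ((FH →L[ℂ] ℂ) × (FH →L[ℂ] ℂ)) ↦ L Y)
    h3.mfderiv.symm)
  rfl

end DualPairs

end HalfFlatGrassmannManifold

namespace HalfFlatGrassmannManifold

/-! ### From integrable $E^*\otimes h$ to integrable $\mathcal D_\pm$ -/

section LiftDistribution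

variable {V : Type*} [NormedAddCommGroup V] [NormedSpace ℂ V] [FiniteDimensional ℂ V]
  {M : Type*} [TopologicalSpace M] [ChartedSpace V M] [IsManifold 𝓘(ℂ, V) ω M]
  {FE : Type*} [NormedAddCommGroup FE] [NormedSpace ℂ FE] [FiniteDimensional ℂ FE]
  {E : M → Type*} [TopologicalSpace (TotalSpace FE E)]
  [∀ x, AddCommGroup (E x)] [∀ x, Module ℂ (E x)] [∀ x, TopologicalSpace (E x)]
  [∀ x, IsTopologicalAddGroup (E x)] [∀ x, ContinuousSMul ℂ (E x)]
  [FiberBundle FE E] [VectorBundle ℂ FE E] [ContMDiffVectorBundle ω FE E 𝓘(ℂ, V)]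
  {FH : Type*} [NormedAddCommGroup FH] [NormedSpace ℂ FH] [FiniteDimensional ℂ FH]
  {H : M → Type*} [TopologicalSpace (TotalSpace FH H)]
  [∀ x, AddCommGroup (H x)] [∀ x, Module ℂ (H x)] [∀ x, TopologicalSpace (H x)]
  [∀ x, IsTopologicalAddGroup (H x)] [∀ x, ContinuousSMul ℂ (H x)]
  [FiberBundle FH H] [VectorBundle ℂ FH H] [ContMDiffVectorBundle ω FH H 𝓘(ℂ, V)]

variable (G : HalfFlatGrassmannManifold V M FE E FH H)

/-- The component `h_+` or `h_-` of a pair. -/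
def pairComponent (b : Bool) {A : Type*} (p : A × A) : A := cond b p.1 p.2

/-- The common form of the distributions `D_+` and `D_-`. -/
def liftDistribution (b : Bool) (s : DualPairs M FH H) :
    Submodule ℂ (TangentSpace (dualPairsModel V FH) s) :=
  Submodule.span ℂ {v | ∃ e : Module.Dual ℂ (E s.proj),
    G.IsHorizontalLift s (G.tangentEquiv s.proj
      (e ⊗ₜ[ℂ] (pairComponent b s.2 : H s.proj →L[ℂ] Bundle.Trivial M ℂ s.proj).toLinearMap)) v}

variable {U : Set M} {T : ∀ y, H y →L[ℂ] FH} {S : ∀ y, FH →L[ℂ] H y}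

theorem pairComponent_parallelPair (b : Bool) (y : M) (c : (FH →L[ℂ] ℂ) × (FH →L[ℂ] ℂ)) :
    (pairComponent b (parallelPair T (y, c)).2 : H y →L[ℂ] Bundle.Trivial M ℂ y) =
      pairComponent b c ∘L T y := by
  cases b <;> rfl

theorem mfderiv_proj_mfderiv_parallelPair (hT : IsParallelTrivialization G.nablaH U T S) {x : M}
    (hx : x ∈ U) (c : (FH →L[ℂ] ℂ) × (FH →L[ℂ] ℂ)) (Y : V) :
    (mfderiv (dualPairsModel V FH) 𝓘(ℂ, V) (TotalSpace.proj : DualPairs M FH H → M)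
      (parallelPair T (x, c)) (mfderiv 𝓘(ℂ, V) (dualPairsModel V FH)
        (fun y ↦ parallelPair T (y, c)) x Y) : V) = Y := by
  have h1 := mfderiv_comp x (g := (TotalSpace.proj : DualPairs M FH H → M))
    (I'' := 𝓘(ℂ, V)) (((contMDiff_proj _ (n := ω)).contMDiffAt).mdifferentiableAt (by simp))
    ((contMDiffAt_parallelPair_const hT hx c).mdifferentiableAt (by simp))
  exact (congrArg (fun L : V →L[ℂ] V ↦ L Y) (h1.symm.trans mfderiv_id))

theorem mfderiv_proj_mfderiv_pairCoord (hT : IsParallelTrivialization G.nablaH U T S)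
    {s : DualPairs M FH H} (hs : s.proj ∈ U) (Y : V) :
    (mfderiv (dualPairsModel V FH) 𝓘(ℂ, V) (TotalSpace.proj : DualPairs M FH H → M) s
      (mfderiv 𝓘(ℂ, V) (dualPairsModel V FH) (fun y ↦ parallelPair T (y, pairCoord S s)) s.proj Y :
        V × ((FH →L[ℂ] ℂ) × (FH →L[ℂ] ℂ))) : V) = Y := by
  have h1 := G.mfderiv_proj_mfderiv_parallelPair hT hs (pairCoord S s) Y
  refine Eq.trans ?_ h1
  exact congrArg (fun q ↦ (mfderiv (dualPairsModel V FH) 𝓘(ℂ, V)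
    (TotalSpace.proj : DualPairs M FH H → M) q (mfderiv 𝓘(ℂ, V) (dualPairsModel V FH)
      (fun y ↦ parallelPair T (y, pairCoord S s)) s.proj Y :
        V × ((FH →L[ℂ] ℂ) × (FH →L[ℂ] ℂ))) : V)) (parallelPair_pairCoord hT hs).symm

/-- Both conclusions are linear in $v$ and hold for the horizontal lifts of $e\otimes h_\pm$ that
span the distribution. The second one recovers $v$ from its projection to $M$, so vectors of the
distribution are determined downstairs. -/
theorem mem_liftDistribution (hT : IsParallelTrivialization G.nablaH U T S)
    {s : DualPairs M FH H} (hs : s.proj ∈ U) {b : Bool}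
    {v : TangentSpace (dualPairsModel V FH) s} (hv : v ∈ G.liftDistribution b s) :
    mfderiv (dualPairsModel V FH) 𝓘(ℂ, V) (TotalSpace.proj : DualPairs M FH H → M) s v ∈
      G.leafSpace s.proj
        (pairComponent b s.2 : H s.proj →L[ℂ] Bundle.Trivial M ℂ s.proj).toLinearMap ∧
    (mfderiv 𝓘(ℂ, V) (dualPairsModel V FH) (fun y ↦ parallelPair T (y, pairCoord S s)) s.proj
      (mfderiv (dualPairsModel V FH) 𝓘(ℂ, V) (TotalSpace.proj : DualPairs M FH H → M) s v) :
        V × ((FH →L[ℂ] ℂ) × (FH →L[ℂ] ℂ))) = v := by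
  let P : TangentSpace (dualPairsModel V FH) s →L[ℂ] TangentSpace 𝓘(ℂ, V) s.proj :=
    mfderiv (dualPairsModel V FH) 𝓘(ℂ, V) (TotalSpace.proj : DualPairs M FH H → M) s
  let Q : TangentSpace 𝓘(ℂ, V) s.proj →L[ℂ] TangentSpace (dualPairsModel V FH) s :=
    (mfderiv 𝓘(ℂ, V) (dualPairsModel V FH) (fun y ↦ parallelPair T (y, pairCoord S s)) s.proj :
      V →L[ℂ] V × ((FH →L[ℂ] ℂ) × (FH →L[ℂ] ℂ)))
  have h1 : G.liftDistribution b s ≤ (G.leafSpace s.proj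
      (pairComponent b s.2 : H s.proj →L[ℂ] Bundle.Trivial M ℂ s.proj).toLinearMap).comap
        P.toLinearMap ⊓ LinearMap.eqLocus (Q.toLinearMap ∘ₗ P.toLinearMap) LinearMap.id := by
    refine Submodule.span_le.2 ?_
    rintro v ⟨e, he⟩
    have h2 : v = Q (G.tangentEquiv s.proj (e ⊗ₜ[ℂ]
        (pairComponent b s.2 : H s.proj →L[ℂ] Bundle.Trivial M ℂ s.proj).toLinearMap)) :=
      he.eq_mfderiv hT hs
    have h3 : P v = G.tangentEquiv s.proj (e ⊗ₜ[ℂ]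
        (pairComponent b s.2 : H s.proj →L[ℂ] Bundle.Trivial M ℂ s.proj).toLinearMap) :=
      (congrArg P h2).trans (G.mfderiv_proj_mfderiv_pairCoord hT hs _)
    refine ⟨?_, ?_⟩
    · refine Submodule.mem_comap.2 (?_ : P v ∈ _)
      rw [h3]
      exact G.tangentEquiv_mem_leafSpace _ _ _
    · change Q (P v) = v
      rw [h3, ← h2]
  exact h1 hv

theorem mfderiv_parallelPair_mem_liftDistribution (hT : IsParallelTrivialization G.nablaH U T S)
    {s : DualPairs M FH H} (hs : s.proj ∈ U) {b : Bool} {Y : TangentSpace 𝓘(ℂ, V) s.proj}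
    (hY : Y ∈ G.leafSpace s.proj
      (pairComponent b s.2 : H s.proj →L[ℂ] Bundle.Trivial M ℂ s.proj).toLinearMap) :
    ((mfderiv 𝓘(ℂ, V) (dualPairsModel V FH) (fun y ↦ parallelPair T (y, pairCoord S s)) s.proj Y :
      V × ((FH →L[ℂ] ℂ) × (FH →L[ℂ] ℂ))) : TangentSpace (dualPairsModel V FH) s) ∈
      G.liftDistribution b s := by
  obtain ⟨e, rfl⟩ := hY
  exact Submodule.subset_span ⟨e, G.isHorizontalLift_parallelPair hT hs _⟩

/-- Since $\omega_H$ is parallel, its value on two parallel sections is locally constant: a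
horizontal section starting in $S_H$ stays in it. -/
theorem eventually_parallelPair_mem_harmonicSpace (hT : IsParallelTrivialization G.nablaH U T S)
    {x : M} (hx : x ∈ U) {c : (FH →L[ℂ] ℂ) × (FH →L[ℂ] ℂ)}
    (hc : parallelPair T (x, c) ∈ G.harmonicSpace) :
    ∀ᶠ y in 𝓝 x, parallelPair T (y, c) ∈ G.harmonicSpace := by
  have h1 := eventually_eq_of_mvfderiv_eq_zero (V := V) (x := x) (u := fun y ↦ G.omega y
    (c.1 ∘L T y).toLinearMap (c.2 ∘L T y).toLinearMap) (by
      filter_upwards [hT.isOpen.mem_nhds hx] with y hy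
      have h2 := hT.holomorphicSectionAt_dual c.1 hy
      have h3 := hT.holomorphicSectionAt_dual c.2 hy
      refine ⟨(G.omega_holomorphic y _ _ h2 h3).mdifferentiableAt (by simp),
        ContinuousLinearMap.ext fun X ↦ ?_⟩
      refine (G.omega_parallel y _ _ X 0 0 h2 h3 (hT.isDualDeriv_dual c.1 hy X)
        (hT.isDualDeriv_dual c.2 hy X)).trans ?_
      simp)
  filter_upwards [h1] with y hy using hy.trans hc

set_option synthInstance.maxHeartbeats 200000 in
/-- Integrability of the distributions `E* ⊗ h` implies that of `D_±`. -/
theorem isIntegrable_liftDistribution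
    (hint : ∀ (U : Set M) (h : ∀ y, H y →L[ℂ] Bundle.Trivial M ℂ y), IsOpen U →
      G.IsParallelOn h U →
        IsIntegrableDistribution 𝓘(ℂ, V) U (fun x ↦ G.leafSpace x (h x).toLinearMap)) (b : Bool) :
    IsIntegrableDistribution (dualPairsModel V FH) G.harmonicSpace (G.liftDistribution b) := by
  intro X Y s hs hX hY hXD hYD
  have : CompleteSpace V := FiniteDimensional.complete ℂ V
  have : CompleteSpace (V × ((FH →L[ℂ] ℂ) × (FH →L[ℂ] ℂ))) := FiniteDimensional.complete ℂ _
  obtain ⟨U, T, S, hxU, hT⟩ := exists_isParallelTrivialization G.nablaH_holomorphic G.flat s.proj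
  set x := s.proj
  set c := pairCoord S s
  let a : FH →L[ℂ] ℂ := pairComponent b c
  let σ : M → DualPairs M FH H := fun y ↦ parallelPair T (y, c)
  have hσx : σ x = s := parallelPair_pairCoord hT hxU
  have hσ : ContMDiffAt 𝓘(ℂ, V) (dualPairsModel V FH) ω σ x :=
    contMDiffAt_parallelPair_const hT hxU c
  -- The two fields lie in the distribution only along $S_H$; this suffices because the horizontal
  -- section `σ` through `s` has its values there.
  have htend : Filter.Tendsto σ (𝓝 x) (𝓝[G.harmonicSpace] s) := by
    refine tendsto_nhdsWithin_iff.2 ⟨?_, ?_⟩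
    · have h1 := hσ.continuousAt.tendsto
      rwa [hσx] at h1
    · refine G.eventually_parallelPair_mem_harmonicSpace hT hxU ?_
      exact (congrArg (· ∈ G.harmonicSpace) hσx).mpr hs
  -- The field restricted to the image of `σ` and projected to $M$. If it lies in the distribution
  -- on $S_H$, the projection is tangent to $E^*\otimes h_\pm$, with $h_\pm$ the parallel component
  -- of `σ`, and is `σ`-related to the field.
  let push (Z : ∀ q : DualPairs M FH H, TangentSpace (dualPairsModel V FH) q) (y : M) :
      TangentSpace 𝓘(ℂ, V) y :=
    mfderiv (dualPairsModel V FH) 𝓘(ℂ, V) (TotalSpace.proj : DualPairs M FH H → M) (σ y) (Z (σ y))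
  have hpush {Z : ∀ q : DualPairs M FH H, TangentSpace (dualPairsModel V FH) q}
      (hZ : ContMDiffAt (dualPairsModel V FH) (dualPairsModel V FH).tangent ω
        (fun q ↦ (⟨q, Z q⟩ : TangentBundle (dualPairsModel V FH) (DualPairs M FH H))) s)
      (hZD : ∀ᶠ q in 𝓝[G.harmonicSpace] s, Z q ∈ G.liftDistribution b q) :
      HolomorphicSectionAt V V (push Z) x ∧
      (∀ᶠ y in 𝓝 x, push Z y ∈ G.leafSpace y (a ∘L T y).toLinearMap) ∧
      ∀ᶠ y in 𝓝 x, mfderiv 𝓘(ℂ, V) (dualPairsModel V FH) σ y (push Z y) = Z (σ y) := by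
    have h1 : ∀ᶠ y in 𝓝 x, y ∈ U ∧ Z (σ y) ∈ G.liftDistribution b (σ y) :=
      Filter.Eventually.and (hT.isOpen.mem_nhds hxU) (htend.eventually hZD)
    refine ⟨?_, ?_, ?_⟩
    · have h2 : ContMDiff (dualPairsModel V FH).tangent 𝓘(ℂ, V).tangent ω
          (tangentMap (dualPairsModel V FH) 𝓘(ℂ, V) (TotalSpace.proj : DualPairs M FH H → M)) :=
        (contMDiff_proj _ (n := ω)).contMDiff_tangentMap (by simp)
      rw [← hσx] at hZ
      exact h2.contMDiffAt.comp x (hZ.comp x hσ)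
    · filter_upwards [h1] with y hy
      have h3 := (G.mem_liftDistribution hT (s := σ y) hy.1 hy.2).1
      exact (congrArg (fun η : H y →L[ℂ] Bundle.Trivial M ℂ y ↦
        push Z y ∈ G.leafSpace y η.toLinearMap) (pairComponent_parallelPair b y c)).mp h3
    · filter_upwards [h1] with y hy
      have h3 := (G.mem_liftDistribution hT (s := σ y) hy.1 hy.2).2
      rw [pairCoord_parallelPair hT hy.1 c] at h3
      exact h3
  obtain ⟨hX1, hX2, hX3⟩ := hpush hX hXD
  obtain ⟨hY1, hY2, hY3⟩ := hpush hY hYD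
  have hpar : G.IsParallelOn (fun y ↦ a ∘L T y) U := fun y hy ↦
    ⟨hT.holomorphicSectionAt_dual a hy, hT.isDualDeriv_dual a hy⟩
  have hbr := hint U _ hT.isOpen hpar (push X) (push Y) x hxU hX1 hY1
    (hX2.filter_mono nhdsWithin_le_nhds) (hY2.filter_mono nhdsWithin_le_nhds)
  -- The bracket at `s` is thus the image under $d\sigma$ of a bracket on $M$ that lies in
  -- $E^*\otimes h_\pm$, hence a horizontal lift belonging to the distribution.
  have hrel := mfderiv_mlieBracket_of_related hσ hX1 hY1 (hσx ▸ hX) (hσx ▸ hY) hX3 hY3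
  have hmem := G.mfderiv_parallelPair_mem_liftDistribution hT (s := σ x) (b := b) hxU
    (Y := VectorField.mlieBracket 𝓘(ℂ, V) (push X) (push Y) x)
    ((congrArg (fun η : H x →L[ℂ] Bundle.Trivial M ℂ x ↦
      VectorField.mlieBracket 𝓘(ℂ, V) (push X) (push Y) x ∈ G.leafSpace x η.toLinearMap)
        (pairComponent_parallelPair b x c)).mpr hbr)
  rw [pairCoord_parallelPair hT hxU c] at hmem
  have hfin : VectorField.mlieBracket (dualPairsModel V FH) X Y (σ x) ∈
      G.liftDistribution b (σ x) := by
    rw [← hrel]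
    exact hmem
  rwa [hσx] at hfin

end LiftDistribution

end HalfFlatGrassmannManifold

/-- The derivative of a holomorphic family of maps, applied to a holomorphic vector field. -/
theorem contMDiffAt_mfderiv_apply_family {B B' B'' : Type*} [NormedAddCommGroup B]
    [NormedSpace ℂ B] [NormedAddCommGroup B'] [NormedSpace ℂ B'] [NormedAddCommGroup B'']
    [NormedSpace ℂ B''] {K K' K'' : Type*} [TopologicalSpace K] [TopologicalSpace K']
    [TopologicalSpace K''] {I : ModelWithCorners ℂ B K} {I' : ModelWithCorners ℂ B' K'}
    {I'' : ModelWithCorners ℂ B'' K''} {N N' N'' : Type*} [TopologicalSpace N] [ChartedSpace K N]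
    [TopologicalSpace N'] [ChartedSpace K' N'] [TopologicalSpace N''] [ChartedSpace K'' N'']
    [IsManifold I ω N] [IsManifold I' ω N'] [IsManifold I'' ω N'']
    {f : N → N' → N''} {g : N → N'} {s : N}
    (hf : ContMDiffAt (I.prod I') I'' ω (Function.uncurry f) (s, g s))
    (hg : ContMDiffAt I I' ω g s) {v : ∀ q, TangentSpace I' (g q)}
    (hv : ContMDiffAt I I'.tangent ω (fun q ↦ (⟨g q, v q⟩ : TangentBundle I' N')) s) :
    ContMDiffAt I I''.tangent ω (fun q ↦ (⟨f q (g q), mfderiv I' I'' (f q) (g q) (v q)⟩ :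
      TangentBundle I'' N'')) s :=
  ContMDiffAt.clm_apply_of_inCoordinates (ContMDiffAt.mfderiv (m := ω) f g hf hg (by simp)) hv
    (ContMDiffAt.comp (g := Function.uncurry f) (f := fun q ↦ (q, g q)) s hf
      (contMDiffAt_id.prodMk hg))

namespace HalfFlatGrassmannManifold

/-! ### From integrable $\mathcal D_\pm$ to admissibility, and back to $E^*\otimes h$ -/

section LiftFields

variable {V : Type*} [NormedAddCommGroup V] [NormedSpace ℂ V] [FiniteDimensional ℂ V]
  {M : Type*} [TopologicalSpace M] [ChartedSpace V M] [IsManifold 𝓘(ℂ, V) ω M]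
  {FE : Type*} [NormedAddCommGroup FE] [NormedSpace ℂ FE] [FiniteDimensional ℂ FE]
  {E : M → Type*} [TopologicalSpace (TotalSpace FE E)]
  [∀ x, AddCommGroup (E x)] [∀ x, Module ℂ (E x)] [∀ x, TopologicalSpace (E x)]
  [∀ x, IsTopologicalAddGroup (E x)] [∀ x, ContinuousSMul ℂ (E x)]
  [FiberBundle FE E] [VectorBundle ℂ FE E] [ContMDiffVectorBundle ω FE E 𝓘(ℂ, V)]
  {FH : Type*} [NormedAddCommGroup FH] [NormedSpace ℂ FH] [FiniteDimensional ℂ FH]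
  {H : M → Type*} [TopologicalSpace (TotalSpace FH H)]
  [∀ x, AddCommGroup (H x)] [∀ x, Module ℂ (H x)] [∀ x, TopologicalSpace (H x)]
  [∀ x, IsTopologicalAddGroup (H x)] [∀ x, ContinuousSMul ℂ (H x)]
  [FiberBundle FH H] [VectorBundle ℂ FH H] [ContMDiffVectorBundle ω FH H 𝓘(ℂ, V)]

variable (G : HalfFlatGrassmannManifold V M FE E FH H)

variable {U : Set M} {T : ∀ y, H y →L[ℂ] FH} {S : ∀ y, FH →L[ℂ] H y}

/-- The vector field `e ⊗ h_±` along the projection `H* ⊕ H* → M`. -/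
def componentField (b : Bool) (e : ∀ y, Module.Dual ℂ (E y)) (s : DualPairs M FH H) :
    TangentSpace 𝓘(ℂ, V) s.proj :=
  G.tangentEquiv s.proj (e s.proj ⊗ₜ[ℂ]
    (pairComponent b s.2 : H s.proj →L[ℂ] Bundle.Trivial M ℂ s.proj).toLinearMap)

/-- The vector field `X_±^e` on `H* ⊕ H*`: the horizontal lift of `e ⊗ h_±`. -/
def liftField (T : ∀ y, H y →L[ℂ] FH) (S : ∀ y, FH →L[ℂ] H y) (b : Bool)
    (e : ∀ y, Module.Dual ℂ (E y)) (s : DualPairs M FH H) :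
    TangentSpace (dualPairsModel V FH) s :=
  (mfderiv 𝓘(ℂ, V) (dualPairsModel V FH) (fun y ↦ parallelPair T (y, pairCoord S s)) s.proj
    (G.componentField b e s) : V × ((FH →L[ℂ] ℂ) × (FH →L[ℂ] ℂ)))

theorem liftField_mem_liftDistribution (hT : IsParallelTrivialization G.nablaH U T S)
    {s : DualPairs M FH H} (hs : s.proj ∈ U) (b : Bool) (e : ∀ y, Module.Dual ℂ (E y)) :
    G.liftField T S b e s ∈ G.liftDistribution b s :=
  G.mfderiv_parallelPair_mem_liftDistribution hT hs (G.tangentEquiv_mem_leafSpace _ _ _)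

theorem holomorphicSectionAt_tangentEquiv_parallel (hT : IsParallelTrivialization G.nablaH U T S)
    {x : M} (hx : x ∈ U) {e : ∀ y, Module.Dual ℂ (E y)}
    (he : ∀ ε : ∀ y, E y, HolomorphicSectionAt V FE ε x →
      ContMDiffAt 𝓘(ℂ, V) 𝓘(ℂ, ℂ) ω (fun y ↦ e y (ε y)) x) (a : FH →L[ℂ] ℂ) :
    HolomorphicSectionAt V V
      (fun y ↦ G.tangentEquiv y (e y ⊗ₜ[ℂ] (a ∘L T y).toLinearMap)) x :=
  G.holomorphicSectionAt_tangentEquiv he fun _ hκ ↦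
    (hT.holomorphicSectionAt_dual a hx).dual_apply hκ

/-- In flat coordinates $h_\pm$ is a combination of parallel sections whose coefficients are
holomorphic functions on $H^*\oplus H^*$, so $e\otimes h_\pm$ is the same combination of holomorphic
fields on $M$. -/
theorem contMDiffAt_componentField (hT : IsParallelTrivialization G.nablaH U T S)
    {s : DualPairs M FH H} (hs : s.proj ∈ U) (b : Bool) {e : ∀ y, Module.Dual ℂ (E y)}
    (he : ∀ ε : ∀ y, E y, HolomorphicSectionAt V FE ε s.proj →
      ContMDiffAt 𝓘(ℂ, V) 𝓘(ℂ, ℂ) ω (fun y ↦ e y (ε y)) s.proj) :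
    ContMDiffAt (dualPairsModel V FH) 𝓘(ℂ, V).tangent ω
      (fun q : DualPairs M FH H ↦ (⟨q.proj, G.componentField b e q⟩ : TangentBundle 𝓘(ℂ, V) M))
      s := by
  let β := Module.finBasis ℂ (FH →L[ℂ] ℂ)
  have hcomp : ContMDiffAt (dualPairsModel V FH) 𝓘(ℂ, FH →L[ℂ] ℂ) ω
      (fun q : DualPairs M FH H ↦ pairComponent b (pairCoord S q)) s := by
    have h1 := (contMDiffAt_prod_module_iff _).1 (contMDiffAt_pairCoord hT hs)
    cases b
    · exact h1.2
    · exact h1.1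
  have h1 := contMDiffAt_sum_smul_section_comp (F := V) (W := fun y : M ↦ TangentSpace 𝓘(ℂ, V) y)
    ((contMDiff_proj _ (n := ω)).contMDiffAt (x := s)) Finset.univ
    (f := fun i q ↦ β.repr (pairComponent b (pairCoord S q)) i)
    (σ := fun i y ↦ G.tangentEquiv y (e y ⊗ₜ[ℂ] (β i ∘L T y).toLinearMap))
    (fun i _ ↦ (LinearMap.toContinuousLinearMap (β.coord i)).contMDiff.contMDiffAt.comp s hcomp)
    (fun i _ ↦ G.holomorphicSectionAt_tangentEquiv_parallel hT hs he (β i))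
  refine h1.congr_of_eventuallyEq ?_
  filter_upwards [(contMDiff_proj _ (n := ω) (IB := 𝓘(ℂ, V))).continuous.continuousAt.eventually
    (hT.isOpen.mem_nhds hs)] with q hq
  refine congrArg (TotalSpace.mk q.proj) ?_
  have h2 : (pairComponent b q.2 : H q.proj →L[ℂ] Bundle.Trivial M ℂ q.proj).toLinearMap =
      ∑ i, β.repr (pairComponent b (pairCoord S q)) i • (β i ∘L T q.proj).toLinearMap := by
    ext w
    have h3 : (pairComponent b q.2 : H q.proj →L[ℂ] Bundle.Trivial M ℂ q.proj) w =
        pairComponent b (pairCoord S q) (T q.proj w) := by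
      have h4 (a : H q.proj →L[ℂ] Bundle.Trivial M ℂ q.proj) :
        a w = a (S q.proj (T q.proj w)) := by rw [hT.left_inv _ hq]
      cases b
      · exact h4 q.2.2
      · exact h4 q.2.1
    refine h3.trans ((congrArg (fun l : FH →L[ℂ] ℂ ↦ l (T q.proj w))
      (β.sum_repr (pairComponent b (pairCoord S q))).symm).trans ?_)
    simp [-Module.Basis.sum_repr]
  rw [componentField, h2, TensorProduct.tmul_sum, map_sum]
  simp only [TensorProduct.tmul_smul, map_smul]

-- The horizontal section through $q$ depends holomorphically on $q$ through its coordinates, so the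
-- lift is the derivative of a holomorphic family of maps applied to a holomorphic field along the
-- projection.
set_option synthInstance.maxHeartbeats 200000 in
theorem contMDiffAt_liftField (hT : IsParallelTrivialization G.nablaH U T S)
    {s : DualPairs M FH H} (hs : s.proj ∈ U) (b : Bool) {e : ∀ y, Module.Dual ℂ (E y)}
    (he : ∀ ε : ∀ y, E y, HolomorphicSectionAt V FE ε s.proj →
      ContMDiffAt 𝓘(ℂ, V) 𝓘(ℂ, ℂ) ω (fun y ↦ e y (ε y)) s.proj) :
    ContMDiffAt (dualPairsModel V FH) (dualPairsModel V FH).tangent ω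
      (fun q ↦ (⟨q, G.liftField T S b e q⟩ :
        TangentBundle (dualPairsModel V FH) (DualPairs M FH H))) s := by
  have hproj : ContMDiffAt (dualPairsModel V FH) 𝓘(ℂ, V) ω
      (TotalSpace.proj : DualPairs M FH H → M) s := (contMDiff_proj _).contMDiffAt
  let f : DualPairs M FH H → M → DualPairs M FH H := fun q y ↦ parallelPair T (y, pairCoord S q)
  have hf : ContMDiffAt ((dualPairsModel V FH).prod 𝓘(ℂ, V)) (dualPairsModel V FH) ω
      (Function.uncurry f) (s, s.proj) :=
    ContMDiffAt.comp (s, s.proj) (contMDiffAt_parallelPair hT (p := (s.proj, pairCoord S s)) hs)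
      (contMDiffAt_snd.prodMk
        (ContMDiffAt.comp (s, s.proj) (contMDiffAt_pairCoord hT hs) contMDiffAt_fst))
  have h1 := contMDiffAt_mfderiv_apply_family hf hproj (G.contMDiffAt_componentField hT hs b he)
  refine h1.congr_of_eventuallyEq ?_
  filter_upwards [hproj.continuousAt.eventually (hT.isOpen.mem_nhds hs)] with q hq
  exact congrArg (fun z : DualPairs M FH H ↦ (⟨z, (G.liftField T S b e q :
    V × ((FH →L[ℂ] ℂ) × (FH →L[ℂ] ℂ)))⟩ :
      TangentBundle (dualPairsModel V FH) (DualPairs M FH H))) (parallelPair_pairCoord hT hq).symm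

/-- All points of a horizontal section have the same flat coordinates, so one section serves for the
lift at each of them. This makes $e\otimes h$ on $M$ and its lift related along the section. -/
theorem mfderiv_parallelPair_eq_liftField (hT : IsParallelTrivialization G.nablaH U T S)
    {y : M} (hy : y ∈ U) (c : (FH →L[ℂ] ℂ) × (FH →L[ℂ] ℂ)) (b : Bool)
    (e : ∀ y, Module.Dual ℂ (E y)) (a : FH →L[ℂ] ℂ) (ha : pairComponent b c = a) :
    mfderiv 𝓘(ℂ, V) (dualPairsModel V FH) (fun y ↦ parallelPair T (y, c)) y
      (G.tangentEquiv y (e y ⊗ₜ[ℂ] (a ∘L T y).toLinearMap)) =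
        G.liftField T S b e (parallelPair T (y, c)) := by
  subst ha
  have h1 : G.componentField b e (parallelPair T (y, c)) =
      G.tangentEquiv y (e y ⊗ₜ[ℂ] (pairComponent b c ∘L T y).toLinearMap) :=
    congrArg (fun η : H y →L[ℂ] Bundle.Trivial M ℂ y ↦
      G.tangentEquiv y (e y ⊗ₜ[ℂ] η.toLinearMap)) (pairComponent_parallelPair b y c)
  rw [liftField, pairCoord_parallelPair hT hy c, h1]
  rfl

set_option synthInstance.maxHeartbeats 200000 in
/-- Integrability of `D_+` or of `D_-` implies admissibility. -/
theorem isAdmissible_of_isIntegrable_liftDistribution (hH : Module.finrank ℂ FH = 2) (b : Bool)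
    (hint : IsIntegrableDistribution (dualPairsModel V FH) G.harmonicSpace
      (G.liftDistribution b)) : G.IsAdmissible := by
  have : CompleteSpace V := FiniteDimensional.complete ℂ V
  have : CompleteSpace (V × ((FH →L[ℂ] ℂ) × (FH →L[ℂ] ℂ))) := FiniteDimensional.complete ℂ _
  refine G.isAdmissible_iff.2 fun x e₀ e₀' h₀ ↦ (G.torsionTensor_eq_zero_iff hH).2 ?_
  rcases eq_or_ne h₀ 0 with rfl | hh₀
  · simp [torsion]
  obtain ⟨q₀, hq₀⟩ := exists_alternating_apply_eq_one (G.omega_nondegenerate x) hh₀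
  obtain ⟨U, T, S, hxU, hT⟩ := exists_isParallelTrivialization G.nablaH_holomorphic G.flat x
  let coord (h : Module.Dual ℂ (H x)) : FH →L[ℂ] ℂ :=
    LinearMap.toContinuousLinearMap (h ∘ₗ (S x).toLinearMap)
  have hcoord (h : Module.Dual ℂ (H x)) : (coord h ∘L T x).toLinearMap = h :=
    LinearMap.ext fun w ↦ congrArg h (hT.left_inv x hxU w)
  -- The given covector is completed to a symplectic basis on the required side: $(h_0,q_0)$ for
  -- $h_+=h_0$ and $(-q_0,h_0)$ for $h_-=h_0$. The sign is needed because
  -- $\omega_H(-q_0,h_0)=\omega_H(h_0,q_0)=1$.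
  let c : (FH →L[ℂ] ℂ) × (FH →L[ℂ] ℂ) :=
    bif b then (coord h₀, coord q₀) else (coord (-q₀), coord h₀)
  have hc : pairComponent b c = coord h₀ := by cases b <;> rfl
  have hcS : parallelPair T (x, c) ∈ G.harmonicSpace := by
    cases b
    · change G.omega x (coord (-q₀) ∘L T x).toLinearMap (coord h₀ ∘L T x).toLinearMap = 1
      rw [hcoord, hcoord, map_neg, LinearMap.neg_apply, (G.omega_alt x).neg_eq]
      exact hq₀
    · change G.omega x (coord h₀ ∘L T x).toLinearMap (coord q₀ ∘L T x).toLinearMap = 1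
      rw [hcoord, hcoord]
      exact hq₀
  obtain ⟨e, rfl, he⟩ := exists_holomorphic_dual_eq (V := V) (FE := FE) e₀
  obtain ⟨e', rfl, he'⟩ := exists_holomorphic_dual_eq (V := V) (FE := FE) e₀'
  have hσ := contMDiffAt_parallelPair_const (V := V) hT hxU c
  have hproj : ContinuousAt (TotalSpace.proj : DualPairs M FH H → M) (parallelPair T (x, c)) :=
    (contMDiff_proj _ (n := ω) (IB := 𝓘(ℂ, V))).continuous.continuousAt
  have hD (e : ∀ y, Module.Dual ℂ (E y)) : ∀ᶠ s in 𝓝[G.harmonicSpace] (parallelPair T (x, c)),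
      G.liftField T S b e s ∈ G.liftDistribution b s := by
    refine Filter.Eventually.filter_mono nhdsWithin_le_nhds ?_
    filter_upwards [hproj.eventually (hT.isOpen.mem_nhds hxU)] with s hs
    exact G.liftField_mem_liftDistribution hT hs b e
  have hL := G.contMDiffAt_liftField hT (s := parallelPair T (x, c)) hxU b he
  have hL' := G.contMDiffAt_liftField hT (s := parallelPair T (x, c)) hxU b he'
  have hZ := G.holomorphicSectionAt_tangentEquiv_parallel hT hxU he (coord h₀)
  have hZ' := G.holomorphicSectionAt_tangentEquiv_parallel hT hxU he' (coord h₀)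
  have hbr := hint _ _ _ hcS hL hL' (hD e) (hD e')
  have hrel := mfderiv_mlieBracket_of_related hσ hZ hZ' hL hL'
    (by
      filter_upwards [hT.isOpen.mem_nhds hxU] with y hy
      exact G.mfderiv_parallelPair_eq_liftField hT hy c b e _ hc)
    (by
      filter_upwards [hT.isOpen.mem_nhds hxU] with y hy
      exact G.mfderiv_parallelPair_eq_liftField hT hy c b e' _ hc)
  -- Projecting the bracket of the lifted fields to $M$ gives back the bracket of $e\otimes h$ and
  -- $e'\otimes h$, with $h$ the parallel extension of $h_0$. It lies in $E^*\otimes h_0$ at $x$,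
  -- and hence so does the torsion.
  have hmem := (G.mem_liftDistribution hT (s := parallelPair T (x, c)) hxU hbr).1
  rw [← hrel] at hmem
  have hmem' := (congrArg (· ∈ G.leafSpace x (pairComponent b (parallelPair T (x, c)).2 :
    H x →L[ℂ] Bundle.Trivial M ℂ x).toLinearMap)
      (G.mfderiv_proj_mfderiv_parallelPair hT hxU c _)).mp hmem
  have hcx : (pairComponent b (parallelPair T (x, c)).2 :
      H x →L[ℂ] Bundle.Trivial M ℂ x) = coord h₀ ∘L T x :=
    (pairComponent_parallelPair b x c).trans (congrArg (fun a : FH →L[ℂ] ℂ ↦ a ∘L T x) hc)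
  rw [hcx] at hmem'
  have hfin := (G.mlieBracket_mem_leafSpace_iff hH (x := x) (h := fun y ↦ coord h₀ ∘L T y)
    (by
      filter_upwards [hT.isOpen.mem_nhds hxU] with y hy
      exact ⟨hT.holomorphicSectionAt_dual _ hy, hT.isDualDeriv_dual _ hy⟩) hZ hZ'
    (.of_forall fun y ↦ G.tangentEquiv_mem_leafSpace _ _ _)
    (.of_forall fun y ↦ G.tangentEquiv_mem_leafSpace _ _ _)).1 hmem'
  simp only [hcoord] at hfin
  exact hfin

/-- Admissibility implies the integrability of the distributions `E* ⊗ h`, `h` parallel. -/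
theorem isIntegrable_leafSpace_of_isAdmissible (hH : Module.finrank ℂ FH = 2)
    (hG : G.IsAdmissible) {U : Set M} {h : ∀ y, H y →L[ℂ] Bundle.Trivial M ℂ y} (hU : IsOpen U)
    (hh : G.IsParallelOn h U) :
    IsIntegrableDistribution 𝓘(ℂ, V) U (fun x ↦ G.leafSpace x (h x).toLinearMap) := by
  intro X Y x hx hX hY hXh hYh
  rw [hU.nhdsWithin_eq hx] at hXh hYh
  refine (G.mlieBracket_mem_leafSpace_iff hH (by
    filter_upwards [hU.mem_nhds hx] with y hy using hh y hy) hX hY hXh hYh).2 ?_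
  obtain ⟨e, he⟩ := hXh.self_of_nhds
  obtain ⟨e', he'⟩ := hYh.self_of_nhds
  rw [← he, ← he']
  exact (G.torsionTensor_eq_zero_iff hH).1 (G.isAdmissible_iff.1 hG x e e' (h x).toLinearMap)

end LiftFields

end HalfFlatGrassmannManifold

end

theorem mainTheorem8
    {V : Type*} [NormedAddCommGroup V] [NormedSpace ℂ V] [FiniteDimensional ℂ V]
    {M : Type*} [TopologicalSpace M] [ChartedSpace V M] [IsManifold 𝓘(ℂ, V) ω M]
    {FE : Type*} [NormedAddCommGroup FE] [NormedSpace ℂ FE] [FiniteDimensional ℂ FE]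
    {E : M → Type*} [TopologicalSpace (TotalSpace FE E)]
    [∀ x, AddCommGroup (E x)] [∀ x, Module ℂ (E x)] [∀ x, TopologicalSpace (E x)]
    [∀ x, IsTopologicalAddGroup (E x)] [∀ x, ContinuousSMul ℂ (E x)]
    [FiberBundle FE E] [VectorBundle ℂ FE E] [ContMDiffVectorBundle ω FE E 𝓘(ℂ, V)]
    {FH : Type*} [NormedAddCommGroup FH] [NormedSpace ℂ FH] [FiniteDimensional ℂ FH]
    {H : M → Type*} [TopologicalSpace (TotalSpace FH H)]
    [∀ x, AddCommGroup (H x)] [∀ x, Module ℂ (H x)] [∀ x, TopologicalSpace (H x)]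
    [∀ x, IsTopologicalAddGroup (H x)] [∀ x, ContinuousSMul ℂ (H x)]
    [FiberBundle FH H] [VectorBundle ℂ FH H] [ContMDiffVectorBundle ω FH H 𝓘(ℂ, V)]
    (hH : Module.finrank ℂ FH = 2)
    (G : HalfFlatGrassmannManifold V M FE E FH H) :
    List.TFAE [
      ∀ (U : Set M) (h : ∀ y, H y →L[ℂ] Bundle.Trivial M ℂ y), IsOpen U → G.IsParallelOn h U →
        IsIntegrableDistribution 𝓘(ℂ, V) U (fun x ↦ G.leafSpace x (h x).toLinearMap),
      IsIntegrableDistribution (HalfFlatGrassmannManifold.dualPairsModel V FH)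
        G.harmonicSpace G.Dplus,
      IsIntegrableDistribution (HalfFlatGrassmannManifold.dualPairsModel V FH)
        G.harmonicSpace G.Dminus,
      G.IsAdmissible] := by
  -- `Dplus` and `Dminus` are `liftDistribution` at `true` and `false` by unfolding, so both signs
  -- are instances of one argument.
  tfae_have 1 → 2 := fun h ↦ G.isIntegrable_liftDistribution h true
  tfae_have 1 → 3 := fun h ↦ G.isIntegrable_liftDistribution h false
  tfae_have 2 → 4 := G.isAdmissible_of_isIntegrable_liftDistribution hH true
  tfae_have 3 → 4 := G.isAdmissible_of_isIntegrable_liftDistribution hH false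
  tfae_have 4 → 1 := fun hG _ _ hU hh ↦ G.isIntegrable_leafSpace_of_isAdmissible hH hG hU hh
  tfae_finish
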